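/- Let $N\ge 3$, $2^*=\frac{2N}{N-2}$, and let $f\in C^1([0,\infty))$ satisfy $f(0)=0$, $f(s)>0$ for $s>0$, and, for some $\alpha,\beta\in(2,2^*)$ and $\mu_1,\mu_2>0$, $$\lim_{t\to0^+}\frac{f'(t)}{t^{\alpha-2}}=\mu_1(\alpha-1),\qquad \lim_{t\to+\infty}\frac{f'(t)}{t^{\beta-2}}=\mu_2(\beta-1).$$ Extend $f$ by $0$ to $(-\infty,0)$ and put $F(s)=\int_0^s f(t)\,dt$. For $k>0$ let $g=g_k:\mathbb R\to\mathbb R$ be the even function with $$g(t)=\sqrt{1-kt^2}\ \text{ for } 0\le t<\sqrt{\tfrac1{3k}},\qquad g(t)=\frac{1}{3\sqrt{2k}\,t}+\sqrt{\tfrac16}\ \text{ for } t\ge\sqrt{\tfrac1{3k}},$$ let $G(t)=\int_0^t g(s)\,ds$, an increasing bijection of $\mathbb R$, and let $G^{-1}$ be its inverse. For $\lambda>0$ consider $$-\Delta v+\lambda\,\frac{G^{-1}(v)}{g(G^{-1}(v))}=\frac{f(G^{-1}(v))}{g(G^{-1}(v))}\quad\text{in }\mathbb R^N,\qquad v\in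 H^1(\mathbb R^N), \tag{2.7}$$ in the weak sense, its energy functional on $H^1(\mathbb R^N)$ $$I_{\lambda}(v)=\frac12\int_{\mathbb R^N}|\nabla v|^2\,dx+\frac\lambda2\int_{\mathbb R^N}|G^{-1}(v)|^2\,dx-\int_{\mathbb R^N}F(G^{-1}(v))\,dx,$$ and its mountain pass level $$m_\lambda=\inf_{\gamma\in\Gamma_\lambda}\max_{t\in[0,1]}I_\lambda(\gamma(t)),\qquad \Gamma_\lambda=\{\gamma\in C([0,1],H^1(\mathbb R^N)):\gamma(0)=0,\ I_\lambda(\gamma(1))<0\}.$$ Then for every $\lambda>0$ there is a constant $C_1>0$, independent of $k$, such that for every $k>0$ every positive solution $v_\lambda\in H^1(\mathbb R^N)$ of (2.7) with $I_\lambda(v_\lambda)=m_\lambda$ satisfies $v_\lambda\in L^\infty(\mathbb R^N)$ and $\|v_\lambda\|_\infty\le C_1$. -/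

import Mathlib

open MeasureTheory Set Filter Topology
open scoped ContDiff

noncomputable section

namespace QLS

/-- `ℝᴺ` with its Euclidean norm. -/
abbrev E (N : ℕ) := EuclideanSpace ℝ (Fin N)

/-- Test functions: smooth and compactly supported. -/
def IsTest {N : ℕ} (φ : E N → ℝ) : Prop := ContDiff ℝ ∞ φ ∧ HasCompactSupport φ

/-- `w` is the weak (distributional) gradient of `v`. -/
def IsWeakGradient {N : ℕ} (v : E N → ℝ) (w : E N → E N) : Prop :=
  ∀ φ : E N → ℝ, IsTest φ → ∀ y : E N,
    ∫ x, v x * fderiv ℝ φ x y = - ∫ x, φ x * inner ℝ (w x) y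

theorem IsTest.memLp {N : ℕ} {φ : E N → ℝ} (hφ : IsTest φ) : MemLp φ 2 volume :=
  hφ.1.continuous.memLp_of_hasCompactSupport hφ.2

theorem IsTest.memLp_fderiv {N : ℕ} {φ : E N → ℝ} (hφ : IsTest φ) (y : E N) :
    MemLp (fun x => fderiv ℝ φ x y) 2 volume := by
  refine Continuous.memLp_of_hasCompactSupport ?_ ?_
  · exact (hφ.1.continuous_fderiv (by simp)).clm_apply continuous_const
  · exact (hφ.2.fderiv (𝕜 := ℝ)).comp_left (g := fun L : E N →L[ℝ] ℝ => L y) rfl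

theorem IsTest.integrable_left {N : ℕ} {φ : E N → ℝ} (hφ : IsTest φ) (y : E N)
    (v : Lp ℝ 2 (volume : Measure (E N))) :
    Integrable (fun x => v x * fderiv ℝ φ x y) volume :=
  (Lp.memLp v).integrable_mul (hφ.memLp_fderiv y)

theorem IsTest.integrable_right {N : ℕ} {φ : E N → ℝ} (hφ : IsTest φ) (y : E N)
    (w : Lp (E N) 2 (volume : Measure (E N))) :
    Integrable (fun x => φ x * inner ℝ (w x) y) volume :=
  hφ.memLp.integrable_mul ((Lp.memLp w).inner_const y)

/-- The Sobolev space `H¹(ℝᴺ)`, as the space of pairs `(v, ∇v)` of square-integrable classes in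
which the second is the weak gradient of the first. The norm inherited from the product,
`max ‖v‖₂ ‖∇v‖₂`, is equivalent to the usual one. -/
def H1 (N : ℕ) :
    Submodule ℝ (Lp ℝ 2 (volume : Measure (E N)) × Lp (E N) 2 (volume : Measure (E N))) where
  carrier := {p | IsWeakGradient (p.1 : E N → ℝ) (p.2 : E N → E N)}
  zero_mem' := by
    intro φ hφ y
    have h1 : ∫ x, ((0 : Lp ℝ 2 (volume : Measure (E N))) : E N → ℝ) x * fderiv ℝ φ x y = 0 := by
      refine integral_eq_zero_of_ae ?_
      filter_upwards [Lp.coeFn_zero ℝ 2 (volume : Measure (E N))] with x hx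
      simp
    have h2 : ∫ x, φ x *
        inner ℝ (((0 : Lp (E N) 2 (volume : Measure (E N))) : E N → E N) x) y = 0 := by
      refine integral_eq_zero_of_ae ?_
      filter_upwards [Lp.coeFn_zero (E N) 2 (volume : Measure (E N))] with x hx
      simp
    simp only [Prod.fst_zero, Prod.snd_zero, h1, h2, neg_zero]
  add_mem' := by
    intro p q hp hq φ hφ y
    have h1 : ∫ x, ((p.1 + q.1 : Lp ℝ 2 (volume : Measure (E N))) : E N → ℝ) x * fderiv ℝ φ x y
        = (∫ x, p.1 x * fderiv ℝ φ x y) + ∫ x, q.1 x * fderiv ℝ φ x y := by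
      rw [← integral_add (hφ.integrable_left y _) (hφ.integrable_left y _)]
      refine integral_congr_ae ?_
      filter_upwards [Lp.coeFn_add p.1 q.1] with x hx
      rw [hx, Pi.add_apply, add_mul]
    have h2 : ∫ x, φ x *
        inner ℝ (((p.2 + q.2 : Lp (E N) 2 (volume : Measure (E N))) : E N → E N) x) y
        = (∫ x, φ x * inner ℝ (p.2 x) y) + ∫ x, φ x * inner ℝ (q.2 x) y := by
      rw [← integral_add (hφ.integrable_right y _) (hφ.integrable_right y _)]
      refine integral_congr_ae ?_
      filter_upwards [Lp.coeFn_add p.2 q.2] with x hx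
      rw [hx, Pi.add_apply, inner_add_left, mul_add]
    simp only [Prod.fst_add, Prod.snd_add, h1, h2, hp φ hφ y, hq φ hφ y]
    ring
  smul_mem' := by
    intro c p hp φ hφ y
    have h1 : ∫ x, ((c • p.1 : Lp ℝ 2 (volume : Measure (E N))) : E N → ℝ) x * fderiv ℝ φ x y
        = c * ∫ x, p.1 x * fderiv ℝ φ x y := by
      rw [← integral_const_mul]
      refine integral_congr_ae ?_
      filter_upwards [Lp.coeFn_smul c p.1] with x hx
      rw [hx, Pi.smul_apply, smul_eq_mul, mul_assoc]
    have h2 : ∫ x, φ x *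
        inner ℝ (((c • p.2 : Lp (E N) 2 (volume : Measure (E N))) : E N → E N) x) y
        = c * ∫ x, φ x * inner ℝ (p.2 x) y := by
      rw [← integral_const_mul]
      refine integral_congr_ae ?_
      filter_upwards [Lp.coeFn_smul c p.2] with x hx
      rw [hx, Pi.smul_apply, real_inner_smul_left]
      ring
    simp only [Prod.smul_fst, Prod.smul_snd, h1, h2, hp φ hφ y]
    ring

/-- The function underlying an element of `H¹(ℝᴺ)`. -/
def fn {N : ℕ} (v : H1 N) : E N → ℝ := v.1.1

/-- The weak gradient of an element of `H¹(ℝᴺ)`. -/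
def grad {N : ℕ} (v : H1 N) : E N → E N := v.1.2

/-- The even function `g` with parameter `k > 0`: `√(1 - k t²)` for `|t| < √(1/(3k))` and
`1 / (3 √(2k) |t|) + √(1/6)` otherwise. -/
def g (k t : ℝ) : ℝ :=
  if |t| < √(1 / (3 * k)) then √(1 - k * t ^ 2)
  else 1 / (3 * √(2 * k) * |t|) + √(1 / 6)

/-- `G(t) = ∫₀ᵗ g(s) ds`. -/
def G (k t : ℝ) : ℝ := ∫ s in (0 : ℝ)..t, g k s

/-- The inverse `G⁻¹`; for `k > 0` the function `G` is an increasing bijection of `ℝ`. -/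
def Ginv (k : ℝ) : ℝ → ℝ := Function.invFun (G k)

/-- Condition (F₁): `f ∈ C¹[0, ∞)`, `f(0) = 0` and `f > 0` on `(0, ∞)`. -/
def CondF1 (f : ℝ → ℝ) : Prop :=
  ContDiffOn ℝ 1 f (Ici 0) ∧ f 0 = 0 ∧ ∀ s, 0 < s → 0 < f s

/-- Condition (F₂): power behaviour of `f'` at `0⁺` and at `+∞` with subcritical exponents. -/
def CondF2 (N : ℕ) (f : ℝ → ℝ) : Prop :=
  ∃ α β μ₁ μ₂ : ℝ, 0 < μ₁ ∧ 0 < μ₂ ∧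
    2 < α ∧ α < 2 * N / (N - 2) ∧ 2 < β ∧ β < 2 * N / (N - 2) ∧
    Tendsto (fun t : ℝ => deriv f t / t ^ (α - 2)) (𝓝[>] 0) (𝓝 (μ₁ * (α - 1))) ∧
    Tendsto (fun t : ℝ => deriv f t / t ^ (β - 2)) atTop (𝓝 (μ₂ * (β - 1)))

/-- `f`, given on `[0, ∞)` with `f(0) = 0`, extended by zero to the negative half-line. -/
def ext (f : ℝ → ℝ) (s : ℝ) : ℝ := f (max s 0)

/-- The primitive `F(s) = ∫₀ˢ f(t) dt`. -/
def F (f : ℝ → ℝ) (s : ℝ) : ℝ := ∫ t in (0 : ℝ)..s, ext f t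

/-- `v ∈ H¹(ℝᴺ)` is a weak solution of
`-Δv + lam * G⁻¹(v) / g(G⁻¹(v)) = f(G⁻¹(v)) / g(G⁻¹(v))` in `ℝᴺ`. -/
def IsWeakSolution {N : ℕ} (f : ℝ → ℝ) (lam k : ℝ) (v : H1 N) : Prop :=
  ∀ φ : E N → ℝ, IsTest φ →
    ∫ x, (fderiv ℝ φ x (grad v x)
        + lam * (Ginv k (fn v x) / g k (Ginv k (fn v x))) * φ x)
      = ∫ x, ext f (Ginv k (fn v x)) / g k (Ginv k (fn v x)) * φ x

/-- The energy functional
`I(v) = ½ ∫ |∇v|² + (lam / 2) ∫ |G⁻¹(v)|² - ∫ F(G⁻¹(v))` on `H¹(ℝᴺ)`. -/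
def energy {N : ℕ} (f : ℝ → ℝ) (lam k : ℝ) (v : H1 N) : ℝ :=
  1 / 2 * (∫ x, ‖grad v x‖ ^ 2) + lam / 2 * (∫ x, Ginv k (fn v x) ^ 2)
    - (∫ x, F f (Ginv k (fn v x)))

/-- The admissible paths: continuous `γ : [0,1] → H¹(ℝᴺ)` with `γ(0) = 0` and `I(γ(1)) < 0`. -/
def paths (N : ℕ) (f : ℝ → ℝ) (lam k : ℝ) : Set C(unitInterval, H1 N) :=
  {γ | γ 0 = 0 ∧ energy f lam k (γ 1) < 0}

/-- The mountain pass level `inf_γ max_t I(γ(t))`. -/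
def mpLevel (N : ℕ) (f : ℝ → ℝ) (lam k : ℝ) : ℝ :=
  ⨅ γ : paths N f lam k, ⨆ t : unitInterval, energy f lam k (γ.1 t)

/-- `v` is a positive solution at the mountain pass level. -/
structure IsMPSolution {N : ℕ} (f : ℝ → ℝ) (lam k : ℝ) (v : H1 N) : Prop where
  pos : ∀ᵐ x, 0 < fn v x
  sol : IsWeakSolution f lam k v
  level : energy f lam k v = mpLevel N f lam k

end QLS

end

noncomputable section

namespace QLS

/-! Write p = 2* and H(s) = F(G⁻¹(s)) - (λ/2) G⁻¹(s)², so that the equation reads -Δv = h(v) with h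
= H' and the energy is ½∫|∇v|² - ∫H(v).

The sup bound comes from two estimates uniform in `k`. Since 1/3 ≤ g ≤ 1 whatever `k` is, s ≤ G⁻¹(s)
≤ 3s for s ≥ 0. By (F₁) and (F₂), f(u) ≤ λu + K u^(q-1) with 2 < q < p (`exists_growth_bound`). The
linear term of the equation absorbs λu exactly, so a positive solution satisfies -Δv ≤ 3^q K v^(q-1)
(`IsMPSolution.isPowerSubsolution`). De Giorgi iteration (`exists_bound_of_isPowerSubsolution`) then
bounds v in terms of N, K, q and an upper bound for ‖∇v‖₂ alone.

It remains to bound ‖∇v‖₂ independently of `k`. The Pohozaev identity N∫H(v) = ((N-2)/2)∫|∇v|²,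
inserted in the energy, gives ∫|∇v|² = N m_λ (`IsMPSolution.integral_grad_sq`). The level is at most
the maximum of the energy along a segment from 0 to a multiple of a fixed bump, and that multiple
can be chosen independently of `k` (`exists_mpLevel_bound`).

The Pohozaev identity is obtained without second derivatives of v. The equation is tested with
η(v(t·) - v), η a cutoff at radius R. Taylor's formula for H bounds the right side below, convexity
of |·|² bounds the left side above, and up to errors the resulting quantities depend on t through
explicit powers. The inequality holds for t on both sides of 1, so differentiating at t = 1 gives
two opposite inequalities; letting R → ∞ and then weakening the Young parameter removes the errors.
The Taylor remainder needs v bounded, so De Giorgi's theorem is used twice: first with the gradient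
norm of the given v, to justify Pohozaev, then with the uniform gradient bound. -/

/-! ### Translation and mollification in L² -/

/-- Translations act continuously on `L²`, at the identity. -/
theorem tendsto_eLpNorm_translate_sub {N : ℕ} {F : Type*} [NormedAddCommGroup F]
    {w : E N → F} (hw : MemLp w 2 volume) :
    Tendsto (fun y : E N => eLpNorm (fun x => w (x - y) - w x) 2 volume) (𝓝 0) (𝓝 0) := by
  let c : E N → C(E N, E N) := fun y => ⟨fun x => x - y, by fun_prop⟩
  have hc : Continuous c :=
    ContinuousMap.continuous_of_continuous_uncurry _ (by
      change Continuous fun p : E N × E N => p.2 - p.1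
      fun_prop)
  have hmp : ∀ y, MeasurePreserving (c y) volume volume := fun y =>
    measurePreserving_sub_right volume y
  have h := Filter.Tendsto.compMeasurePreservingLp (f := fun _ : E N => hw.toLp w)
    (f₀ := hw.toLp w) (l := 𝓝 (0 : E N)) (p := 2) tendsto_const_nhds (hc.tendsto 0) hmp (hmp 0)
    (by simp)
  rw [Lp.tendsto_Lp_iff_tendsto_eLpNorm'] at h
  refine h.congr fun y => ?_
  refine eLpNorm_congr_ae ?_
  have h1 := Lp.coeFn_compMeasurePreserving (hw.toLp w) (hmp y)
  have h2 := Lp.coeFn_compMeasurePreserving (hw.toLp w) (hmp 0)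
  have h3 := (hmp y).quasiMeasurePreserving.ae (hw.coeFn_toLp)
  have h4 := (hmp 0).quasiMeasurePreserving.ae (hw.coeFn_toLp)
  filter_upwards [h1, h2, h3, h4] with x h1 h2 h3 h4
  simp only [Pi.sub_apply]
  rw [h1, h2, Function.comp, Function.comp, h3, h4]
  simp [c]

/-- Jensen's inequality for the square, with respect to the probability measure |ρ(y)| dy. -/
theorem enorm_integral_smul_sq_le {N : ℕ} {F : Type*} [NormedAddCommGroup F] [NormedSpace ℝ F]
    {ρ : E N → ℝ} (hρ : Measurable ρ) (hρ1 : ∫⁻ y, ‖ρ y‖ₑ = 1) {d : E N → F}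
    (hd : AEStronglyMeasurable d volume) :
    ‖∫ y, ρ y • d y‖ₑ ^ 2 ≤ ∫⁻ y, ‖ρ y‖ₑ * ‖d y‖ₑ ^ 2 := by
  let ν : Measure (E N) := volume.withDensity fun y => ‖ρ y‖ₑ
  have hν : IsProbabilityMeasure ν := ⟨by simp [ν, hρ1]⟩
  have hdν : AEStronglyMeasurable d ν := hd.mono_ac (withDensity_absolutelyContinuous _ _)
  have h1 : ‖∫ y, ρ y • d y‖ₑ ≤ eLpNorm d 1 ν := by
    refine (enorm_integral_le_lintegral_enorm _).trans ?_
    rw [eLpNorm_one_eq_lintegral_enorm, lintegral_withDensity_eq_lintegral_mul₀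
      hρ.enorm.aemeasurable hd.enorm]
    simp [enorm_smul]
  have h2 : eLpNorm d 2 ν ^ 2 = ∫⁻ y, ‖ρ y‖ₑ * ‖d y‖ₑ ^ 2 := by
    rw [eLpNorm_eq_lintegral_rpow_enorm_toReal (by simp) (by simp),
      lintegral_withDensity_eq_lintegral_mul₀ hρ.enorm.aemeasurable (by fun_prop)]
    rw [← ENNReal.rpow_natCast, ← ENNReal.rpow_mul]
    simp
  calc ‖∫ y, ρ y • d y‖ₑ ^ 2 ≤ eLpNorm d 1 ν ^ 2 := by gcongr
    _ ≤ eLpNorm d 2 ν ^ 2 := by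
        gcongr
        exact eLpNorm_le_eLpNorm_of_exponent_le (by norm_num) hdν
    _ = _ := h2

theorem eLpNorm_two_sq {α F : Type*} [MeasurableSpace α] [NormedAddCommGroup F] {μ : Measure α}
    (d : α → F) : eLpNorm d 2 μ ^ 2 = ∫⁻ y, ‖d y‖ₑ ^ 2 ∂μ := by
  rw [eLpNorm_eq_lintegral_rpow_enorm_toReal (by simp) (by simp),
    ← ENNReal.rpow_natCast, ← ENNReal.rpow_mul]
  simp

/-- Averaging against a probability density moves a function in `L²` by at most the largest
distance between the function and its translates over the support of the density. -/
theorem eLpNorm_convolution_sub_le {N : ℕ} {F : Type*} [NormedAddCommGroup F] [NormedSpace ℝ F]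
    [CompleteSpace F] {ρ : E N → ℝ} (hρ : Continuous ρ) (hρc : HasCompactSupport ρ)
    (hρ0 : ∀ y, 0 ≤ ρ y) (hρ1 : ∫ y, ρ y = 1) {w : E N → F} (hw : MemLp w 2 volume)
    {δ : ENNReal} (hδ : ∀ y, ρ y ≠ 0 → eLpNorm (fun x => w (x - y) - w x) 2 volume ≤ δ) :
    eLpNorm (fun x => convolution ρ w (ContinuousLinearMap.lsmul ℝ ℝ) volume x - w x) 2 volume
      ≤ δ := by
  have hρi : Integrable ρ := hρ.integrable_of_hasCompactSupport hρc
  have hρ1' : ∫⁻ y, ‖ρ y‖ₑ = 1 := by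
    have := ofReal_integral_eq_lintegral_ofReal hρi (ae_of_all _ hρ0)
    rw [hρ1, ENNReal.ofReal_one] at this
    rw [this]
    exact lintegral_congr fun y => Real.enorm_of_nonneg (hρ0 y)
  have hloc : LocallyIntegrable w volume := hw.locallyIntegrable (by norm_num)
  have hex := hρc.convolutionExists_left (ContinuousLinearMap.lsmul ℝ ℝ) hρ hloc
  have hpt : ∀ x, convolution ρ w (ContinuousLinearMap.lsmul ℝ ℝ) volume x - w x
      = ∫ y, ρ y • (w (x - y) - w x) := by
    intro x
    have h1 : Integrable (fun y => ρ y • w (x - y)) volume := hex x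
    simp_rw [smul_sub]
    rw [integral_sub h1 (hρi.smul_const _), integral_smul_const, hρ1, one_smul]
    rfl
  have hmeas : AEStronglyMeasurable (fun p : E N × E N => w (p.1 - p.2) - w p.1)
      (volume.prod volume) :=
    (hw.1.comp_quasiMeasurePreserving (quasiMeasurePreserving_sub_of_right_invariant _ _)).sub
      hw.1.comp_fst
  have hsec : ∀ x, AEStronglyMeasurable (fun y => w (x - y) - w x) volume := fun x =>
    (hw.1.comp_quasiMeasurePreserving (quasiMeasurePreserving_sub_left _ x)).sub
      aestronglyMeasurable_const
  -- Jensen in y at each x, then Tonelli. For fixed y the integral in x is the squared distance from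
  -- w to its translate, which is at most δ² wherever ρ(y) ≠ 0.
  have key : eLpNorm (fun x => convolution ρ w (ContinuousLinearMap.lsmul ℝ ℝ) volume x - w x) 2
      volume ^ 2 ≤ δ ^ 2 := by
    rw [eLpNorm_two_sq]
    calc ∫⁻ x, ‖convolution ρ w (ContinuousLinearMap.lsmul ℝ ℝ) volume x - w x‖ₑ ^ 2
        ≤ ∫⁻ x, ∫⁻ y, ‖ρ y‖ₑ * ‖w (x - y) - w x‖ₑ ^ 2 := by
          refine lintegral_mono fun x => ?_
          rw [hpt x]
          exact enorm_integral_smul_sq_le hρ.measurable hρ1' (hsec x)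
      _ = ∫⁻ y, ∫⁻ x, ‖ρ y‖ₑ * ‖w (x - y) - w x‖ₑ ^ 2 := by
          refine lintegral_lintegral_swap ?_
          exact (hρ.measurable.enorm.comp measurable_snd).aemeasurable.mul (hmeas.enorm.pow_const 2)
      _ ≤ ∫⁻ y, ‖ρ y‖ₑ * δ ^ 2 := by
          refine lintegral_mono fun y => ?_
          rw [lintegral_const_mul' _ _ (by simp), ← eLpNorm_two_sq]
          by_cases hy : ρ y = 0
          · simp [hy]
          · gcongr
            exact hδ y hy
      _ = δ ^ 2 := by
          rw [lintegral_mul_const _ hρ.measurable.enorm, hρ1', one_mul]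
  exact (ENNReal.pow_le_pow_left_iff (by norm_num)).1 key

/-! ### Sobolev functions and density of test functions -/

/-- `v` belongs to the Sobolev space `H¹`, with weak gradient `w`. -/
structure Sob {N : ℕ} (v : E N → ℝ) (w : E N → E N) : Prop where
  memLp : MemLp v 2 volume
  memLp_grad : MemLp w 2 volume
  weak : IsWeakGradient v w

theorem continuous_gradient {N : ℕ} {φ : E N → ℝ} (hφ : ContDiff ℝ 1 φ) :
    Continuous (gradient φ) :=
  (InnerProductSpace.toDual ℝ (E N)).symm.continuous.comp (hφ.continuous_fderiv (by simp))

theorem inner_gradient {N : ℕ} (φ : E N → ℝ) (x y : E N) :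
    inner ℝ (gradient φ x) y = fderiv ℝ φ x y := by
  simp [gradient]

theorem norm_gradient {N : ℕ} (φ : E N → ℝ) (x : E N) : ‖gradient φ x‖ = ‖fderiv ℝ φ x‖ := by
  simp [gradient]

theorem hasCompactSupport_gradient {N : ℕ} {φ : E N → ℝ} (hφ : HasCompactSupport φ) :
    HasCompactSupport (gradient φ) :=
  (hφ.fderiv (𝕜 := ℝ)).comp_left (g := fun L => (InnerProductSpace.toDual ℝ (E N)).symm L)
    (map_zero _)

theorem sob_of_contDiff {N : ℕ} {u : E N → ℝ} (hu : ContDiff ℝ 1 u) (huc : HasCompactSupport u) :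
    Sob u (gradient u) where
  memLp := hu.continuous.memLp_of_hasCompactSupport huc
  memLp_grad :=
    (continuous_gradient hu).memLp_of_hasCompactSupport (hasCompactSupport_gradient huc)
  weak := by
    intro φ hφ y
    have hu' : Continuous fun x => fderiv ℝ u x y :=
      (hu.continuous_fderiv (by simp)).clm_apply continuous_const
    have hφ' : Continuous fun x => fderiv ℝ φ x y :=
      (hφ.1.continuous_fderiv (by simp)).clm_apply continuous_const
    have := integral_mul_fderiv_eq_neg_fderiv_mul_of_integrable (μ := volume) (f := u) (g := φ)
      (v := y) ((hu'.mul hφ.1.continuous).integrable_of_hasCompactSupport hφ.2.mul_left)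
      ((hu.continuous.mul hφ').integrable_of_hasCompactSupport huc.mul_right)
      ((hu.continuous.mul hφ.1.continuous).integrable_of_hasCompactSupport hφ.2.mul_left)
      (fun x _ => hu.differentiable (by simp) x) (fun x _ => hφ.1.differentiable (by simp) x)
    rw [this]
    congr 1
    refine integral_congr_ae (ae_of_all _ fun x => ?_)
    simp only [inner_gradient]
    ring

theorem IsTest.sob {N : ℕ} {φ : E N → ℝ} (hφ : IsTest φ) : Sob φ (gradient φ) :=
  sob_of_contDiff (hφ.1.of_le (by simp)) hφ.2

theorem IsTest.mul {N : ℕ} {φ ψ : E N → ℝ} (hφ : IsTest φ) (hψ : IsTest ψ) :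
    IsTest fun x => φ x * ψ x :=
  ⟨hφ.1.mul hψ.1, hφ.2.mul_right⟩

theorem Sob.integrable_left {N : ℕ} {v : E N → ℝ} {w : E N → E N} (h : Sob v w)
    {φ : E N → ℝ} (hφ : IsTest φ) (y : E N) :
    Integrable (fun x => v x * fderiv ℝ φ x y) volume :=
  h.memLp.integrable_mul (hφ.memLp_fderiv y)

theorem Sob.integrable_right {N : ℕ} {v : E N → ℝ} {w : E N → E N} (h : Sob v w)
    {φ : E N → ℝ} (hφ : IsTest φ) (y : E N) :
    Integrable (fun x => φ x * inner ℝ (w x) y) volume :=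
  hφ.memLp.integrable_mul (h.memLp_grad.inner_const y)

theorem Sob.congr {N : ℕ} {v v' : E N → ℝ} {w w' : E N → E N} (h : Sob v w)
    (hv : v =ᵐ[volume] v') (hw : w =ᵐ[volume] w') : Sob v' w' where
  memLp := h.memLp.ae_eq hv
  memLp_grad := h.memLp_grad.ae_eq hw
  weak := by
    intro φ hφ y
    have h1 : ∫ x, v' x * fderiv ℝ φ x y = ∫ x, v x * fderiv ℝ φ x y :=
      integral_congr_ae (by filter_upwards [hv] with x hx; rw [hx])
    have h2 : ∫ x, φ x * inner ℝ (w' x) y = ∫ x, φ x * inner ℝ (w x) y :=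
      integral_congr_ae (by filter_upwards [hw] with x hx; rw [hx])
    rw [h1, h2, h.weak φ hφ y]

theorem Sob.sub {N : ℕ} {v v' : E N → ℝ} {w w' : E N → E N} (h : Sob v w) (h' : Sob v' w') :
    Sob (fun x => v x - v' x) (fun x => w x - w' x) where
  memLp := h.memLp.sub h'.memLp
  memLp_grad := h.memLp_grad.sub h'.memLp_grad
  weak := by
    intro φ hφ y
    simp only [sub_mul, inner_sub_left, mul_sub]
    rw [integral_sub (h.integrable_left hφ y) (h'.integrable_left hφ y),
      integral_sub (h.integrable_right hφ y) (h'.integrable_right hφ y), h.weak φ hφ y,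
      h'.weak φ hφ y]
    ring

theorem IsTest.exists_bound {N : ℕ} {η : E N → ℝ} (hη : IsTest η) :
    ∃ C, ∀ x, ‖η x‖ ≤ C ∧ ‖gradient η x‖ ≤ C := by
  obtain ⟨C₁, h₁⟩ := hη.2.exists_bound_of_continuous hη.1.continuous
  obtain ⟨C₂, h₂⟩ := (hasCompactSupport_gradient hη.2).exists_bound_of_continuous
    (continuous_gradient (hη.1.of_le (by simp)))
  exact ⟨max C₁ C₂, fun x => ⟨(h₁ x).trans (le_max_left _ _), (h₂ x).trans (le_max_right _ _)⟩⟩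

/-- The product rule for a Sobolev function and a test function. -/
theorem Sob.mul_isTest {N : ℕ} {v : E N → ℝ} {w : E N → E N} (h : Sob v w)
    {η : E N → ℝ} (hη : IsTest η) :
    Sob (fun x => η x * v x) (fun x => η x • w x + v x • gradient η x) := by
  obtain ⟨C, hC⟩ := hη.exists_bound
  have hηm : AEStronglyMeasurable η volume := hη.1.continuous.aestronglyMeasurable
  have hgm : AEStronglyMeasurable (gradient η) volume :=
    (continuous_gradient (hη.1.of_le (by simp))).aestronglyMeasurable
  have m1 : MemLp (fun x => η x * v x) 2 volume :=
    MemLp.of_le_mul (c := C) h.memLp (hηm.mul h.memLp.1) (ae_of_all _ fun x => by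
      rw [norm_mul]; gcongr; exact (hC x).1)
  have m2 : MemLp (fun x => η x • w x) 2 volume :=
    MemLp.of_le_mul (c := C) h.memLp_grad (hηm.smul h.memLp_grad.1) (ae_of_all _ fun x => by
      rw [norm_smul]; gcongr; exact (hC x).1)
  have m3 : MemLp (fun x => v x • gradient η x) 2 volume :=
    MemLp.of_le_mul (c := C) h.memLp (h.memLp.1.smul hgm) (ae_of_all _ fun x => by
      rw [norm_smul, mul_comm]; gcongr; exact (hC x).2)
  refine ⟨m1, m2.add m3, ?_⟩
  intro φ hφ y
  have hprod := h.weak _ (hη.mul hφ) y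
  have hd : ∀ x, fderiv ℝ (fun x => η x * φ x) x y
      = η x * fderiv ℝ φ x y + φ x * fderiv ℝ η x y := by
    intro x
    rw [fderiv_fun_mul (hη.1.differentiable (by simp) x) (hφ.1.differentiable (by simp) x)]
    simp
  have i1 : Integrable (fun x => (η x * v x) * fderiv ℝ φ x y) volume :=
    m1.integrable_mul (hφ.memLp_fderiv y)
  have i2 : Integrable (fun x => φ x * inner ℝ (v x • gradient η x) y) volume :=
    hφ.memLp.integrable_mul (m3.inner_const y)
  have i3 : Integrable (fun x => φ x * inner ℝ (η x • w x) y) volume :=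
    hφ.memLp.integrable_mul (m2.inner_const y)
  have e1 : ∫ x, v x * fderiv ℝ (fun x => η x * φ x) x y
      = (∫ x, (η x * v x) * fderiv ℝ φ x y) + ∫ x, φ x * inner ℝ (v x • gradient η x) y := by
    rw [← integral_add i1 i2]
    refine integral_congr_ae (ae_of_all _ fun x => ?_)
    simp only [hd, real_inner_smul_left, inner_gradient]
    ring
  have e2 : ∫ x, η x * φ x * inner ℝ (w x) y = ∫ x, φ x * inner ℝ (η x • w x) y := by
    refine integral_congr_ae (ae_of_all _ fun x => ?_)
    simp only [real_inner_smul_left]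
    ring
  rw [e1, e2] at hprod
  simp only [inner_add_left, mul_add]
  rw [integral_add i3 i2]
  linarith

/-- The gradient of a mollification is the mollification of the weak gradient. -/
theorem Sob.gradient_convolution {N : ℕ} {v : E N → ℝ} {w : E N → E N} (h : Sob v w)
    {ρ : E N → ℝ} (hρ : IsTest ρ) (x : E N) :
    gradient (convolution ρ v (ContinuousLinearMap.lsmul ℝ ℝ) volume) x
      = convolution ρ w (ContinuousLinearMap.lsmul ℝ ℝ) volume x := by
  have hv : LocallyIntegrable v volume := h.memLp.locallyIntegrable (by norm_num)
  have hw : LocallyIntegrable w volume := h.memLp_grad.locallyIntegrable (by norm_num)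
  have hd := hρ.2.hasFDerivAt_convolution_left (ContinuousLinearMap.lsmul ℝ ℝ)
    (hρ.1.of_le (by simp)) hv x
  have hρ1 : ContDiff ℝ 1 ρ := hρ.1.of_le (by simp)
  refine ext_inner_right ℝ fun y => ?_
  rw [inner_gradient, hd.fderiv]
  have hex := (hρ.2.fderiv (𝕜 := ℝ)).convolutionExists_left
    ((ContinuousLinearMap.lsmul ℝ ℝ).precompL (E N)) (hρ1.continuous_fderiv (by simp)) hv x
  have hexw := hρ.2.convolutionExists_left (ContinuousLinearMap.lsmul ℝ ℝ) hρ.1.continuous hw x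
  -- For fixed x the reflected kernel is itself a test function. The sign produced by the reflection
  -- cancels the one in the definition of the weak gradient.
  let φ : E N → ℝ := fun z => ρ (x - z)
  have hφ : IsTest φ := by
    refine ⟨hρ.1.comp (contDiff_const.sub contDiff_id), ?_⟩
    exact hρ.2.comp_homeomorph (Homeomorph.subLeft x)
  have hφd : ∀ z, fderiv ℝ φ z y = - fderiv ℝ ρ (x - z) y := by
    intro z
    have h1 : HasFDerivAt φ ((fderiv ℝ ρ (x - z)).comp (-ContinuousLinearMap.id ℝ (E N))) z := by
      have h2 : HasFDerivAt (fun z : E N => x - z) (-ContinuousLinearMap.id ℝ (E N)) z := by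
        simpa using (hasFDerivAt_id z).const_sub x
      exact ((hρ1.differentiable (by simp) (x - z)).hasFDerivAt).comp z h2
    rw [h1.fderiv]
    simp
  rw [convolution_eq_swap, ContinuousLinearMap.integral_apply]
  · have e1 : ∫ z, ((ContinuousLinearMap.lsmul ℝ ℝ).precompL (E N)) (fderiv ℝ ρ (x - z)) (v z) y
        = - ∫ z, v z * fderiv ℝ φ z y := by
      rw [← integral_neg]
      refine integral_congr_ae (ae_of_all _ fun z => ?_)
      simp [hφd, ContinuousLinearMap.precompL_apply, mul_comm]
    rw [e1, h.weak φ hφ y, neg_neg, convolution_eq_swap, real_inner_comm]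
    have hi : Integrable (fun z => ρ (x - z) • w z) volume := hexw.integrable_swap
    change _ = inner ℝ y (∫ z, ρ (x - z) • w z)
    rw [← integral_inner hi]
    refine integral_congr_ae (ae_of_all _ fun z => ?_)
    simp [φ, real_inner_smul_right, real_inner_comm]
  · exact hex.integrable_swap

/-- Sobolev functions of compact support are limits of test functions. -/
theorem Sob.exists_isTest_of_hasCompactSupport {N : ℕ} {v : E N → ℝ} {w : E N → E N}
    (h : Sob v w) (hvc : HasCompactSupport v) {ε : ENNReal} (hε : 0 < ε) :
    ∃ φ : E N → ℝ, IsTest φ ∧ eLpNorm (fun x => φ x - v x) 2 volume ≤ ε ∧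
      eLpNorm (fun x => gradient φ x - w x) 2 volume ≤ ε := by
  -- The mollifier is supported in a ball of translations that move both v and w by less than ε in
  -- L².
  have h1 := (tendsto_eLpNorm_translate_sub h.memLp).eventually (gt_mem_nhds hε)
  have h2 := (tendsto_eLpNorm_translate_sub h.memLp_grad).eventually (gt_mem_nhds hε)
  obtain ⟨r, hr, hball⟩ := Metric.eventually_nhds_iff_ball.1 (h1.and h2)
  let B : ContDiffBump (0 : E N) := ⟨r / 2, r, by positivity, by linarith⟩
  let ρ : E N → ℝ := B.normed volume
  have hρ : IsTest ρ := ⟨B.contDiff_normed, B.hasCompactSupport_normed⟩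
  have hsupp : ∀ y, ρ y ≠ 0 → y ∈ Metric.ball (0 : E N) r := by
    intro y hy
    have : y ∈ Function.support (B.normed volume) := hy
    rwa [B.support_normed_eq] at this
  refine ⟨convolution ρ v (ContinuousLinearMap.lsmul ℝ ℝ) volume, ⟨?_, ?_⟩, ?_, ?_⟩
  · exact hρ.2.contDiff_convolution_left _ hρ.1 (h.memLp.locallyIntegrable (by norm_num))
  · exact hρ.2.convolution _ hvc
  · exact eLpNorm_convolution_sub_le hρ.1.continuous hρ.2 (fun y => B.nonneg_normed y)
      B.integral_normed h.memLp fun y hy => (hball y (hsupp y hy)).1.le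
  · simp_rw [h.gradient_convolution hρ]
    exact eLpNorm_convolution_sub_le hρ.1.continuous hρ.2 (fun y => B.nonneg_normed y)
      B.integral_normed h.memLp_grad fun y hy => (hball y (hsupp y hy)).2.le

/-- A smooth cutoff, equal to one on the unit ball and supported in the ball of radius two. -/
def cutoffBump (N : ℕ) : ContDiffBump (0 : E N) := ⟨1, 2, one_pos, one_lt_two⟩

/-- The cutoff rescaled to radius `R`. -/
def cutoff {N : ℕ} (R : ℝ) (x : E N) : ℝ := cutoffBump N (R⁻¹ • x)

theorem isTest_cutoffBump (N : ℕ) : IsTest (cutoffBump N) :=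
  ⟨(cutoffBump N).contDiff, (cutoffBump N).hasCompactSupport⟩

theorem isTest_cutoff {N : ℕ} {R : ℝ} (hR : 0 < R) : IsTest (cutoff R : E N → ℝ) := by
  refine ⟨(cutoffBump N).contDiff.comp (contDiff_const_smul _), ?_⟩
  exact (cutoffBump N).hasCompactSupport.comp_homeomorph
    (Homeomorph.smulOfNeZero R⁻¹ (inv_ne_zero hR.ne'))

theorem cutoff_nonneg {N : ℕ} (R : ℝ) (x : E N) : 0 ≤ cutoff R x := (cutoffBump N).nonneg

theorem cutoff_le_one {N : ℕ} (R : ℝ) (x : E N) : cutoff R x ≤ 1 := (cutoffBump N).le_one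

theorem norm_cutoff_le_one {N : ℕ} (R : ℝ) (x : E N) : ‖cutoff R x‖ ≤ 1 := by
  rw [Real.norm_of_nonneg (cutoff_nonneg R x)]; exact cutoff_le_one R x

theorem cutoff_eq_one {N : ℕ} {R : ℝ} (hR : 0 < R) {x : E N} (hx : ‖x‖ ≤ R) :
    cutoff R x = 1 := by
  refine (cutoffBump N).one_of_mem_closedBall ?_
  rw [mem_closedBall_zero_iff, norm_smul, norm_inv, Real.norm_of_nonneg hR.le]
  change R⁻¹ * ‖x‖ ≤ 1
  rw [inv_mul_le_iff₀ hR]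
  linarith

theorem cutoff_eq_zero {N : ℕ} {R : ℝ} (hR : 0 < R) {x : E N} (hx : 2 * R ≤ ‖x‖) :
    cutoff R x = 0 := by
  refine (cutoffBump N).zero_of_le_dist ?_
  rw [dist_zero_right, norm_smul, norm_inv, Real.norm_of_nonneg hR.le]
  change 2 ≤ R⁻¹ * ‖x‖
  rw [le_inv_mul_iff₀ hR]
  linarith

theorem gradient_cutoff {N : ℕ} (R : ℝ) (x : E N) :
    gradient (cutoff R) x = R⁻¹ • gradient (cutoffBump N) (R⁻¹ • x) := by
  have h : HasFDerivAt (cutoff R : E N → ℝ)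
      ((fderiv ℝ (cutoffBump N) (R⁻¹ • x)).comp (R⁻¹ • ContinuousLinearMap.id ℝ (E N))) x :=
    (((cutoffBump N).contDiff (n := 1)).differentiable (by simp) _).hasFDerivAt.comp x
      ((hasFDerivAt_id x).const_smul R⁻¹)
  refine ext_inner_right ℝ fun y => ?_
  rw [inner_gradient, h.fderiv, real_inner_smul_left, inner_gradient]
  simp

theorem gradient_cutoff_eq_zero {N : ℕ} {R : ℝ} (hR : 0 < R) {x : E N} (hx : ‖x‖ < R) :
    gradient (cutoff R) x = 0 := by
  have h : (cutoff R : E N → ℝ) =ᶠ[𝓝 x] fun _ => 1 := by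
    filter_upwards [(isOpen_lt continuous_norm continuous_const).mem_nhds hx] with z hz
    exact cutoff_eq_one hR (le_of_lt hz)
  rw [gradient, h.fderiv_eq]
  simp

/-- A bound for the gradient of the cutoff. -/
theorem exists_cutoff_bound (N : ℕ) :
    ∃ C : ℝ, 0 < C ∧ (∀ R : ℝ, 0 < R → ∀ x : E N, ‖gradient (cutoff R) x‖ ≤ C / R) ∧
      ∀ x y : E N, |cutoffBump N x - cutoffBump N y| ≤ C * ‖x - y‖ := by
  obtain ⟨C, hC⟩ := (isTest_cutoffBump N).exists_bound
  refine ⟨|C| + 1, by positivity, fun R hR x => ?_, fun x y => ?_⟩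
  · rw [gradient_cutoff, norm_smul, norm_inv, Real.norm_of_nonneg hR.le, div_eq_inv_mul]
    gcongr
    exact ((hC _).2.trans (le_abs_self C)).trans (by linarith)
  · have := Convex.norm_image_sub_le_of_norm_fderiv_le (𝕜 := ℝ) (f := cutoffBump N)
      (s := Set.univ) (C := |C| + 1) (x := y) (y := x)
      (fun z _ => ((cutoffBump N).contDiff (n := 1)).differentiable (by simp) z)
      (fun z _ => by
        rw [← norm_gradient]
        exact ((hC z).2.trans (le_abs_self C)).trans (by linarith)) convex_univ trivial trivial
    simpa using this

theorem tendsto_cutoff {N : ℕ} (x : E N) :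
    Tendsto (fun n : ℕ => cutoff ((n : ℝ) + 1) x) atTop (𝓝 1) := by
  refine tendsto_const_nhds.congr' ?_
  filter_upwards [eventually_ge_atTop ⌈‖x‖⌉₊] with n hn
  refine (cutoff_eq_one (by positivity) ?_).symm
  have := Nat.le_ceil ‖x‖
  have h2 : ((⌈‖x‖⌉₊ : ℕ) : ℝ) ≤ n := by exact_mod_cast hn
  linarith

/-- Dominated convergence in `L²`. -/
theorem tendsto_eLpNorm_two_of_dominated {α F : Type*} [MeasurableSpace α] {μ : Measure α}
    [NormedAddCommGroup F] {d : ℕ → α → F} {b : α → ℝ} (hd : ∀ n, AEStronglyMeasurable (d n) μ)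
    (hb : MemLp b 2 μ) (hle : ∀ n, ∀ᵐ x ∂μ, ‖d n x‖ ≤ b x)
    (hlim : ∀ᵐ x ∂μ, Tendsto (fun n => d n x) atTop (𝓝 0)) :
    Tendsto (fun n => eLpNorm (d n) 2 μ) atTop (𝓝 0) := by
  have h : Tendsto (fun n => ∫⁻ x, ‖d n x‖ₑ ^ 2 ∂μ) atTop (𝓝 (∫⁻ _, 0 ∂μ)) := by
    refine tendsto_lintegral_of_dominated_convergence' (fun x => ‖b x‖ₑ ^ 2)
      (fun n => (hd n).enorm.pow_const 2) (fun n => ?_) ?_ ?_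
    · filter_upwards [hle n] with x hx
      gcongr
      rw [enorm_le_iff_norm_le]
      exact hx.trans (le_abs_self _)
    · rw [← eLpNorm_two_sq]
      exact (ENNReal.pow_lt_top hb.2).ne
    · filter_upwards [hlim] with x hx
      simpa using ENNReal.Tendsto.pow (n := 2) hx.enorm
  simp only [lintegral_zero, ← eLpNorm_two_sq] at h
  have h2 := h.ennrpow_const (((2 : ℕ) : ℝ)⁻¹)
  rw [ENNReal.zero_rpow_of_pos (by norm_num)] at h2
  exact h2.congr fun n => ENNReal.pow_rpow_inv_natCast two_ne_zero _

/-- Test functions are dense in the Sobolev space. -/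
theorem Sob.exists_isTest {N : ℕ} {v : E N → ℝ} {w : E N → E N}
    (h : Sob v w) {ε : ENNReal} (hε : 0 < ε) :
    ∃ φ : E N → ℝ, IsTest φ ∧ eLpNorm (fun x => φ x - v x) 2 volume ≤ ε ∧
      eLpNorm (fun x => gradient φ x - w x) 2 volume ≤ ε := by
  obtain ⟨C, hC0, hC, -⟩ := exists_cutoff_bound N
  have hpos : ∀ n : ℕ, (0 : ℝ) < (n : ℝ) + 1 := fun n => by positivity
  have hS : ∀ n : ℕ, Sob _ _ := fun n => h.mul_isTest (isTest_cutoff (N := N) (hpos n))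
  have hgb : ∀ (n : ℕ) (x : E N), ‖gradient (cutoff ((n : ℝ) + 1)) x‖ ≤ C := fun n x => by
    refine (hC _ (hpos n) x).trans (div_le_self hC0.le (by simp))
  have t1 : Tendsto (fun n : ℕ => eLpNorm (fun x => cutoff ((n : ℝ) + 1) x * v x - v x) 2 volume)
      atTop (𝓝 0) := by
    refine tendsto_eLpNorm_two_of_dominated (b := fun x => 2 * ‖v x‖)
      (fun n => ((hS n).memLp.1.sub h.memLp.1)) (h.memLp.norm.const_mul 2)
      (fun n => ae_of_all _ fun x => ?_) (ae_of_all _ fun x => ?_)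
    · calc ‖cutoff ((n : ℝ) + 1) x * v x - v x‖ ≤ ‖cutoff ((n : ℝ) + 1) x‖ * ‖v x‖ + ‖v x‖ := by
            rw [← norm_mul]; exact norm_sub_le _ _
        _ ≤ 1 * ‖v x‖ + ‖v x‖ := by gcongr; exact norm_cutoff_le_one _ _
        _ = 2 * ‖v x‖ := by ring
    · simpa using ((tendsto_cutoff x).mul_const (v x)).sub_const (v x)
  have t2 : Tendsto (fun n : ℕ => eLpNorm (fun x => (cutoff ((n : ℝ) + 1) x • w x
      + v x • gradient (cutoff ((n : ℝ) + 1)) x) - w x) 2 volume) atTop (𝓝 0) := by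
    refine tendsto_eLpNorm_two_of_dominated (b := fun x => 2 * ‖w x‖ + C * ‖v x‖)
      (fun n => ((hS n).memLp_grad.1.sub h.memLp_grad.1))
      ((h.memLp_grad.norm.const_mul 2).add (h.memLp.norm.const_mul C))
      (fun n => ae_of_all _ fun x => ?_) (ae_of_all _ fun x => ?_)
    · calc _ ≤ ‖cutoff ((n : ℝ) + 1) x • w x‖ + ‖v x • gradient (cutoff ((n : ℝ) + 1)) x‖
            + ‖w x‖ := (norm_sub_le _ _).trans (by gcongr; exact norm_add_le _ _)
        _ ≤ 1 * ‖w x‖ + ‖v x‖ * C + ‖w x‖ := by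
            rw [norm_smul, norm_smul]
            gcongr
            · exact norm_cutoff_le_one _ _
            · exact hgb n x
        _ = _ := by ring
    · have g0 : Tendsto (fun n : ℕ => gradient (cutoff ((n : ℝ) + 1)) x) atTop (𝓝 0) := by
        refine squeeze_zero_norm (fun n => hC _ (hpos n) x) ?_
        exact tendsto_const_nhds.div_atTop
          (tendsto_atTop_add_const_right _ _ tendsto_natCast_atTop_atTop)
      simpa using (((tendsto_cutoff x).smul_const (w x)).add (g0.const_smul (v x))).sub_const (w x)
  -- Half of the error is spent on cutting off at infinity, half on mollifying the compactly
  -- supported result.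
  have hε2 : 0 < ε / 2 := ENNReal.half_pos hε.ne'
  obtain ⟨n, hn1, hn2⟩ := ((t1.eventually (gt_mem_nhds hε2)).and
    (t2.eventually (gt_mem_nhds hε2))).exists
  obtain ⟨φ, hφ, e1, e2⟩ := (hS n).exists_isTest_of_hasCompactSupport
    ((isTest_cutoff (hpos n)).2.mul_right) hε2
  refine ⟨φ, hφ, ?_, ?_⟩
  · have := eLpNorm_add_le (p := 2) (μ := volume) (hφ.sob.memLp.1.sub (hS n).memLp.1)
      ((hS n).memLp.1.sub h.memLp.1) (by norm_num)
    refine le_trans (le_of_eq ?_) (this.trans ((add_le_add e1 hn1.le).trans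
      (ENNReal.add_halves ε).le))
    congr 1
    ext x
    simp
  · have := eLpNorm_add_le (p := 2) (μ := volume) (hφ.sob.memLp_grad.1.sub (hS n).memLp_grad.1)
      ((hS n).memLp_grad.1.sub h.memLp_grad.1) (by norm_num)
    refine le_trans (le_of_eq ?_) (this.trans ((add_le_add e2 hn2.le).trans
      (ENNReal.add_halves ε).le))
    congr 1
    ext1 x
    simp

/-- Every Sobolev function is the limit, in `H¹` and almost everywhere, of a sequence of test
functions. -/
theorem Sob.exists_seq_isTest {N : ℕ} {v : E N → ℝ} {w : E N → E N} (h : Sob v w) :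
    ∃ φ : ℕ → E N → ℝ, (∀ n, IsTest (φ n)) ∧
      Tendsto (fun n => eLpNorm (fun x => φ n x - v x) 2 volume) atTop (𝓝 0) ∧
      Tendsto (fun n => eLpNorm (fun x => gradient (φ n) x - w x) 2 volume) atTop (𝓝 0) ∧
      ∀ᵐ x, Tendsto (fun n => φ n x) atTop (𝓝 (v x)) := by
  have hpos : ∀ n : ℕ, (0 : ENNReal) < ((n : ENNReal) + 1)⁻¹ := fun n => by simp
  choose φ hφ h1 h2 using fun n : ℕ => h.exists_isTest (hpos n)
  have hlim : Tendsto (fun n : ℕ => ((n : ENNReal) + 1)⁻¹) atTop (𝓝 0) := by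
    have := (tendsto_add_atTop_iff_nat 1).2 ENNReal.tendsto_inv_nat_nhds_zero
    simpa using this
  have t1 := tendsto_of_tendsto_of_tendsto_of_le_of_le tendsto_const_nhds hlim
    (fun _ => zero_le) h1
  have t2 := tendsto_of_tendsto_of_tendsto_of_le_of_le tendsto_const_nhds hlim
    (fun _ => zero_le) h2
  have hm : TendstoInMeasure volume φ atTop v :=
    tendstoInMeasure_of_tendsto_eLpNorm (p := 2) (by simp)
      (fun n => (hφ n).sob.memLp.1) h.memLp.1 t1
  obtain ⟨ns, hns, hae⟩ := hm.exists_seq_tendsto_ae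
  exact ⟨fun n => φ (ns n), fun n => hφ _, t1.comp hns.tendsto_atTop, t2.comp hns.tendsto_atTop,
    hae⟩

/-! ### Sobolev inequality and Sobolev test functions -/

/-- The critical Sobolev exponent. -/
def crit (N : ℕ) : ℝ := 2 * N / (N - 2)

theorem two_lt_crit {N : ℕ} (hN : 3 ≤ N) : 2 < crit N := by
  have : (3 : ℝ) ≤ N := by exact_mod_cast hN
  rw [crit, lt_div_iff₀ (by linarith)]
  linarith

/-- The Sobolev inequality in `H¹`. -/
theorem exists_sobolev_const {N : ℕ} (hN : 3 ≤ N) :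
    ∃ S : ℝ, 0 < S ∧ ∀ (v : E N → ℝ) (w : E N → E N), Sob v w →
      eLpNorm v (ENNReal.ofReal (crit N)) volume ≤ ENNReal.ofReal S * eLpNorm w 2 volume := by
  let S₀ : NNReal := SNormLESNormFDerivOfEqConst ℝ (volume : Measure (E N)) 2
  refine ⟨(S₀ : ℝ) + 1, by positivity, fun v w h => ?_⟩
  have hN' : (3 : ℝ) ≤ N := by exact_mod_cast hN
  have hS : ∀ φ : E N → ℝ, IsTest φ → eLpNorm φ (ENNReal.ofReal (crit N)) volume
      ≤ S₀ * eLpNorm (gradient φ) 2 volume := by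
    intro φ hφ
    have h1 := eLpNorm_le_eLpNorm_fderiv_of_eq (μ := (volume : Measure (E N))) (F := ℝ) (p := 2)
      (p' := (crit N).toNNReal) (hφ.1.of_le (by simp)) hφ.2 (by norm_num)
      (by simp; omega) (by
        rw [Real.coe_toNNReal _ (by linarith [two_lt_crit hN])]
        simp only [crit, finrank_euclideanSpace, Fintype.card_fin]
        have : (N : ℝ) - 2 ≠ 0 := by linarith
        push_cast
        field_simp)
    have h2 : eLpNorm (fderiv ℝ φ) 2 volume = eLpNorm (gradient φ) 2 volume :=
      eLpNorm_congr_norm_ae (ae_of_all _ fun x => (norm_gradient φ x).symm)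
    rw [← h2]
    exact h1
  obtain ⟨φ, hφ, -, t2, hae⟩ := h.exists_seq_isTest
  -- Fatou: the critical norm is lower semicontinuous along the almost everywhere convergent
  -- sequence of test functions, so v need not be known to lie in that space beforehand.
  refine (Lp.eLpNorm_lim_le_liminf_eLpNorm (fun n => (hφ n).1.continuous.aestronglyMeasurable)
    v hae).trans ?_
  have hb : ∀ n, eLpNorm (φ n) (ENNReal.ofReal (crit N)) volume
      ≤ S₀ * (eLpNorm w 2 volume + eLpNorm (fun x => gradient (φ n) x - w x) 2 volume) := by
    intro n
    refine (hS _ (hφ n)).trans ?_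
    gcongr
    have := eLpNorm_add_le (p := 2) (μ := volume) h.memLp_grad.1
      ((hφ n).sob.memLp_grad.1.sub h.memLp_grad.1) (by norm_num)
    refine le_trans (le_of_eq ?_) this
    congr 1
    ext1 x
    simp
  have hlim : Tendsto (fun n => (S₀ : ENNReal) * (eLpNorm w 2 volume
      + eLpNorm (fun x => gradient (φ n) x - w x) 2 volume)) atTop
      (𝓝 (S₀ * (eLpNorm w 2 volume + 0))) :=
    ENNReal.Tendsto.const_mul (tendsto_const_nhds.add t2) (Or.inr ENNReal.coe_ne_top)
  refine (liminf_le_liminf (Eventually.of_forall hb)).trans ?_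
  rw [hlim.liminf_eq, add_zero]
  gcongr
  rw [ENNReal.ofReal_add (by positivity) (by norm_num), ENNReal.ofReal_coe_nnreal]
  exact le_self_add

/-- Continuity of the duality pairing. -/
theorem tendsto_integral_inner {α F : Type*} [MeasurableSpace α] {μ : Measure α}
    [NormedAddCommGroup F] [InnerProductSpace ℝ F] {p q : ENNReal} [ENNReal.HolderConjugate p q]
    {h : α → F} (hh : MemLp h p μ) {φ : ℕ → α → F} {φ' : α → F} (hφ : ∀ n, MemLp (φ n) q μ)
    (hφ' : MemLp φ' q μ)
    (ht : Tendsto (fun n => eLpNorm (fun x => φ n x - φ' x) q μ) atTop (𝓝 0)) :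
    Tendsto (fun n => ∫ x, inner ℝ (h x) (φ n x) ∂μ) atTop (𝓝 (∫ x, inner ℝ (h x) (φ' x) ∂μ)) := by
  have hi : ∀ {ψ : α → F}, MemLp ψ q μ → Integrable (fun x => inner ℝ (h x) (ψ x)) μ := by
    intro ψ hψ
    refine (MemLp.integrable_mul hh.norm hψ.norm).mono'
      (hh.1.inner hψ.1) (ae_of_all _ fun x => norm_inner_le_norm _ _)
  refine tendsto_integral_of_L1' _ (hi hφ').1 (Eventually.of_forall fun n => hi (hφ n)) ?_
  have hle : ∀ n, eLpNorm ((fun x => inner ℝ (h x) (φ n x)) - fun x => inner ℝ (h x) (φ' x)) 1 μ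
      ≤ eLpNorm h p μ * eLpNorm (fun x => φ n x - φ' x) q μ := by
    intro n
    have := eLpNorm_le_eLpNorm_mul_eLpNorm_of_nnnorm (p := p) (q := q) (r := 1) hh.1
      ((hφ n).1.sub hφ'.1) (fun a b : F => (inner ℝ a b : ℝ)) 1
      (ae_of_all _ fun x => by simpa using nnnorm_inner_le_nnnorm (𝕜 := ℝ) (h x) ((φ n - φ') x))
    refine le_trans (le_of_eq ?_) (this.trans (le_of_eq ?_))
    · congr 1
      ext x
      simp [inner_sub_right]
    · simp
      rfl
  have hlim : Tendsto (fun n => eLpNorm h p μ * eLpNorm (fun x => φ n x - φ' x) q μ) atTop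
      (𝓝 (eLpNorm h p μ * 0)) := ENNReal.Tendsto.const_mul ht (Or.inr hh.2.ne)
  rw [mul_zero] at hlim
  exact tendsto_of_tendsto_of_tendsto_of_le_of_le tendsto_const_nhds hlim (fun _ => zero_le) hle

/-- A weak equation with right-hand side in `L² + L^q`, `q` dual to the critical exponent, extends
from test functions to Sobolev functions. -/
theorem Sob.weak_equation {N : ℕ} (hN : 3 ≤ N) {w : E N → E N} (hw : MemLp w 2 volume)
    {h₁ h₂ : E N → ℝ} {q : ENNReal} [ENNReal.HolderConjugate q (ENNReal.ofReal (crit N))]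
    (hh₁ : MemLp h₁ 2 volume) (hh₂ : MemLp h₂ q volume)
    (heq : ∀ φ : E N → ℝ, IsTest φ →
      ∫ x, inner ℝ (w x) (gradient φ x) = ∫ x, (h₁ x + h₂ x) * φ x)
    {φ : E N → ℝ} {w' : E N → E N} (hφ : Sob φ w') :
    Integrable (fun x => (h₁ x + h₂ x) * φ x) volume ∧
      ∫ x, inner ℝ (w x) (w' x) = ∫ x, (h₁ x + h₂ x) * φ x := by
  obtain ⟨S, hS0, hS⟩ := exists_sobolev_const hN
  have hcrit : ∀ {u : E N → ℝ} {u' : E N → E N}, Sob u u' →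
      MemLp u (ENNReal.ofReal (crit N)) volume := fun {u u'} hu =>
    ⟨hu.memLp.1, (hS u u' hu).trans_lt (ENNReal.mul_lt_top ENNReal.ofReal_lt_top hu.memLp_grad.2)⟩
  have hint : ∀ {u : E N → ℝ} {u' : E N → E N}, Sob u u' →
      Integrable (fun x => h₁ x * u x) volume ∧ Integrable (fun x => h₂ x * u x) volume :=
    fun {u u'} hu => ⟨hh₁.integrable_mul hu.memLp, hh₂.integrable_mul (hcrit hu)⟩
  have hsplit : ∀ {u : E N → ℝ} {u' : E N → E N}, Sob u u' →
      ∫ x, (h₁ x + h₂ x) * u x = (∫ x, inner ℝ (h₁ x) (u x)) + ∫ x, inner ℝ (h₂ x) (u x) := by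
    intro u u' hu
    simp_rw [add_mul]
    rw [integral_add (hint hu).1 (hint hu).2]
    simp [mul_comm]
  refine ⟨by simpa only [add_mul] using! (hint hφ).1.add (hint hφ).2, ?_⟩
  obtain ⟨ψ, hψ, t1, t2, -⟩ := hφ.exists_seq_isTest
  -- The Sobolev inequality applied to differences upgrades H¹ convergence to convergence in the
  -- critical space, where pairing with `h₂` is continuous.
  have t3 : Tendsto (fun n => eLpNorm (fun x => ψ n x - φ x) (ENNReal.ofReal (crit N)) volume)
      atTop (𝓝 0) := by
    have hlim : Tendsto (fun n => ENNReal.ofReal S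
        * eLpNorm (fun x => gradient (ψ n) x - w' x) 2 volume) atTop
        (𝓝 (ENNReal.ofReal S * 0)) := ENNReal.Tendsto.const_mul t2 (Or.inr ENNReal.ofReal_ne_top)
    rw [mul_zero] at hlim
    exact tendsto_of_tendsto_of_tendsto_of_le_of_le tendsto_const_nhds hlim (fun _ => zero_le)
      (fun n => hS _ _ ((hψ n).sob.sub hφ))
  have a1 := tendsto_integral_inner hw (fun n => (hψ n).sob.memLp_grad) hφ.memLp_grad t2
  have a2 := tendsto_integral_inner hh₁ (fun n => (hψ n).sob.memLp) hφ.memLp t1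
  have a3 := tendsto_integral_inner hh₂ (fun n => hcrit (hψ n).sob) (hcrit hφ) t3
  rw [hsplit hφ]
  refine tendsto_nhds_unique a1 ((a2.add a3).congr fun n => ?_)
  rw [heq _ (hψ n), hsplit (hψ n).sob]

/-- The chain rule in `H¹` for a Lipschitz `C¹` function vanishing at the origin. -/
theorem Sob.comp {N : ℕ} {v : E N → ℝ} {w : E N → E N} (h : Sob v w) {ψ θ : ℝ → ℝ}
    (hψ : ∀ s, HasDerivAt ψ (θ s) s) (hθ : Continuous θ) (hθ1 : ∀ s, |θ s| ≤ 1) (hψ0 : ψ 0 = 0) :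
    Sob (fun x => ψ (v x)) (fun x => θ (v x) • w x) := by
  have hlip : ∀ a b, |ψ a - ψ b| ≤ |a - b| := by
    intro a b
    have := Convex.norm_image_sub_le_of_norm_hasDerivWithin_le (s := Set.univ) (C := 1)
      (fun x _ => (hψ x).hasDerivWithinAt) (fun x _ => hθ1 x) convex_univ (mem_univ b)
      (mem_univ a)
    simpa using this
  have hψc : Continuous ψ := continuous_iff_continuousAt.2 fun s => (hψ s).continuousAt
  have hψ1 : ContDiff ℝ 1 ψ := by
    rw [contDiff_one_iff_deriv]
    exact ⟨fun s => (hψ s).differentiableAt, by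
      have : deriv ψ = θ := funext fun s => (hψ s).deriv
      rwa [this]⟩
  have hθm : AEStronglyMeasurable (fun x => θ (v x)) volume := hθ.comp_aestronglyMeasurable h.memLp.1
  have m1 : MemLp (fun x => ψ (v x)) 2 volume :=
    h.memLp.of_le (hψc.comp_aestronglyMeasurable h.memLp.1) (ae_of_all _ fun x => by
      simpa [hψ0] using hlip (v x) 0)
  have m2 : MemLp (fun x => θ (v x) • w x) 2 volume :=
    h.memLp_grad.of_le (hθm.smul h.memLp_grad.1) (ae_of_all _ fun x => by
      rw [norm_smul]
      exact mul_le_of_le_one_left (norm_nonneg _) (hθ1 _))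
  refine ⟨m1, m2, ?_⟩
  obtain ⟨φ, hφ, t1, t2, hae⟩ := h.exists_seq_isTest
  have hgr : ∀ n x, gradient (fun x => ψ (φ n x)) x = θ (φ n x) • gradient (φ n) x := by
    intro n x
    refine ext_inner_right ℝ fun y => ?_
    have := (hψ (φ n x)).comp_hasFDerivAt x ((hφ n).1.differentiable (by simp) x).hasFDerivAt
    rw [inner_gradient, real_inner_smul_left, inner_gradient]
    have h2 : fderiv ℝ (fun x => ψ (φ n x)) x = θ (φ n x) • fderiv ℝ (φ n) x := this.fderiv
    rw [h2]
    simp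
  have hS : ∀ n, Sob (fun x => ψ (φ n x)) (fun x => θ (φ n x) • gradient (φ n) x) := by
    intro n
    have := sob_of_contDiff (u := fun x => ψ (φ n x)) (hψ1.comp ((hφ n).1.of_le (by simp)))
      ((hφ n).2.comp_left hψ0)
    have e : gradient (fun x => ψ (φ n x)) = fun x => θ (φ n x) • gradient (φ n) x :=
      funext (hgr n)
    rwa [e] at this
  have s1 : Tendsto (fun n => eLpNorm (fun x => ψ (φ n x) - ψ (v x)) 2 volume) atTop (𝓝 0) :=
    tendsto_of_tendsto_of_tendsto_of_le_of_le tendsto_const_nhds t1 (fun _ => zero_le)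
      (fun n => eLpNorm_mono fun x => hlip _ _)
  have s2 : Tendsto (fun n => eLpNorm (fun x => θ (φ n x) • gradient (φ n) x - θ (v x) • w x) 2
      volume) atTop (𝓝 0) := by
    -- The gradient difference splits as θ(φₙ)(∇φₙ - w) + (θ(φₙ) - θ(v))w. The first summand is
    -- controlled by |θ| ≤ 1, the second by dominated convergence, θ being continuous.
    have s3 : Tendsto (fun n => eLpNorm (fun x => (θ (φ n x) - θ (v x)) • w x) 2 volume) atTop
        (𝓝 0) := by
      refine tendsto_eLpNorm_two_of_dominated (b := fun x => 2 * ‖w x‖) (fun n => ?_)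
        (h.memLp_grad.norm.const_mul 2) (fun n => ae_of_all _ fun x => ?_) ?_
      · exact ((hθ.comp_aestronglyMeasurable (hφ n).sob.memLp.1).sub hθm).smul h.memLp_grad.1
      · rw [norm_smul]
        gcongr
        calc ‖θ (φ n x) - θ (v x)‖ ≤ ‖θ (φ n x)‖ + ‖θ (v x)‖ := norm_sub_le _ _
          _ ≤ 1 + 1 := add_le_add (hθ1 _) (hθ1 _)
          _ = 2 := by norm_num
      · filter_upwards [hae] with x hx
        simpa using (((hθ.tendsto _).comp hx).sub_const (θ (v x))).smul_const (w x)
    have hlim := t2.add s3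
    rw [add_zero] at hlim
    refine tendsto_of_tendsto_of_tendsto_of_le_of_le tendsto_const_nhds hlim (fun _ => zero_le)
      (fun n => ?_)
    have hm1 : AEStronglyMeasurable (fun x => θ (φ n x) • (gradient (φ n) x - w x)) volume :=
      (hθ.comp_aestronglyMeasurable (hφ n).sob.memLp.1).smul
        ((hφ n).sob.memLp_grad.1.sub h.memLp_grad.1)
    have hm2 : AEStronglyMeasurable (fun x => (θ (φ n x) - θ (v x)) • w x) volume :=
      ((hθ.comp_aestronglyMeasurable (hφ n).sob.memLp.1).sub hθm).smul h.memLp_grad.1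
    calc eLpNorm (fun x => θ (φ n x) • gradient (φ n) x - θ (v x) • w x) 2 volume
        = eLpNorm ((fun x => θ (φ n x) • (gradient (φ n) x - w x))
            + fun x => (θ (φ n x) - θ (v x)) • w x) 2 volume := by
          congr 1
          ext1 x
          simp only [Pi.add_apply, smul_sub, sub_smul]
          abel
      _ ≤ _ := eLpNorm_add_le hm1 hm2 (by norm_num)
      _ ≤ _ := by
          refine add_le_add (eLpNorm_mono fun x => ?_) le_rfl
          rw [norm_smul]
          exact mul_le_of_le_one_left (norm_nonneg _) (hθ1 _)
  intro χ hχ y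
  have a1 := tendsto_integral_inner (hχ.memLp_fderiv y) (fun n => (hS n).memLp) m1 s1
  have hχy : MemLp (fun x => χ x • y) 2 volume :=
    (hχ.1.continuous.smul continuous_const).memLp_of_hasCompactSupport (hχ.2.smul_right)
  have a2 := tendsto_integral_inner hχy (fun n => (hS n).memLp_grad) m2 s2
  have e : ∀ {a : E N → ℝ} {b : E N → E N},
      (∫ x, inner ℝ (fderiv ℝ χ x y) (a x) = ∫ x, a x * fderiv ℝ χ x y) ∧
      (∫ x, inner ℝ (χ x • y) (b x) = ∫ x, χ x * inner ℝ (b x) y) := by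
    intro a b
    refine ⟨integral_congr_ae (ae_of_all _ fun x => ?_),
      integral_congr_ae (ae_of_all _ fun x => ?_)⟩
    · simp
    · change inner ℝ (χ x • y) (b x) = χ x * inner ℝ (b x) y
      rw [real_inner_smul_left, real_inner_comm]
  rw [← (e (a := fun x => ψ (v x)) (b := 0)).1,
    ← (e (a := 0) (b := fun x => θ (v x) • w x)).2]
  refine tendsto_nhds_unique a1 (a2.neg.congr fun n => ?_)
  rw [(e (a := fun x => ψ (φ n x)) (b := 0)).1,
    (e (a := 0) (b := fun x => θ (φ n x) • gradient (φ n) x)).2]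
  exact ((hS n).weak χ hχ y).symm

/-! ### Truncations and De Giorgi iteration -/

/-- The squared positive part is C¹ even at the kink. Differences of such squares give truncations
to which the C¹ chain rule `Sob.comp` applies, in place of the merely Lipschitz (v - a)⁺. -/
theorem hasDerivAt_max_zero_sq (s : ℝ) :
    HasDerivAt (fun s : ℝ => max s 0 ^ 2) (2 * max s 0) s := by
  rcases lt_trichotomy s 0 with h | rfl | h
  · have : (fun s : ℝ => max s 0 ^ 2) =ᶠ[𝓝 s] fun _ => 0 := by
      filter_upwards [gt_mem_nhds h] with t ht
      simp [max_eq_right ht.le]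
    rw [max_eq_right h.le, mul_zero]
    exact (hasDerivAt_const s (0 : ℝ)).congr_of_eventuallyEq this
  · rw [hasDerivAt_iff_isLittleO_nhds_zero]
    simp only [zero_add, max_self, mul_zero, smul_zero, sub_zero, ne_eq, OfNat.ofNat_ne_zero,
      not_false_eq_true, zero_pow]
    have h1 : (fun h : ℝ => max h 0 ^ 2) =O[𝓝 0] fun h : ℝ => h ^ 2 :=
      Asymptotics.isBigO_of_le _ fun x => by
        rw [norm_pow, norm_pow]
        gcongr
        rw [Real.norm_of_nonneg (le_max_right _ _), Real.norm_eq_abs]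
        exact max_le (le_abs_self x) (abs_nonneg x)
    exact h1.trans_isLittleO (Asymptotics.isLittleO_pow_id one_lt_two)
  · have : (fun s : ℝ => max s 0 ^ 2) =ᶠ[𝓝 s] fun t => t ^ 2 := by
      filter_upwards [lt_mem_nhds h] with t ht
      simp [max_eq_left ht.le]
    rw [max_eq_left h.le]
    simpa using (hasDerivAt_pow 2 s).congr_of_eventuallyEq this

/-- A continuous ramp: zero below `a`, one above `b`, affine in between. -/
def ramp (a b s : ℝ) : ℝ := (max (s - a) 0 - max (s - b) 0) / (b - a)

/-- The primitive of `ramp` vanishing below `a`. -/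
def rampPrim (a b s : ℝ) : ℝ := (max (s - a) 0 ^ 2 - max (s - b) 0 ^ 2) / (2 * (b - a))

theorem hasDerivAt_rampPrim {a b : ℝ} (hab : a < b) (s : ℝ) :
    HasDerivAt (rampPrim a b) (ramp a b s) s := by
  have h1 := ((hasDerivAt_max_zero_sq (s - a)).comp s ((hasDerivAt_id s).sub_const a)).sub
    ((hasDerivAt_max_zero_sq (s - b)).comp s ((hasDerivAt_id s).sub_const b))
  have h2 := h1.div_const (2 * (b - a))
  have : b - a ≠ 0 := by linarith
  have e : ramp a b s = (2 * max (s - a) 0 * 1 - 2 * max (s - b) 0 * 1) / (2 * (b - a)) := by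
    rw [ramp]
    field_simp
  rw [e]
  exact h2

theorem continuous_ramp (a b : ℝ) : Continuous (ramp a b) := by
  unfold ramp
  fun_prop

theorem ramp_nonneg {a b : ℝ} (hab : a < b) (s : ℝ) : 0 ≤ ramp a b s := by
  refine div_nonneg ?_ (by linarith)
  rw [sub_nonneg]
  exact max_le_max_right _ (by linarith)

theorem ramp_le_one {a b : ℝ} (hab : a < b) (s : ℝ) : ramp a b s ≤ 1 := by
  rw [ramp, div_le_one (by linarith)]
  rcases le_total (s - a) 0 with h1 | h1 <;> rcases le_total (s - b) 0 with h2 | h2 <;>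
    simp only [max_eq_left, max_eq_right, h1, h2] <;> linarith

theorem rampPrim_of_le {a b s : ℝ} (hab : a < b) (hs : s ≤ a) : rampPrim a b s = 0 := by
  rw [rampPrim, max_eq_right (by linarith), max_eq_right (by linarith)]
  simp

theorem rampPrim_nonneg {a b : ℝ} (hab : a < b) (s : ℝ) : 0 ≤ rampPrim a b s := by
  refine div_nonneg ?_ (by linarith)
  rw [sub_nonneg]
  gcongr

theorem rampPrim_le {a b s : ℝ} (ha : 0 ≤ a) (hab : a < b) (hs : 0 ≤ s) : rampPrim a b s ≤ s := by
  rw [rampPrim, div_le_iff₀ (by linarith)]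
  rcases le_total (s - a) 0 with h1 | h1 <;> rcases le_total (s - b) 0 with h2 | h2 <;>
    simp only [max_eq_left, max_eq_right, h1, h2] <;> nlinarith

theorem le_rampPrim {a b s : ℝ} (ha : 0 ≤ a) (hab : a < b) (hs : b < s) :
    (b - a) / (2 * b) * s ≤ rampPrim a b s := by
  have hb : 0 < b := by linarith
  rw [rampPrim, max_eq_left (by linarith), max_eq_left (by linarith)]
  have e : ((s - a) ^ 2 - (s - b) ^ 2) / (2 * (b - a)) = s - (a + b) / 2 := by
    have : b - a ≠ 0 := by linarith
    field_simp
    ring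
  rw [e, div_mul_eq_mul_div, div_le_iff₀ (by linarith)]
  nlinarith

/-- The part of a function above a level. -/
def above {α : Type*} (v : α → ℝ) (a : ℝ) (x : α) : ℝ := {x | a < v x}.indicator v x

theorem norm_above_mono {α : Type*} (v : α → ℝ) {a b : ℝ} (hab : a ≤ b) (x : α) :
    ‖above v b x‖ ≤ ‖above v a x‖ := by
  by_cases h : b < v x
  · rw [above, above, indicator_of_mem (show x ∈ {x | b < v x} from h),
      indicator_of_mem (show x ∈ {x | a < v x} from lt_of_le_of_lt hab h)]
  · rw [above, indicator_of_notMem (show x ∉ {x | b < v x} from h)]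
    simp

/-- A fast geometric decay lemma. -/
theorem tendsto_zero_of_superlinear {y : ℕ → ℝ} {B Y δ : ℝ} (hδ : 0 < δ) (hY : 0 ≤ Y)
    (hB : 0 ≤ B) (hy : ∀ n, 0 ≤ y n) (h0 : y 0 ≤ Y)
    (hrec : ∀ n, y (n + 1) ≤ B * 2 ^ n * y n ^ (1 + δ)) (hBY : B * Y ^ δ ≤ 2 ^ (-1 / δ)) :
    Tendsto y atTop (𝓝 0) := by
  -- The ratio is chosen so that r^δ = 1/2: the gain (r^δ)^n cancels the factor 2^n of the
  -- recursion, and the induction y n ≤ Y r^n closes.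
  set r : ℝ := 2 ^ (-1 / δ) with hr
  have hr0 : 0 < r := by positivity
  have hr1 : r < 1 := Real.rpow_lt_one_of_one_lt_of_neg one_lt_two (div_neg_of_neg_of_pos (by norm_num) hδ)
  have hrδ : r ^ δ = 2⁻¹ := by
    rw [hr, ← Real.rpow_mul (by norm_num), div_mul_cancel₀ _ hδ.ne', Real.rpow_neg_one]
  have key : ∀ n, y n ≤ Y * r ^ n := by
    intro n
    induction n with
    | zero => simpa using h0
    | succ n ih =>
      calc y (n + 1) ≤ B * 2 ^ n * y n ^ (1 + δ) := hrec n
        _ ≤ B * 2 ^ n * (Y * r ^ n) ^ (1 + δ) := by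
            gcongr
            exact hy n
        _ = B * 2 ^ n * ((Y * r ^ n) * (Y ^ δ * (r ^ δ) ^ n)) := by
            rw [Real.rpow_add_of_nonneg (by positivity) (by norm_num) hδ.le, Real.rpow_one,
              Real.mul_rpow hY (by positivity), ← Real.rpow_natCast r n, ← Real.rpow_mul hr0.le,
              ← Real.rpow_natCast (r ^ δ) n, ← Real.rpow_mul hr0.le, mul_comm (n : ℝ) δ]
        _ = (B * Y ^ δ) * (Y * r ^ n) := by
            rw [hrδ, inv_pow]
            field_simp
        _ ≤ r * (Y * r ^ n) := by gcongr
        _ = Y * r ^ (n + 1) := by ring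
  refine squeeze_zero hy key ?_
  simpa using (tendsto_pow_atTop_nhds_zero_of_lt_one hr0.le hr1).const_mul Y

/-- `v` is a weak subsolution of `-Δv ≤ K v^(q-1)`, tested against functions of `v`. -/
def IsPowerSubsolution {N : ℕ} (K q : ℝ) (v : E N → ℝ) (w : E N → E N) : Prop :=
  ∀ ψ θ : ℝ → ℝ, (∀ s, HasDerivAt ψ (θ s) s) → Continuous θ → (∀ s, 0 ≤ θ s) → (∀ s, θ s ≤ 1) →
    ψ 0 = 0 → ∫⁻ x, ENNReal.ofReal (θ (v x)) * ‖w x‖ₑ ^ 2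
      ≤ ENNReal.ofReal K * ∫⁻ x, ENNReal.ofReal (v x ^ (q - 1) * ψ (v x))

/-- One De Giorgi step, passing from level a to level b. Apply Sobolev to ψ(v), ψ the truncation
`rampPrim a b`. Since 0 ≤ θ ≤ 1 for θ = ψ', |θ(v)w|² ≤ θ(v)|w|², and the subsolution property bounds
the integral of this by K∫v^(q-1)ψ(v). Here ψ(v) ≤ v vanishes below a, and v^q ≤ a^(q-p) v^p above
a. The exponent p/2 > 1 on the norm at level a makes the recursion superlinear, and a^(q-p) is small
at high levels because q < p. -/
theorem sobolev_level_step {N : ℕ} {S : ℝ} (hS : ∀ (v : E N → ℝ) (w : E N → E N), Sob v w →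
      eLpNorm v (ENNReal.ofReal (crit N)) volume ≤ ENNReal.ofReal S * eLpNorm w 2 volume)
    {K q : ℝ} (hq : 2 < q) (hq' : q < crit N) {v : E N → ℝ} {w : E N → E N}
    (h : Sob v w) (hv0 : ∀ᵐ x, 0 ≤ v x) (hsub : IsPowerSubsolution K q v w)
    {a b : ℝ} (ha : 0 < a) (hab : a < b) :
    ENNReal.ofReal ((b - a) / (2 * b)) * eLpNorm (above v b) (ENNReal.ofReal (crit N)) volume
      ≤ ENNReal.ofReal S * (ENNReal.ofReal K * (ENNReal.ofReal (a ^ (q - crit N))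
        * eLpNorm (above v a) (ENNReal.ofReal (crit N)) volume ^ crit N)) ^ (2⁻¹ : ℝ) := by
  have hp : 0 < crit N := by linarith
  have hc : 0 ≤ (b - a) / (2 * b) := div_nonneg (by linarith) (by linarith)
  have hψS := h.comp (hasDerivAt_rampPrim hab) (continuous_ramp a b)
    (fun s => by rw [abs_of_nonneg (ramp_nonneg hab s)]; exact ramp_le_one hab s)
    (rampPrim_of_le hab ha.le)
  have h1 : ENNReal.ofReal ((b - a) / (2 * b))
      * eLpNorm (above v b) (ENNReal.ofReal (crit N)) volume
      ≤ eLpNorm (fun x => rampPrim a b (v x)) (ENNReal.ofReal (crit N)) volume := by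
    rw [← Real.enorm_of_nonneg hc, ← eLpNorm_const_smul]
    refine eLpNorm_mono fun x => ?_
    rw [Real.norm_of_nonneg (rampPrim_nonneg hab _), Pi.smul_apply, norm_smul,
      Real.norm_of_nonneg hc]
    by_cases hx : b < v x
    · rw [above, indicator_of_mem (show x ∈ {x | b < v x} from hx),
        Real.norm_of_nonneg (by linarith)]
      exact le_rampPrim ha.le hab hx
    · rw [above, indicator_of_notMem (show x ∉ {x | b < v x} from hx), norm_zero, mul_zero]
      exact rampPrim_nonneg hab _
  have h2 : eLpNorm (fun x => ramp a b (v x) • w x) 2 volume ^ 2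
      ≤ ENNReal.ofReal K * (ENNReal.ofReal (a ^ (q - crit N))
        * eLpNorm (above v a) (ENNReal.ofReal (crit N)) volume ^ crit N) := by
    rw [eLpNorm_two_sq]
    calc ∫⁻ x, ‖ramp a b (v x) • w x‖ₑ ^ 2
        ≤ ∫⁻ x, ENNReal.ofReal (ramp a b (v x)) * ‖w x‖ₑ ^ 2 := by
          refine lintegral_mono fun x => ?_
          rw [enorm_smul, mul_pow, Real.enorm_of_nonneg (ramp_nonneg hab _)]
          gcongr
          exact pow_le_of_le_one zero_le
            (ENNReal.ofReal_le_one.2 (ramp_le_one hab _)) two_ne_zero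
      _ ≤ ENNReal.ofReal K * ∫⁻ x, ENNReal.ofReal (v x ^ (q - 1) * rampPrim a b (v x)) :=
          hsub _ _ (hasDerivAt_rampPrim hab) (continuous_ramp a b) (ramp_nonneg hab)
            (ramp_le_one hab) (rampPrim_of_le hab ha.le)
      _ ≤ ENNReal.ofReal K * ∫⁻ x, ENNReal.ofReal (a ^ (q - crit N)) * ‖above v a x‖ₑ ^ crit N := by
          gcongr ENNReal.ofReal K * ?_
          refine lintegral_mono_ae ?_
          filter_upwards [hv0] with x hx
          by_cases hax : a < v x
          · have hvx : 0 < v x := ha.trans hax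
            rw [above, indicator_of_mem (show x ∈ {x | a < v x} from hax),
              Real.enorm_of_nonneg hx, ENNReal.ofReal_rpow_of_pos hvx,
              ← ENNReal.ofReal_mul (by positivity)]
            refine ENNReal.ofReal_le_ofReal ?_
            calc v x ^ (q - 1) * rampPrim a b (v x) ≤ v x ^ (q - 1) * v x := by
                  gcongr
                  exact rampPrim_le ha.le hab hx
              _ = v x ^ (q - crit N) * v x ^ crit N := by
                  rw [← Real.rpow_add hvx, ← Real.rpow_add_one hvx.ne']
                  ring_nf
              _ ≤ a ^ (q - crit N) * v x ^ crit N := by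
                  gcongr ?_ * _
                  exact Real.rpow_le_rpow_of_nonpos ha hax.le (by linarith)
          · rw [rampPrim_of_le hab (not_lt.1 hax)]
            simp
      _ = _ := by
          rw [lintegral_const_mul' _ _ ENNReal.ofReal_ne_top,
            eLpNorm_eq_lintegral_rpow_enorm_toReal (by simpa using hp) (by simp),
            ENNReal.toReal_ofReal hp.le, ← ENNReal.rpow_mul, one_div, inv_mul_cancel₀ hp.ne',
            ENNReal.rpow_one]
  refine h1.trans ((hS _ _ hψS).trans ?_)
  gcongr
  have h3 := ENNReal.rpow_le_rpow h2 (show (0 : ℝ) ≤ ((2 : ℕ) : ℝ)⁻¹ by norm_num)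
  rw [ENNReal.pow_rpow_inv_natCast two_ne_zero] at h3
  exact_mod_cast h3

/-- De Giorgi's boundedness theorem: nonnegative subsolutions of `-Δv ≤ K v^(q-1)` with `q`
subcritical are bounded in terms of `‖∇v‖₂`. -/
theorem exists_bound_of_isPowerSubsolution {N : ℕ} (hN : 3 ≤ N) {K q : ℝ} (hK : 0 < K)
    (hq : 2 < q) (hq' : q < crit N) (A : ℝ) :
    ∃ M : ℝ, 0 < M ∧ ∀ (v : E N → ℝ) (w : E N → E N), Sob v w → Measurable v →
      (∀ᵐ x, 0 ≤ v x) → eLpNorm w 2 volume ≤ ENNReal.ofReal A → IsPowerSubsolution K q v w →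
      ∀ᵐ x, v x ≤ M := by
  obtain ⟨S, hS0, hS⟩ := exists_sobolev_const hN
  have hp2 := two_lt_crit hN
  have hp : 0 < crit N := by linarith
  set p := crit N with hpdef
  set δ : ℝ := p / 2 - 1 with hδ
  have hδ0 : 0 < δ := by rw [hδ]; linarith
  set σ : ℝ := (p - q) / 2 with hσ
  have hσ0 : 0 < σ := by rw [hσ]; linarith
  set Y : ℝ := S * |A| with hY
  have hY0 : 0 ≤ Y := by positivity
  set B₀ : ℝ := 8 * S * K ^ (2⁻¹ : ℝ) with hB₀
  have hB₀0 : 0 < B₀ := by positivity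
  -- Subcriticality enters here: σ > 0, so a high starting level makes the recursion small enough
  -- for geometric decay. The choice uses only S, K, q, N and A, never v.
  obtain ⟨M, hM1, hM⟩ : ∃ M : ℝ, 0 < M ∧ B₀ * M ^ (-σ) * Y ^ δ ≤ 2 ^ (-1 / δ) := by
    have hlim : Tendsto (fun M : ℝ => B₀ * M ^ (-σ) * Y ^ δ) atTop (𝓝 (B₀ * 0 * Y ^ δ)) :=
      ((tendsto_rpow_neg_atTop hσ0).const_mul B₀).mul_const _
    rw [mul_zero, zero_mul] at hlim
    have hpos : (0 : ℝ) < 2 ^ (-1 / δ) := by positivity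
    obtain ⟨M, h1, h2⟩ := ((hlim.eventually (gt_mem_nhds hpos)).and (eventually_gt_atTop 0)).exists
    exact ⟨M, h2, h1.le⟩
  refine ⟨2 * M, by positivity, fun v w h hvm hv0 hA hsub => ?_⟩
  have hnorm : eLpNorm v (ENNReal.ofReal p) volume ≤ ENNReal.ofReal Y := by
    refine (hS v w h).trans ?_
    rw [hY, ENNReal.ofReal_mul hS0.le]
    gcongr
    exact hA.trans (ENNReal.ofReal_le_ofReal (le_abs_self A))
  have habove : ∀ a, eLpNorm (above v a) (ENNReal.ofReal p) volume ≤ ENNReal.ofReal Y := fun a =>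
    (eLpNorm_mono fun x => norm_indicator_le_norm_self _ _).trans hnorm
  have hfin : ∀ a, eLpNorm (above v a) (ENNReal.ofReal p) volume ≠ ⊤ := fun a =>
    ((habove a).trans_lt ENNReal.ofReal_lt_top).ne
  set y : ℝ → ℝ := fun a => (eLpNorm (above v a) (ENNReal.ofReal p) volume).toReal with hy
  have hy0 : ∀ a, 0 ≤ y a := fun a => ENNReal.toReal_nonneg
  have hyY : ∀ a, y a ≤ Y := fun a =>
    ENNReal.toReal_le_of_le_ofReal hY0 (habove a)
  have hymono : ∀ a b, a ≤ b → y b ≤ y a := fun a b hab =>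
    ENNReal.toReal_mono (hfin a) (eLpNorm_mono (norm_above_mono v hab))
  have hstep : ∀ a b, 0 < a → a < b →
      (b - a) / (2 * b) * y b ≤ S * (K * (a ^ (q - p) * y a ^ p)) ^ (2⁻¹ : ℝ) := by
    intro a b ha hab
    have h1 := sobolev_level_step hS hq hq' h hv0 hsub ha hab
    rw [← ENNReal.ofReal_toReal (hfin a), ← ENNReal.ofReal_toReal (hfin b),
      ENNReal.ofReal_rpow_of_nonneg ENNReal.toReal_nonneg hp.le,
      ← ENNReal.ofReal_mul (Real.rpow_nonneg ha.le _), ← ENNReal.ofReal_mul hK.le,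
      ENNReal.ofReal_rpow_of_nonneg (by positivity) (by norm_num), ← ENNReal.ofReal_mul hS0.le,
      ← ENNReal.ofReal_mul (div_nonneg (by linarith) (by linarith))] at h1
    exact (ENNReal.ofReal_le_ofReal_iff (by positivity)).1 h1
  -- The levels increase from M to 2M with geometrically decreasing gaps.
  set l : ℕ → ℝ := fun n => M * (2 - (2 ^ n)⁻¹) with hl
  have hinv : ∀ n : ℕ, (0 : ℝ) < (2 ^ n)⁻¹ ∧ ((2 : ℝ) ^ n)⁻¹ ≤ 1 := fun n =>
    ⟨by positivity, inv_le_one_of_one_le₀ (one_le_pow₀ one_le_two)⟩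
  have hlM : ∀ n, M ≤ l n := fun n => by
    have := (hinv n).2
    simp only [hl]
    nlinarith
  have hl2M : ∀ n, l n ≤ 2 * M := fun n => by
    have := (hinv n).1
    simp only [hl]
    nlinarith
  have hldiff : ∀ n, l (n + 1) - l n = M * (2 ^ (n + 1))⁻¹ := fun n => by
    simp only [hl, pow_succ]
    field_simp
    ring
  have hlt : ∀ n, l n < l (n + 1) := fun n => by
    have := hldiff n
    have h2 : 0 < M * ((2 : ℝ) ^ (n + 1))⁻¹ := by positivity
    linarith
  have hrec : ∀ n, y (l (n + 1)) ≤ (B₀ * M ^ (-σ)) * 2 ^ n * y (l n) ^ (1 + δ) := by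
    intro n
    have hln : 0 < l n := hM1.trans_le (hlM n)
    have h1 := hstep (l n) (l (n + 1)) hln (hlt n)
    have e1 : (K * (l n ^ (q - p) * y (l n) ^ p)) ^ (2⁻¹ : ℝ)
        = K ^ (2⁻¹ : ℝ) * l n ^ (-σ) * y (l n) ^ (1 + δ) := by
      rw [Real.mul_rpow hK.le (mul_nonneg (by positivity) (Real.rpow_nonneg (hy0 _) _)),
        Real.mul_rpow (by positivity) (Real.rpow_nonneg (hy0 _) _),
        ← Real.rpow_mul hln.le, ← Real.rpow_mul (hy0 _), hσ, hδ]
      ring_nf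
    rw [e1] at h1
    -- The gap is M 2^(-n-1) and 2 l(n+1) ≤ 4M, whence the 8 in `B₀`.
    have h2 : ((2 : ℝ) ^ n)⁻¹ / 8 ≤ (l (n + 1) - l n) / (2 * l (n + 1)) := by
      rw [hldiff, div_le_div_iff₀ (by norm_num) (by linarith [hlM (n + 1)]), pow_succ, mul_inv]
      have := hl2M (n + 1)
      have h3 := (hinv n).1
      nlinarith
    have h3 : l n ^ (-σ) ≤ M ^ (-σ) :=
      Real.rpow_le_rpow_of_nonpos hM1 (hlM n) (by linarith)
    have h4 : ((2 : ℝ) ^ n)⁻¹ / 8 * y (l (n + 1))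
        ≤ S * (K ^ (2⁻¹ : ℝ) * M ^ (-σ) * y (l n) ^ (1 + δ)) := by
      calc _ ≤ (l (n + 1) - l n) / (2 * l (n + 1)) * y (l (n + 1)) := by
            gcongr
        _ ≤ _ := h1
        _ ≤ _ := by
            have := hy0 (l n)
            gcongr
    have h5 := mul_le_mul_of_nonneg_left h4 (show (0 : ℝ) ≤ 8 * 2 ^ n by positivity)
    have e2 : (8 * 2 ^ n) * (((2 : ℝ) ^ n)⁻¹ / 8 * y (l (n + 1))) = y (l (n + 1)) := by
      field_simp
    rw [e2] at h5
    refine h5.trans (le_of_eq ?_)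
    rw [hB₀]
    ring
  have hlim := tendsto_zero_of_superlinear (y := fun n => y (l n)) hδ0 hY0 (by positivity)
    (fun n => hy0 _) (hyY _) hrec hM
  have hzero : y (2 * M) = 0 :=
    le_antisymm (ge_of_tendsto' hlim fun n => hymono _ _ (hl2M n)) (hy0 _)
  have hzero' : eLpNorm (above v (2 * M)) (ENNReal.ofReal p) volume = 0 :=
    ((ENNReal.toReal_eq_zero_iff _).1 hzero).resolve_right (hfin _)
  have hmeas : Measurable (above v (2 * M)) :=
    hvm.indicator (measurableSet_lt measurable_const hvm)
  rw [eLpNorm_eq_zero_iff hmeas.aestronglyMeasurable (by simpa using hp)] at hzero'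
  filter_upwards [hzero'] with x hx
  by_contra hcon
  rw [not_le] at hcon
  rw [above, indicator_of_mem (show x ∈ {x | 2 * M < v x} from hcon)] at hx
  simp only [Pi.zero_apply] at hx
  linarith

/-! ### The change of variable G, with bounds uniform in k -/

theorem sqrt_two_thirds : √(2 / 3 : ℝ) = 2 * √(1 / 6) := by
  rw [show (2 / 3 : ℝ) = 2 ^ 2 * (1 / 6) by norm_num, Real.sqrt_mul (by norm_num),
    Real.sqrt_sq (by norm_num)]

theorem third_le_sqrt_sixth : (1 / 3 : ℝ) ≤ √(1 / 6) :=
  Real.le_sqrt_of_sq_le (by norm_num)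

theorem sqrt_sixth_le_half : √(1 / 6 : ℝ) ≤ 1 / 2 := by
  rw [Real.sqrt_le_left (by norm_num)]
  norm_num

theorem joint_pos {k : ℝ} (hk : 0 < k) : 0 < √(1 / (3 * k)) := Real.sqrt_pos.2 (by positivity)

theorem mul_joint_sq {k : ℝ} (hk : 0 < k) : k * √(1 / (3 * k)) ^ 2 = 1 / 3 := by
  rw [Real.sq_sqrt (by positivity)]
  field_simp

/-- Matching of the two branches of `g`: at the joint the second equals 2√(1/6) = √(2/3), which is
the value √(1 - 1/3) of the first. -/
theorem tail_at_joint {k : ℝ} (hk : 0 < k) :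
    1 / (3 * √(2 * k)) / √(1 / (3 * k)) = √(1 / 6) := by
  rw [div_div, mul_assoc, ← Real.sqrt_mul (by positivity),
    show 2 * k * (1 / (3 * k)) = 2 / 3 by field_simp, sqrt_two_thirds]
  have h := Real.sq_sqrt (show (0 : ℝ) ≤ 1 / 6 by norm_num)
  have h2 : √(1 / 6 : ℝ) ≠ 0 := by
    have := third_le_sqrt_sixth
    linarith
  rw [div_eq_iff (by positivity)]
  linarith

/-- The two branches of `g` in one formula. -/
theorem g_eq {k : ℝ} (hk : 0 < k) (t : ℝ) :
    g k t = √(1 - k * min |t| √(1 / (3 * k)) ^ 2)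
      + (1 / (3 * √(2 * k)) / max |t| √(1 / (3 * k)) - √(1 / 6)) := by
  rw [g]
  split_ifs with h
  · rw [min_eq_left h.le, max_eq_right h.le, tail_at_joint hk, sq_abs]
    ring
  · rw [not_lt] at h
    rw [min_eq_right h, max_eq_left h, mul_joint_sq hk,
      show (1 - 1 / 3 : ℝ) = 2 / 3 by norm_num, sqrt_two_thirds, div_div]
    ring

/-- A lower bound free of `k`. It makes G⁻¹ Lipschitz with constant 3 and 1/g at most 3, the source
of all powers of 3 in the estimates below. -/
theorem third_le_g {k : ℝ} (hk : 0 < k) (t : ℝ) : 1 / 3 ≤ g k t := by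
  rw [g]
  split_ifs with h
  · refine Real.le_sqrt_of_sq_le ?_
    have h1 : t ^ 2 ≤ √(1 / (3 * k)) ^ 2 := by
      rw [← sq_abs t]
      gcongr
    have h2 := mul_joint_sq hk
    nlinarith
  · have h1 := third_le_sqrt_sixth
    have h2 : 0 ≤ 1 / (3 * √(2 * k) * |t|) := by positivity
    linarith

theorem g_pos {k : ℝ} (hk : 0 < k) (t : ℝ) : 0 < g k t := by linarith [third_le_g hk t]

theorem inv_g_le_three {k : ℝ} (hk : 0 < k) (t : ℝ) : (g k t)⁻¹ ≤ 3 := by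
  rw [inv_le_comm₀ (g_pos hk t) (by norm_num)]
  linarith [third_le_g hk t]

theorem inv_g_nonneg {k : ℝ} (hk : 0 < k) (t : ℝ) : 0 ≤ (g k t)⁻¹ := (inv_pos.2 (g_pos hk t)).le

/-- Gives G(t) ≤ t, hence s ≤ G⁻¹(s), for nonnegative arguments. This lets F(G⁻¹(s)) be bounded
below by F(s) in the estimate of the mountain pass level. -/
theorem g_le_one {k : ℝ} (hk : 0 < k) (t : ℝ) : g k t ≤ 1 := by
  rw [g]
  split_ifs with h
  · have : 0 ≤ k * t ^ 2 := by positivity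
    exact Real.sqrt_le_one.2 (by linarith)
  · rw [not_lt] at h
    have h0 := joint_pos hk
    have h1 : 1 / (3 * √(2 * k) * |t|) ≤ 1 / (3 * √(2 * k)) / √(1 / (3 * k)) := by
      rw [div_div]
      gcongr
    rw [tail_at_joint hk] at h1
    linarith [sqrt_sixth_le_half]

/-- In the unified formula the clipped arguments are 1-Lipschitz in t. Rationalising the difference
of square roots, whose sum is at least 2/3 while the clipped arguments add to at most 2j, gives 3kj;
the hyperbola gives c/j². The constant depends on `k`, harmlessly: it only serves continuity and the
proof of Pohozaev's identity, which carries no constant. -/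
theorem g_lipschitz {k : ℝ} (hk : 0 < k) :
    ∃ L : ℝ, 0 ≤ L ∧ ∀ s t, |g k s - g k t| ≤ L * |s - t| := by
  set j := √(1 / (3 * k)) with hj
  have hj0 : 0 < j := joint_pos hk
  set c := 1 / (3 * √(2 * k)) with hc
  have hc0 : 0 < c := by positivity
  refine ⟨k * j * 3 + c / j ^ 2, by positivity, fun s t => ?_⟩
  have habs : |(|s| - |t|)| ≤ |s - t| := abs_abs_sub_abs_le_abs_sub s t
  have hsq : ∀ t : ℝ, 1 / 3 ≤ √(1 - k * min |t| j ^ 2) := by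
    intro t
    refine Real.le_sqrt_of_sq_le ?_
    have h1 : min |t| j ^ 2 ≤ j ^ 2 := by
      gcongr
      exact min_le_right _ _
    have h2 := mul_joint_sq hk
    nlinarith
  have hin : ∀ t : ℝ, 0 ≤ 1 - k * min |t| j ^ 2 := fun t =>
    (Real.sqrt_pos.1 (by linarith [hsq t])).le
  have h1 : |√(1 - k * min |s| j ^ 2) - √(1 - k * min |t| j ^ 2)| ≤ k * j * 3 * |s - t| := by
    set a := min |s| j
    set b := min |t| j
    have ha : 0 ≤ a := le_min (abs_nonneg _) hj0.le
    have hb : 0 ≤ b := le_min (abs_nonneg _) hj0.le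
    have haj : a ≤ j := min_le_right _ _
    have hbj : b ≤ j := min_le_right _ _
    have hab : |a - b| ≤ |s - t| := by
      have := abs_min_sub_min_le_max |s| j |t| j
      rw [sub_self, abs_zero, max_eq_left (abs_nonneg _)] at this
      exact this.trans habs
    have hA := hsq s
    have hB := hsq t
    have e : (√(1 - k * a ^ 2) - √(1 - k * b ^ 2)) * (√(1 - k * a ^ 2) + √(1 - k * b ^ 2))
        = k * (a + b) * (b - a) := by
      have e1 := Real.sq_sqrt (hin s)
      have e2 := Real.sq_sqrt (hin t)
      linear_combination e1 - e2
    have e' := congrArg abs e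
    rw [abs_mul, abs_mul, abs_of_nonneg (show 0 ≤ k * (a + b) by positivity),
      abs_of_pos (show 0 < √(1 - k * a ^ 2) + √(1 - k * b ^ 2) by linarith),
      abs_sub_comm b a] at e'
    have h3 : k * (a + b) * |a - b| ≤ k * (j + j) * |s - t| := by gcongr
    have h4 : |√(1 - k * a ^ 2) - √(1 - k * b ^ 2)| * (2 / 3)
        ≤ |√(1 - k * a ^ 2) - √(1 - k * b ^ 2)| * (√(1 - k * a ^ 2) + √(1 - k * b ^ 2)) := by
      gcongr
      linarith
    linarith
  have h2 : |c / max |s| j - c / max |t| j| ≤ c / j ^ 2 * |s - t| := by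
    set a := max |s| j
    set b := max |t| j
    have haj : j ≤ a := le_max_right _ _
    have hbj : j ≤ b := le_max_right _ _
    have hab : |a - b| ≤ |s - t| := by
      have := abs_max_sub_max_le_max |s| j |t| j
      rw [sub_self, abs_zero, max_eq_left (abs_nonneg (|s| - |t|))] at this
      exact this.trans habs
    have ha0 : 0 < a := by linarith
    have hb0 : 0 < b := by linarith
    have e : c / a - c / b = c / (a * b) * (b - a) := by
      field_simp
    rw [e, abs_mul, abs_of_pos (by positivity), abs_sub_comm]
    have : j ^ 2 ≤ a * b := by nlinarith
    gcongr
  rw [g_eq hk, g_eq hk]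
  calc _ = |(√(1 - k * min |s| j ^ 2) - √(1 - k * min |t| j ^ 2))
          + (c / max |s| j - c / max |t| j)| := by
        congr 1
        ring
    _ ≤ _ := (abs_add_le _ _).trans (by linarith)

theorem continuous_g {k : ℝ} (hk : 0 < k) : Continuous (g k) := by
  obtain ⟨L, hL, h⟩ := g_lipschitz hk
  exact (LipschitzWith.of_dist_le_mul (K := ⟨L, hL⟩) fun s t => h s t).continuous

theorem hasDerivAt_G {k : ℝ} (hk : 0 < k) (t : ℝ) : HasDerivAt (G k) (g k t) t :=
  (continuous_g hk).integral_hasStrictDerivAt 0 t |>.hasDerivAt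

theorem G_sub {k : ℝ} (hk : 0 < k) (a b : ℝ) : G k b - G k a = ∫ s in a..b, g k s :=
  intervalIntegral.integral_interval_sub_left ((continuous_g hk).intervalIntegrable _ _)
    ((continuous_g hk).intervalIntegrable _ _)

theorem le_G_sub {k : ℝ} (hk : 0 < k) {a b : ℝ} (hab : a ≤ b) : (b - a) / 3 ≤ G k b - G k a := by
  rw [G_sub hk]
  have := intervalIntegral.integral_mono_on (μ := volume) hab
    (intervalIntegrable_const (c := (1 / 3 : ℝ)))
    ((continuous_g hk).intervalIntegrable a b) fun s _ => third_le_g hk s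
  rw [intervalIntegral.integral_const, smul_eq_mul] at this
  linarith

theorem G_sub_le {k : ℝ} (hk : 0 < k) {a b : ℝ} (hab : a ≤ b) : G k b - G k a ≤ b - a := by
  rw [G_sub hk]
  have := intervalIntegral.integral_mono_on (μ := volume) hab
    ((continuous_g hk).intervalIntegrable a b)
    (intervalIntegrable_const (c := (1 : ℝ))) fun s _ => g_le_one hk s
  rw [intervalIntegral.integral_const, smul_eq_mul] at this
  linarith

theorem G_zero (k : ℝ) : G k 0 = 0 := by simp [G]

theorem continuous_G {k : ℝ} (hk : 0 < k) : Continuous (G k) :=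
  continuous_iff_continuousAt.2 fun t => (hasDerivAt_G hk t).continuousAt

theorem strictMono_G {k : ℝ} (hk : 0 < k) : StrictMono (G k) := fun a b hab => by
  have := le_G_sub hk hab.le
  linarith

theorem surjective_G {k : ℝ} (hk : 0 < k) : Function.Surjective (G k) := by
  refine (continuous_G hk).surjective ?_ ?_
  · refine tendsto_atTop_mono' _ ?_ (tendsto_id.atTop_div_const (show (0 : ℝ) < 3 by norm_num))
    filter_upwards [eventually_ge_atTop 0] with t ht
    have := le_G_sub hk ht
    rw [G_zero] at this
    simpa using this
  · refine tendsto_atBot_mono' _ ?_ (tendsto_id.atBot_div_const (show (0 : ℝ) < 3 by norm_num))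
    filter_upwards [eventually_le_atBot 0] with t ht
    have := le_G_sub hk ht
    rw [G_zero] at this
    simp only [id]
    linarith

theorem G_Ginv {k : ℝ} (hk : 0 < k) (s : ℝ) : G k (Ginv k s) = s :=
  Function.rightInverse_invFun (surjective_G hk) s

theorem Ginv_zero {k : ℝ} (hk : 0 < k) : Ginv k 0 = 0 :=
  (strictMono_G hk).injective (by rw [G_Ginv hk, G_zero])

theorem strictMono_Ginv {k : ℝ} (hk : 0 < k) : StrictMono (Ginv k) := fun a b hab => by
  rw [← (strictMono_G hk).lt_iff_lt, G_Ginv hk, G_Ginv hk]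
  exact hab

theorem Ginv_sub_le {k : ℝ} (hk : 0 < k) {a b : ℝ} (hab : a ≤ b) :
    Ginv k b - Ginv k a ≤ 3 * (b - a) := by
  have := le_G_sub hk ((strictMono_Ginv hk).monotone hab)
  rw [G_Ginv hk, G_Ginv hk] at this
  linarith

theorem abs_Ginv_sub_le {k : ℝ} (hk : 0 < k) (a b : ℝ) :
    |Ginv k a - Ginv k b| ≤ 3 * |a - b| := by
  wlog hab : b ≤ a generalizing a b
  · rw [abs_sub_comm, abs_sub_comm a b]
    exact this b a (le_of_not_ge hab)
  rw [abs_of_nonneg (by linarith [(strictMono_Ginv hk).monotone hab]), abs_of_nonneg (by linarith)]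
  exact Ginv_sub_le hk hab

theorem abs_Ginv_le {k : ℝ} (hk : 0 < k) (s : ℝ) : |Ginv k s| ≤ 3 * |s| := by
  simpa [Ginv_zero hk] using abs_Ginv_sub_le hk s 0

theorem Ginv_nonneg {k : ℝ} (hk : 0 < k) {s : ℝ} (hs : 0 ≤ s) : 0 ≤ Ginv k s := by
  have := (strictMono_Ginv hk).monotone hs
  rwa [Ginv_zero hk] at this

theorem Ginv_le {k : ℝ} (hk : 0 < k) {s : ℝ} (hs : 0 ≤ s) : Ginv k s ≤ 3 * s := by
  simpa [Ginv_zero hk] using Ginv_sub_le hk hs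

theorem le_Ginv {k : ℝ} (hk : 0 < k) {s : ℝ} (hs : 0 ≤ s) : s ≤ Ginv k s := by
  have := G_sub_le hk (Ginv_nonneg hk hs)
  rw [G_Ginv hk, G_zero] at this
  linarith

theorem continuous_Ginv {k : ℝ} (hk : 0 < k) : Continuous (Ginv k) :=
  (LipschitzWith.of_dist_le_mul (K := 3) fun s t => abs_Ginv_sub_le hk s t).continuous

theorem hasDerivAt_Ginv {k : ℝ} (hk : 0 < k) (s : ℝ) :
    HasDerivAt (Ginv k) (g k (Ginv k s))⁻¹ s :=
  HasDerivAt.of_local_left_inverse (continuous_Ginv hk).continuousAt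
    (hasDerivAt_G hk _) (g_pos hk _).ne' (Eventually.of_forall fun t => G_Ginv hk t)

/-! ### Growth of f and F -/

theorem ext_of_nonneg (f : ℝ → ℝ) {s : ℝ} (hs : 0 ≤ s) : ext f s = f s := by
  rw [ext, max_eq_left hs]

theorem CondF1.nonneg {f : ℝ → ℝ} (h : CondF1 f) {s : ℝ} (hs : 0 ≤ s) : 0 ≤ f s := by
  rcases hs.eq_or_lt with rfl | hs
  · exact h.2.1.ge
  · exact (h.2.2 s hs).le

theorem CondF1.ext_nonneg {f : ℝ → ℝ} (h : CondF1 f) (s : ℝ) : 0 ≤ ext f s :=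
  h.nonneg (le_max_right _ _)

theorem CondF1.continuous_ext {f : ℝ → ℝ} (h : CondF1 f) : Continuous (ext f) :=
  h.1.continuousOn.comp_continuous (by fun_prop) fun s => mem_Ici.2 (le_max_right _ _)

theorem CondF1.differentiableAt {f : ℝ → ℝ} (h : CondF1 f) {s : ℝ} (hs : 0 < s) :
    DifferentiableAt ℝ f s :=
  (h.1.differentiableOn (by simp)).differentiableAt (Ici_mem_nhds hs)

theorem CondF1.hasDerivAt_F {f : ℝ → ℝ} (h : CondF1 f) (s : ℝ) :
    HasDerivAt (F f) (ext f s) s :=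
  (h.continuous_ext.integral_hasStrictDerivAt 0 s).hasDerivAt

theorem F_zero (f : ℝ → ℝ) : F f 0 = 0 := by simp [F]

theorem CondF1.monotone_F {f : ℝ → ℝ} (h : CondF1 f) : Monotone (F f) :=
  monotone_of_hasDerivAt_nonneg h.hasDerivAt_F h.ext_nonneg

theorem CondF1.F_nonneg {f : ℝ → ℝ} (h : CondF1 f) {s : ℝ} (hs : 0 ≤ s) : 0 ≤ F f s := by
  have := h.monotone_F hs
  rwa [F_zero] at this

theorem CondF1.exists_slope {f : ℝ → ℝ} (h : CondF1 f) {a b : ℝ} (ha : 0 ≤ a) (hab : a < b) :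
    ∃ c ∈ Ioo a b, deriv f c = (f b - f a) / (b - a) :=
  exists_deriv_eq_slope f hab (h.1.continuousOn.mono fun _ hx => ha.trans hx.1)
    fun _ hx => (h.differentiableAt (ha.trans_lt hx.1)).differentiableWithinAt

/-- Subcritical growth: linear with an arbitrarily small constant, plus a power. -/
theorem exists_growth_bound {N : ℕ} {f : ℝ → ℝ} (h1 : CondF1 f) (h2 : CondF2 N f) :
    ∃ q : ℝ, 2 < q ∧ q < crit N ∧ ∀ lam : ℝ, 0 < lam → ∃ K : ℝ, 0 < K ∧
      ∀ u : ℝ, 0 ≤ u → f u ≤ lam * u + K * u ^ (q - 1) := by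
  obtain ⟨α, β, μ₁, μ₂, hμ₁, hμ₂, hα, -, hβ, hβ', hl0, hl1⟩ := h2
  refine ⟨β, hβ, hβ', fun lam hlam => ?_⟩
  -- Because α > 2, f' tends to 0 at the origin; by the mean value theorem f(u) ≤ λu for small u,
  -- however small λ is.
  have hd0 : Tendsto (deriv f) (𝓝[>] 0) (𝓝 0) := by
    have hp : Tendsto (fun t : ℝ => t ^ (α - 2)) (𝓝[>] 0) (𝓝 0) := by
      have := (Real.continuousAt_rpow_const 0 (α - 2) (Or.inr (by linarith))).tendsto
      rw [Real.zero_rpow (by linarith)] at this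
      exact this.mono_left nhdsWithin_le_nhds
    have := hl0.mul hp
    rw [mul_zero] at this
    refine this.congr' ?_
    filter_upwards [self_mem_nhdsWithin] with t ht
    exact div_mul_cancel₀ _ (Real.rpow_pos_of_pos ht _).ne'
  obtain ⟨δ, hδ, hδ'⟩ : ∃ δ > 0, ∀ t ∈ Ioo (0 : ℝ) δ, deriv f t < lam := by
    have := hd0.eventually (gt_mem_nhds hlam)
    obtain ⟨δ, hδ, h⟩ := mem_nhdsGT_iff_exists_Ioo_subset.1 this
    exact ⟨δ, hδ, fun t ht => h ht⟩
  obtain ⟨T, hT⟩ := eventually_atTop.1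
    (hl1.eventually (gt_mem_nhds (show μ₂ * (β - 1) < μ₂ * (β - 1) + 1 by linarith)))
  set D := μ₂ * (β - 1) + 1 with hD
  have hD0 : 0 < D := by
    have : 0 < μ₂ * (β - 1) := mul_pos hμ₂ (by linarith)
    linarith
  set T₁ := max T (max δ 1) with hT₁
  have hT1 : 1 ≤ T₁ := (le_max_right _ _).trans (le_max_right _ _)
  have hTδ : δ ≤ T₁ := (le_max_left _ _).trans (le_max_right _ _)
  -- On the middle range f is at most |B|, which is absorbed in a multiple of u^(β-1) since u stays
  -- away from 0. Beyond `T₁` the mean value theorem with f'(t) ≤ D t^(β-2) takes over.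
  obtain ⟨B, hB⟩ := (isCompact_Icc (a := δ / 2) (b := T₁)).exists_bound_of_continuousOn
    (h1.1.continuousOn.mono fun x hx => (show (0 : ℝ) ≤ δ / 2 by positivity).trans hx.1)
  set P := (δ / 2) ^ (β - 1) with hP
  have hP0 : 0 < P := by positivity
  have hB0 : 0 ≤ |B| / P := by positivity
  refine ⟨|B| / P + D, by positivity, fun u hu => ?_⟩
  have hlin : 0 ≤ lam * u := by positivity
  have hup : 0 ≤ u ^ (β - 1) := by positivity
  rcases hu.eq_or_lt with rfl | hu0
  · rw [h1.2.1]
    positivity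
  rcases lt_or_ge u δ with hu1 | hu1
  · obtain ⟨c, hc, hc'⟩ := h1.exists_slope le_rfl hu0
    rw [h1.2.1, sub_zero, sub_zero, eq_div_iff hu0.ne'] at hc'
    have := hδ' c ⟨hc.1, hc.2.trans hu1⟩
    have h3 : f u ≤ lam * u := by
      rw [← hc']
      gcongr
    have : 0 ≤ (|B| / P + D) * u ^ (β - 1) := by positivity
    linarith
  · have hPu : P ≤ u ^ (β - 1) := by
      rw [hP]
      gcongr
      · linarith
      · linarith
    have hBu : |B| ≤ |B| / P * u ^ (β - 1) := by
      rw [div_mul_eq_mul_div, le_div_iff₀ hP0]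
      gcongr
    rcases le_or_gt u T₁ with hu2 | hu2
    · have h3 : f u ≤ |B| :=
        ((le_abs_self _).trans (hB u ⟨by linarith, hu2⟩)).trans (le_abs_self _)
      have : 0 ≤ D * u ^ (β - 1) := by positivity
      linarith
    · obtain ⟨c, hc, hc'⟩ := h1.exists_slope (show 0 ≤ T₁ by linarith) hu2
      rw [eq_div_iff (by linarith)] at hc'
      have hc0 : 0 < c := by linarith [hc.1]
      have h4 := hT c ((le_max_left _ _).trans hc.1.le)
      rw [div_lt_iff₀ (by positivity)] at h4
      have h5 : f T₁ ≤ |B| :=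
        ((le_abs_self _).trans (hB T₁ ⟨by linarith, le_rfl⟩)).trans (le_abs_self _)
      have h6 : deriv f c * (u - T₁) ≤ D * u ^ (β - 1) := by
        calc deriv f c * (u - T₁) ≤ D * c ^ (β - 2) * (u - T₁) := by
              gcongr
          _ ≤ D * u ^ (β - 2) * u := by
              have := hc.2.le
              gcongr
              · linarith
          _ = D * u ^ (β - 1) := by
              rw [mul_assoc, ← Real.rpow_add_one hu0.ne']
              ring_nf
      linarith

/-- The primitive grows faster than any quadratic. -/
theorem exists_quadratic_lower_bound {N : ℕ} {f : ℝ → ℝ} (h1 : CondF1 f) (h2 : CondF2 N f)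
    (L : ℝ) : ∃ T : ℝ, 0 < T ∧ ∀ s, T ≤ s → L / 2 * (s - T) ^ 2 ≤ F f s := by
  obtain ⟨α, β, μ₁, μ₂, hμ₁, hμ₂, hα, -, hβ, hβ', hl0, hl1⟩ := h2
  -- Since β > 2, f' is eventually above any L; two integrations from T give the quadratic bound.
  have hd : Tendsto (deriv f) atTop atTop := by
    have hc : 0 < μ₂ * (β - 1) := mul_pos hμ₂ (by linarith)
    have := hl1.pos_mul_atTop hc (tendsto_rpow_atTop (show 0 < β - 2 by linarith))
    refine this.congr' ?_
    filter_upwards [eventually_gt_atTop 0] with t ht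
    exact div_mul_cancel₀ _ (Real.rpow_pos_of_pos ht _).ne'
  obtain ⟨T₀, hT₀⟩ := eventually_atTop.1 (hd.eventually_ge_atTop L)
  set T := max T₀ 1 with hT
  have hT0 : 0 < T := lt_of_lt_of_le one_pos (le_max_right _ _)
  refine ⟨T, hT0, fun s hs => ?_⟩
  have hf : ∀ t, T ≤ t → L * (t - T) ≤ f t := by
    intro t ht
    rcases ht.eq_or_lt with rfl | ht
    · simpa using h1.nonneg hT0.le
    · obtain ⟨c, hc, hc'⟩ := h1.exists_slope hT0.le ht
      rw [eq_div_iff (by linarith)] at hc'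
      have h3 := hT₀ c ((le_max_left _ _).trans hc.1.le)
      have h4 : L * (t - T) ≤ deriv f c * (t - T) := by
        gcongr
      linarith [h1.nonneg hT0.le]
  have hmono : MonotoneOn (fun s => F f s - L / 2 * (s - T) ^ 2) (Ici T) := by
    have hder : ∀ s, HasDerivAt (fun s => F f s - L / 2 * (s - T) ^ 2)
        (ext f s - L * (s - T)) s := by
      intro s
      have := (h1.hasDerivAt_F s).sub
        ((((hasDerivAt_id s).sub_const T).pow 2).const_mul (L / 2))
      refine this.congr_deriv ?_
      simp only [id, Nat.cast_ofNat, Nat.add_one_sub_one, pow_one]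
      ring
    refine monotoneOn_of_deriv_nonneg (convex_Ici T)
      (fun s _ => (hder s).continuousAt.continuousWithinAt)
      (fun s _ => (hder s).differentiableAt.differentiableWithinAt) fun s hs => ?_
    rw [interior_Ici] at hs
    rw [(hder s).deriv, ext_of_nonneg f (hT0.le.trans (le_of_lt hs)), sub_nonneg]
    exact hf s (le_of_lt hs)
  have := hmono (mem_Ici.2 le_rfl) (mem_Ici.2 hs) hs
  simp only [sub_self, ne_eq, OfNat.ofNat_ne_zero, not_false_eq_true, zero_pow, mul_zero,
    sub_zero] at this
  linarith [h1.F_nonneg hT0.le]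

/-- The derivative within [0, ∞) is continuous up to 0, hence bounded on the compact interval. The
two-sided derivative at 0 is unusable because f is unconstrained on the negative axis. -/
theorem CondF1.exists_lipschitz {f : ℝ → ℝ} (h : CondF1 f) (M : ℝ) :
    ∃ L : ℝ, 0 ≤ L ∧ ∀ a ∈ Icc 0 M, ∀ b ∈ Icc 0 M, |f a - f b| ≤ L * |a - b| := by
  have hd : ContinuousOn (derivWithin f (Ici 0)) (Icc 0 M) :=
    (h.1.continuousOn_derivWithin (uniqueDiffOn_Ici 0) (by simp)).mono fun x hx => hx.1
  obtain ⟨B, hB⟩ := isCompact_Icc.exists_bound_of_continuousOn hd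
  refine ⟨|B|, abs_nonneg B, fun a ha b hb => ?_⟩
  exact Convex.norm_image_sub_le_of_norm_hasDerivWithin_le (s := Icc 0 M)
    (f := f) (f' := derivWithin f (Ici 0))
    (fun x hx => (((h.1.differentiableOn (by simp)) x hx.1).hasDerivWithinAt).mono
      fun y hy => hy.1)
    (fun x hx => (hB x hx).trans (le_abs_self B)) (convex_Icc _ _) hb ha

/-! ### The transformed nonlinearity h and its primitive H -/

/-- The right-hand side minus the linear term of the transformed equation. -/
def rhs (f : ℝ → ℝ) (lam k s : ℝ) : ℝ :=
  (ext f (Ginv k s) - lam * Ginv k s) / g k (Ginv k s)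

/-- The primitive of `rhs`. -/
def rhsPrim (f : ℝ → ℝ) (lam k s : ℝ) : ℝ := F f (Ginv k s) - lam / 2 * Ginv k s ^ 2

theorem continuous_rhs {f : ℝ → ℝ} (hf : CondF1 f) (lam : ℝ) {k : ℝ} (hk : 0 < k) :
    Continuous (rhs f lam k) := by
  have h1 := continuous_Ginv hk
  exact ((hf.continuous_ext.comp h1).sub (h1.const_mul lam)).div ((continuous_g hk).comp h1)
    fun s => (g_pos hk _).ne'

theorem hasDerivAt_rhsPrim {f : ℝ → ℝ} (hf : CondF1 f) (lam : ℝ) {k : ℝ} (hk : 0 < k) (s : ℝ) :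
    HasDerivAt (rhsPrim f lam k) (rhs f lam k s) s := by
  have h1 := hasDerivAt_Ginv hk s
  have h2 := ((hf.hasDerivAt_F (Ginv k s)).comp s h1).sub ((h1.pow 2).const_mul (lam / 2))
  refine h2.congr_deriv ?_
  rw [rhs]
  simp only [Nat.cast_ofNat, Nat.add_one_sub_one, pow_one, div_eq_mul_inv]
  ring

theorem rhs_zero {f : ℝ → ℝ} (hf : CondF1 f) (lam : ℝ) {k : ℝ} (hk : 0 < k) :
    rhs f lam k 0 = 0 := by
  simp [rhs, Ginv_zero hk, ext, hf.2.1]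

theorem rhsPrim_zero (f : ℝ → ℝ) (lam : ℝ) {k : ℝ} (hk : 0 < k) : rhsPrim f lam k 0 = 0 := by
  simp [rhsPrim, Ginv_zero hk, F_zero]

/-- A quotient of Lipschitz functions with denominator at least 1/3, composed with the 3-Lipschitz
G⁻¹. It supplies the quadratic Taylor remainder of H; L may depend on `k` and M. -/
theorem exists_rhs_lipschitz {f : ℝ → ℝ} (hf : CondF1 f) (lam : ℝ) {k : ℝ} (hk : 0 < k)
    {M : ℝ} (hM : 0 ≤ M) :
    ∃ L : ℝ, 0 ≤ L ∧ ∀ a ∈ Icc 0 M, ∀ b ∈ Icc 0 M,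
      |rhs f lam k a - rhs f lam k b| ≤ L * |a - b| := by
  obtain ⟨L₁, hL₁, hf1⟩ := hf.exists_lipschitz (3 * M)
  obtain ⟨L₂, hL₂, hg⟩ := g_lipschitz hk
  set L₃ := L₁ + |lam| with hL₃
  have hL₃0 : 0 ≤ L₃ := by positivity
  refine ⟨(3 * L₃ + 9 * (L₃ * (3 * M)) * L₂) * 3, by positivity, fun a ha b hb => ?_⟩
  have hmem : ∀ s ∈ Icc 0 M, Ginv k s ∈ Icc 0 (3 * M) := fun s hs =>
    ⟨Ginv_nonneg hk hs.1, (Ginv_le hk hs.1).trans (by linarith [hs.2])⟩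
  have hab := abs_Ginv_sub_le hk a b
  have hA := hmem a ha
  have hB := hmem b hb
  rw [rhs, rhs, ext_of_nonneg f hA.1, ext_of_nonneg f hB.1]
  set x := Ginv k a
  set y := Ginv k b
  have hx := third_le_g hk x
  have hy := third_le_g hk y
  have hφ : ∀ s ∈ Icc 0 (3 * M), ∀ t ∈ Icc 0 (3 * M),
      |(f s - lam * s) - (f t - lam * t)| ≤ L₃ * |s - t| := by
    intro s hs t ht
    calc |(f s - lam * s) - (f t - lam * t)| = |(f s - f t) - lam * (s - t)| := by
          congr 1
          ring
      _ ≤ |f s - f t| + |lam * (s - t)| := abs_sub _ _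
      _ ≤ L₁ * |s - t| + |lam| * |s - t| := by
          rw [abs_mul]
          gcongr
          exact hf1 s hs t ht
      _ = L₃ * |s - t| := by rw [hL₃]; ring
  have hφy : |f y - lam * y| ≤ L₃ * (3 * M) := by
    have h0 := hφ y hB 0 ⟨le_rfl, by positivity⟩
    rw [hf.2.1] at h0
    simp only [mul_zero, sub_zero] at h0
    refine h0.trans ?_
    gcongr
    rw [abs_of_nonneg hB.1]
    exact hB.2
  have hinv0 : ∀ z, 0 < (g k z)⁻¹ := fun z => inv_pos.2 (g_pos hk z)
  have e : (f x - lam * x) / g k x - (f y - lam * y) / g k y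
      = ((f x - lam * x) - (f y - lam * y)) * (g k x)⁻¹
        + (f y - lam * y) * ((g k x)⁻¹ * (g k y)⁻¹ * (g k y - g k x)) := by
    have := (g_pos hk x).ne'
    have := (g_pos hk y).ne'
    field_simp
    ring
  rw [e]
  calc _ ≤ |(f x - lam * x) - (f y - lam * y)| * (g k x)⁻¹
        + |f y - lam * y| * ((g k x)⁻¹ * (g k y)⁻¹ * |g k y - g k x|) := by
        refine (abs_add_le _ _).trans (le_of_eq ?_)
        rw [abs_mul, abs_mul, abs_mul, abs_of_pos (mul_pos (hinv0 x) (hinv0 y)),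
          abs_of_pos (hinv0 x)]
    _ ≤ (L₃ * |x - y|) * 3 + (L₃ * (3 * M)) * (3 * 3 * (L₂ * |x - y|)) := by
        have i1 := inv_g_le_three hk x
        have i2 := inv_g_le_three hk y
        have i3 := hinv0 x
        have i4 := hinv0 y
        have i5 := hφ x hA y hB
        have i6 := hg y x
        rw [abs_sub_comm y x] at i6
        gcongr
    _ = (3 * L₃ + 9 * (L₃ * (3 * M)) * L₂) * |x - y| := by ring
    _ ≤ (3 * L₃ + 9 * (L₃ * (3 * M)) * L₂) * (3 * |a - b|) := by gcongr
    _ = _ := by ring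

/-- Second-order Taylor estimates for the potential on bounded intervals. -/
theorem exists_rhsPrim_taylor {f : ℝ → ℝ} (hf : CondF1 f) (lam : ℝ) {k : ℝ} (hk : 0 < k)
    {M : ℝ} (hM : 0 ≤ M) :
    ∃ L : ℝ, 0 ≤ L ∧ (∀ a ∈ Icc 0 M, ∀ b ∈ Icc 0 M,
      |rhsPrim f lam k b - rhsPrim f lam k a - rhs f lam k a * (b - a)| ≤ L * (b - a) ^ 2) ∧
      (∀ a ∈ Icc 0 M, |rhs f lam k a| ≤ L * a) ∧ ∀ a ∈ Icc 0 M, |rhsPrim f lam k a| ≤ L * a ^ 2 := by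
  obtain ⟨L, hL, hlip⟩ := exists_rhs_lipschitz hf lam hk hM
  have h1 : ∀ a ∈ Icc 0 M, ∀ b ∈ Icc 0 M,
      |rhsPrim f lam k b - rhsPrim f lam k a - rhs f lam k a * (b - a)| ≤ L * (b - a) ^ 2 := by
    intro a ha b hb
    -- Mean value inequality for s ↦ H(s) - h(a)s, whose derivative h(s) - h(a) is at most L|b - a|
    -- between a and b.
    have := Convex.norm_image_sub_le_of_norm_hasDerivWithin_le (s := uIcc a b)
      (f := fun s => rhsPrim f lam k s - rhs f lam k a * s)
      (f' := fun s => rhs f lam k s - rhs f lam k a) (C := L * |b - a|)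
      (fun x hx => ((hasDerivAt_rhsPrim hf lam hk x).sub
        (by simpa using (hasDerivAt_id x).const_mul (rhs f lam k a))).hasDerivWithinAt)
      (fun x hx => by
        have hxM : x ∈ Icc 0 M := (convex_Icc 0 M).ordConnected.uIcc_subset ha hb hx
        exact (hlip x hxM a ha).trans
          (mul_le_mul_of_nonneg_left (abs_sub_left_of_mem_uIcc hx) hL))
      (convex_uIcc a b) left_mem_uIcc right_mem_uIcc
    simp only [Real.norm_eq_abs] at this
    calc _ = |rhsPrim f lam k b - rhs f lam k a * b - (rhsPrim f lam k a - rhs f lam k a * a)| := by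
          congr 1
          ring
      _ ≤ _ := this
      _ = L * (b - a) ^ 2 := by rw [mul_assoc, ← sq, sq_abs]
  refine ⟨L, hL, h1, fun a ha => ?_, fun a ha => ?_⟩
  · have := hlip a ha 0 ⟨le_rfl, hM⟩
    rwa [rhs_zero hf lam hk, sub_zero, sub_zero, abs_of_nonneg ha.1] at this
  · have := h1 0 ⟨le_rfl, hM⟩ a ha
    rwa [rhs_zero hf lam hk, rhsPrim_zero f lam hk, sub_zero, sub_zero, zero_mul, sub_zero] at this

/-! ### Dilations of Sobolev functions -/

theorem memLp_comp_smul {N : ℕ} {F : Type*} [NormedAddCommGroup F] {p : ENNReal} {w : E N → F}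
    (hw : MemLp w p volume) {t : ℝ} (ht : 0 < t) : MemLp (fun x => w (t • x)) p volume := by
  have he : MeasurableEmbedding fun x : E N => t • x :=
    (Homeomorph.smulOfNeZero t ht.ne').measurableEmbedding
  have h1 : MemLp w p (Measure.map (fun x : E N => t • x) volume) := by
    rw [Measure.map_addHaar_smul _ ht.ne']
    exact hw.smul_measure ENNReal.ofReal_ne_top
  exact (he.memLp_map_measure_iff).1 h1

theorem ae_comp_smul {N : ℕ} {P : E N → Prop} (hP : ∀ᵐ x, P x) {t : ℝ} (ht : 0 < t) :
    ∀ᵐ x : E N, P (t • x) := by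
  have h1 : ∀ᵐ x ∂(Measure.map (fun x : E N => t • x) volume), P x := by
    rw [Measure.map_addHaar_smul _ ht.ne']
    exact Measure.ae_smul_measure hP _
  exact ae_of_ae_map (measurable_const_smul t).aemeasurable h1

theorem integral_comp_smul_pos {N : ℕ} (φ : E N → ℝ) {t : ℝ} (ht : 0 < t) :
    ∫ x, φ (t • x) = (t ^ N)⁻¹ * ∫ x, φ x := by
  rw [Measure.integral_comp_smul_of_nonneg volume φ t (hR := ht.le)]
  simp

theorem lintegral_comp_smul_pos {N : ℕ} {φ : E N → ENNReal} (hφ : Measurable φ) {t : ℝ}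
    (ht : 0 < t) : ∫⁻ x, φ (t • x) = ENNReal.ofReal (t ^ N)⁻¹ * ∫⁻ x, φ x := by
  rw [← lintegral_map (f := φ) (g := fun x : E N => t • x) hφ (measurable_const_smul t),
    Measure.map_addHaar_smul _ ht.ne', lintegral_smul_measure,
    abs_of_nonneg (by positivity)]
  simp

/-- Dilations act on `H¹`. -/
theorem Sob.dilate {N : ℕ} {v : E N → ℝ} {w : E N → E N} (h : Sob v w) {t : ℝ} (ht : 0 < t) :
    Sob (fun x => v (t • x)) (fun x => t • w (t • x)) where
  memLp := memLp_comp_smul h.memLp ht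
  memLp_grad := (memLp_comp_smul h.memLp_grad ht).const_smul t
  weak := by
    intro φ hφ y
    let χ : E N → ℝ := fun z => φ (t⁻¹ • z)
    have hχ : IsTest χ := ⟨hφ.1.comp (contDiff_const_smul _),
      hφ.2.comp_homeomorph (Homeomorph.smulOfNeZero t⁻¹ (inv_ne_zero ht.ne'))⟩
    have hd : ∀ x, fderiv ℝ φ x y = t * fderiv ℝ χ (t • x) y := by
      intro x
      have h1 : HasFDerivAt χ
          ((fderiv ℝ φ (t⁻¹ • t • x)).comp (t⁻¹ • ContinuousLinearMap.id ℝ (E N))) (t • x) :=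
        (hφ.1.differentiable (by simp) _).hasFDerivAt.comp (t • x)
          ((hasFDerivAt_id (t • x)).const_smul t⁻¹)
      rw [h1.fderiv, inv_smul_smul₀ ht.ne']
      simp [ht.ne']
    have e1 : ∫ x, v (t • x) * fderiv ℝ φ x y
        = (t ^ N)⁻¹ * ∫ z, t * (v z * fderiv ℝ χ z y) := by
      rw [← integral_comp_smul_pos (fun z => t * (v z * fderiv ℝ χ z y)) ht]
      refine integral_congr_ae (ae_of_all _ fun x => ?_)
      simp only [hd]
      ring
    have e2 : ∫ x, φ x * inner ℝ (t • w (t • x)) y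
        = (t ^ N)⁻¹ * ∫ z, t * (χ z * inner ℝ (w z) y) := by
      rw [← integral_comp_smul_pos (fun z => t * (χ z * inner ℝ (w z) y)) ht]
      refine integral_congr_ae (ae_of_all _ fun x => ?_)
      simp only [χ, inv_smul_smul₀ ht.ne', real_inner_smul_left]
      ring
    rw [e1, e2, integral_const_mul, integral_const_mul, h.weak χ hχ y]
    ring

theorem ofReal_integral_norm_sq {α F : Type*} [MeasurableSpace α] {μ : Measure α}
    [NormedAddCommGroup F] {w : α → F} (hw : MemLp w 2 μ) :
    ENNReal.ofReal (∫ x, ‖w x‖ ^ 2 ∂μ) = eLpNorm w 2 μ ^ 2 := by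
  rw [eLpNorm_two_sq, ofReal_integral_eq_lintegral_ofReal hw.norm.integrable_sq
    (ae_of_all _ fun x => by positivity)]
  refine lintegral_congr fun x => ?_
  rw [ENNReal.ofReal_pow (norm_nonneg _), ofReal_norm]

/-- The fundamental theorem of calculus along the segment from x to tx, followed by Jensen on the
unit interval. -/
theorem IsTest.enorm_dilate_sub_sq_le {N : ℕ} {φ : E N → ℝ} (hφ : IsTest φ) (t : ℝ) (x : E N) :
    ‖φ (t • x) - φ x‖ₑ ^ 2 ≤ ENNReal.ofReal ((‖x‖ * |t - 1|) ^ 2)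
      * ∫⁻ s in Ioc (0 : ℝ) 1, ‖gradient φ ((1 + s * (t - 1)) • x)‖ₑ ^ 2 := by
  let c : ℝ → E N := fun s => (1 + s * (t - 1)) • x
  have hc : ∀ s, HasDerivAt c ((t - 1) • x) s := fun s => by
    have h1 : HasDerivAt (fun s : ℝ => 1 + s * (t - 1)) (t - 1) s := by
      simpa using ((hasDerivAt_id s).mul_const (t - 1)).const_add 1
    exact h1.smul_const x
  have hcc : Continuous c := by fun_prop
  have hder : ∀ s, HasDerivAt (fun s => φ (c s)) (inner ℝ (gradient φ (c s)) ((t - 1) • x)) s := by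
    intro s
    rw [inner_gradient]
    exact (hφ.1.differentiable (by simp) (c s)).hasFDerivAt.comp_hasDerivAt s (hc s)
  have hgc : Continuous fun s => gradient φ (c s) :=
    (continuous_gradient (hφ.1.of_le (by simp))).comp hcc
  have hftc : φ (t • x) - φ x
      = ∫ s in Ioc (0 : ℝ) 1, inner ℝ (gradient φ (c s)) ((t - 1) • x) := by
    rw [← intervalIntegral.integral_of_le zero_le_one,
      intervalIntegral.integral_eq_sub_of_hasDerivAt (f := fun s => φ (c s)) (fun s _ => hder s)
        ((hgc.inner continuous_const).intervalIntegrable _ _)]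
    simp [c]
  have hprob : IsProbabilityMeasure (volume.restrict (Ioc (0 : ℝ) 1)) := ⟨by simp⟩
  rw [hftc]
  calc ‖∫ s in Ioc (0 : ℝ) 1, inner ℝ (gradient φ (c s)) ((t - 1) • x)‖ₑ ^ 2
      ≤ eLpNorm (fun s => inner ℝ (gradient φ (c s)) ((t - 1) • x)) 1
          (volume.restrict (Ioc (0 : ℝ) 1)) ^ 2 := by
        gcongr
        rw [eLpNorm_one_eq_lintegral_enorm]
        exact enorm_integral_le_lintegral_enorm _
    _ ≤ eLpNorm (fun s => inner ℝ (gradient φ (c s)) ((t - 1) • x)) 2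
          (volume.restrict (Ioc (0 : ℝ) 1)) ^ 2 := by
        gcongr
        exact eLpNorm_le_eLpNorm_of_exponent_le (by norm_num)
          (hgc.inner continuous_const).aestronglyMeasurable
    _ = ∫⁻ s in Ioc (0 : ℝ) 1, ‖(inner ℝ (gradient φ (c s)) ((t - 1) • x) : ℝ)‖ₑ ^ 2 :=
        eLpNorm_two_sq _
    _ ≤ ∫⁻ s in Ioc (0 : ℝ) 1, ENNReal.ofReal ((‖x‖ * |t - 1|) ^ 2) * ‖gradient φ (c s)‖ₑ ^ 2 := by
        refine lintegral_mono fun s => ?_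
        have h1 : ‖(inner ℝ (gradient φ (c s)) ((t - 1) • x) : ℝ)‖
            ≤ (‖x‖ * |t - 1|) * ‖gradient φ (c s)‖ := by
          refine (norm_inner_le_norm _ _).trans (le_of_eq ?_)
          rw [norm_smul, Real.norm_eq_abs]
          ring
        rw [ENNReal.ofReal_pow (by positivity), ← mul_pow]
        gcongr
        rw [← ofReal_norm, ← ofReal_norm, ← ENNReal.ofReal_mul (by positivity)]
        exact ENNReal.ofReal_le_ofReal h1
    _ = _ := lintegral_const_mul' _ _ ENNReal.ofReal_ne_top

/-- Integrate the pointwise bound over the ball, where |x| ≤ r, exchange the integrals and rescale.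
Every dilation factor on the segment is at least 1/2, so each Jacobian costs at most 2^N. -/
theorem IsTest.eLpNorm_dilate_sub_le {N : ℕ} {φ : E N → ℝ} (hφ : IsTest φ) {t : ℝ}
    (ht : t ∈ Icc (1 / 2 : ℝ) 2) {r : ℝ} (hr : 0 ≤ r) :
    eLpNorm (fun x => φ (t • x) - φ x) 2 (volume.restrict (Metric.ball 0 r))
      ≤ ENNReal.ofReal (r * |t - 1| * 2 ^ N) * eLpNorm (gradient φ) 2 volume := by
  have hg := continuous_gradient (hφ.1.of_le (by simp : (1 : WithTop ℕ∞) ≤ ∞))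
  have hτ : ∀ s ∈ Ioc (0 : ℝ) 1, 1 / 2 ≤ 1 + s * (t - 1) := by
    intro s hs
    have h1 := hs.1
    have h2 := hs.2
    have h3 := ht.1
    nlinarith
  have key : eLpNorm (fun x => φ (t • x) - φ x) 2 (volume.restrict (Metric.ball 0 r)) ^ 2
      ≤ (ENNReal.ofReal (r * |t - 1| * 2 ^ N) * eLpNorm (gradient φ) 2 volume) ^ 2 := by
    rw [eLpNorm_two_sq]
    calc ∫⁻ x in Metric.ball 0 r, ‖φ (t • x) - φ x‖ₑ ^ 2
        ≤ ∫⁻ x in Metric.ball 0 r, ENNReal.ofReal ((r * |t - 1|) ^ 2)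
          * ∫⁻ s in Ioc (0 : ℝ) 1, ‖gradient φ ((1 + s * (t - 1)) • x)‖ₑ ^ 2 := by
          refine setLIntegral_mono' Metric.isOpen_ball.measurableSet fun x hx => ?_
          refine (hφ.enorm_dilate_sub_sq_le t x).trans ?_
          have hx' : ‖x‖ ≤ r := (mem_ball_zero_iff.1 hx).le
          gcongr
      _ ≤ ∫⁻ x, ENNReal.ofReal ((r * |t - 1|) ^ 2)
          * ∫⁻ s in Ioc (0 : ℝ) 1, ‖gradient φ ((1 + s * (t - 1)) • x)‖ₑ ^ 2 :=
          setLIntegral_le_lintegral _ _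
      _ = ENNReal.ofReal ((r * |t - 1|) ^ 2)
          * ∫⁻ x, ∫⁻ s in Ioc (0 : ℝ) 1, ‖gradient φ ((1 + s * (t - 1)) • x)‖ₑ ^ 2 :=
          lintegral_const_mul' _ _ ENNReal.ofReal_ne_top
      _ = ENNReal.ofReal ((r * |t - 1|) ^ 2)
          * ∫⁻ s in Ioc (0 : ℝ) 1, ∫⁻ x, ‖gradient φ ((1 + s * (t - 1)) • x)‖ₑ ^ 2 := by
          congr 1
          refine lintegral_lintegral_swap ?_
          have : Continuous fun p : E N × ℝ => gradient φ ((1 + p.2 * (t - 1)) • p.1) :=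
            hg.comp (by fun_prop)
          exact (this.enorm.measurable.pow_const 2).aemeasurable
      _ ≤ ENNReal.ofReal ((r * |t - 1|) ^ 2)
          * ∫⁻ s in Ioc (0 : ℝ) 1, ENNReal.ofReal (2 ^ N) * ∫⁻ x, ‖gradient φ x‖ₑ ^ 2 := by
          gcongr ENNReal.ofReal ((r * |t - 1|) ^ 2) * ?_
          refine setLIntegral_mono' measurableSet_Ioc fun s hs => ?_
          have h1 := hτ s hs
          rw [lintegral_comp_smul_pos (φ := fun x => ‖gradient φ x‖ₑ ^ 2)
            (hg.enorm.measurable.pow_const 2) (by linarith)]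
          gcongr
          rw [← inv_pow]
          gcongr
          rw [inv_le_comm₀ (by linarith) (by norm_num)]
          linarith
      _ = ENNReal.ofReal ((r * |t - 1|) ^ 2) * (ENNReal.ofReal (2 ^ N)
          * eLpNorm (gradient φ) 2 volume ^ 2) := by
          rw [lintegral_const, ← eLpNorm_two_sq]
          simp
      _ ≤ _ := by
          rw [mul_pow (ENNReal.ofReal _), ← mul_assoc, ← ENNReal.ofReal_mul (by positivity),
            ← ENNReal.ofReal_pow (by positivity)]
          gcongr
          rw [mul_pow _ ((2 : ℝ) ^ N)]
          gcongr
          exact le_self_pow₀ (one_le_pow₀ one_le_two) two_ne_zero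
  exact (ENNReal.pow_le_pow_left_iff (by norm_num)).1 key

/-- A Sobolev function changes little, locally in `L²`, under a small dilation. -/
theorem Sob.setIntegral_dilate_sub_sq_le {N : ℕ} {v : E N → ℝ} {w : E N → E N} (h : Sob v w)
    {t : ℝ} (ht : t ∈ Icc (1 / 2 : ℝ) 2) {r : ℝ} (hr : 0 ≤ r) :
    ∫ x in Metric.ball 0 r, (v (t • x) - v x) ^ 2
      ≤ (r * |t - 1| * 2 ^ N) ^ 2 * ∫ x, ‖w x‖ ^ 2 := by
  have ht0 : 0 < t := by linarith [ht.1]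
  obtain ⟨φ, hφ, -, t2, hae⟩ := h.exists_seq_isTest
  have hm : MemLp (fun x => v (t • x) - v x) 2 (volume.restrict (Metric.ball 0 r)) :=
    ((memLp_comp_smul h.memLp ht0).sub h.memLp).restrict _
  have h1 : eLpNorm (fun x => v (t • x) - v x) 2 (volume.restrict (Metric.ball 0 r))
      ≤ ENNReal.ofReal (r * |t - 1| * 2 ^ N) * eLpNorm w 2 volume := by
    refine (Lp.eLpNorm_lim_le_liminf_eLpNorm (f := fun n x => φ n (t • x) - φ n x)
      (fun n => ?_) _ (ae_restrict_of_ae ?_)).trans ?_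
    · have := (hφ n).1.continuous
      exact (by fun_prop : Continuous fun x => φ n (t • x) - φ n x).aestronglyMeasurable
    · filter_upwards [hae, ae_comp_smul hae ht0] with x h1 h2
      exact h2.sub h1
    have hb : ∀ n, eLpNorm (fun x => φ n (t • x) - φ n x) 2 (volume.restrict (Metric.ball 0 r))
        ≤ ENNReal.ofReal (r * |t - 1| * 2 ^ N) * (eLpNorm w 2 volume
          + eLpNorm (fun x => gradient (φ n) x - w x) 2 volume) := by
      intro n
      refine ((hφ n).eLpNorm_dilate_sub_le ht hr).trans ?_
      gcongr
      have := eLpNorm_add_le (p := 2) (μ := volume) h.memLp_grad.1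
        ((hφ n).sob.memLp_grad.1.sub h.memLp_grad.1) (by norm_num)
      refine le_trans (le_of_eq ?_) this
      congr 1
      ext1 x
      simp
    have hlim : Tendsto (fun n => ENNReal.ofReal (r * |t - 1| * 2 ^ N) * (eLpNorm w 2 volume
        + eLpNorm (fun x => gradient (φ n) x - w x) 2 volume)) atTop
        (𝓝 (ENNReal.ofReal (r * |t - 1| * 2 ^ N) * (eLpNorm w 2 volume + 0))) :=
      ENNReal.Tendsto.const_mul (tendsto_const_nhds.add t2) (Or.inr ENNReal.ofReal_ne_top)
    refine (liminf_le_liminf (Eventually.of_forall hb)).trans ?_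
    rw [hlim.liminf_eq, add_zero]
  have h2 := pow_le_pow_left' h1 2
  rw [mul_pow, ← ofReal_integral_norm_sq hm, ← ofReal_integral_norm_sq h.memLp_grad,
    ← ENNReal.ofReal_pow (by positivity), ← ENNReal.ofReal_mul (by positivity),
    ENNReal.ofReal_le_ofReal_iff (by positivity)] at h2
  simpa using h2

/-! ### Pohozaev's identity by dilation -/

/-- An upper bound on increments on both sides of a point controls the derivative from both sides:
dividing by t - 1 > 0 gives q ≤ A, dividing by t - 1 < 0 gives q ≥ -A. The quadratic error
disappears in the limit, whatever D is. -/
theorem abs_deriv_le_of_one_sided {Q : ℝ → ℝ} {q A D : ℝ} (hQ : HasDerivAt Q q 1)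
    (h : ∀ t ∈ Icc (1 / 2 : ℝ) 2, Q t - Q 1 ≤ A * |t - 1| + D * |t - 1| ^ 2) : |q| ≤ A := by
  have hs := hasDerivAt_iff_tendsto_slope.1 hQ
  have hlim : ∀ c : ℝ, Tendsto (fun t : ℝ => A + c * (t - 1)) (𝓝 1) (𝓝 A) := fun c => by
    have : Continuous fun t : ℝ => A + c * (t - 1) := by fun_prop
    simpa using this.tendsto 1
  rw [abs_le]
  constructor
  · have h1 : Tendsto (slope Q 1) (𝓝[<] 1) (𝓝 q) :=
      hs.mono_left (nhdsWithin_mono _ fun x hx => ne_of_lt hx)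
    have h2 : Tendsto (fun t : ℝ => -(A + (-D) * (t - 1))) (𝓝[<] 1) (𝓝 (-A)) :=
      ((hlim (-D)).neg).mono_left nhdsWithin_le_nhds
    refine le_of_tendsto_of_tendsto h2 h1 ?_
    filter_upwards [Ioo_mem_nhdsLT (show (1 / 2 : ℝ) < 1 by norm_num)] with t ht
    have h3 := h t ⟨ht.1.le, by linarith [ht.2]⟩
    have h4 : t - 1 < 0 := by linarith [ht.2]
    rw [abs_of_neg h4] at h3
    rw [slope_def_field, le_div_iff_of_neg h4]
    nlinarith
  · have h1 : Tendsto (slope Q 1) (𝓝[>] 1) (𝓝 q) :=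
      hs.mono_left (nhdsWithin_mono _ fun x hx => ne_of_gt hx)
    refine le_of_tendsto_of_tendsto h1 ((hlim D).mono_left nhdsWithin_le_nhds) ?_
    filter_upwards [Ioo_mem_nhdsGT (show (1 : ℝ) < 2 by norm_num)] with t ht
    have h3 := h t ⟨by linarith [ht.1], ht.2.le⟩
    have h4 : 0 < t - 1 := by linarith [ht.1]
    rw [abs_of_pos h4] at h3
    rw [slope_def_field, div_le_iff₀ h4]
    nlinarith

/-- The cutoff changes little under a small dilation, and only away from the origin. -/
theorem abs_cutoff_dilate_sub_le {N : ℕ} {C : ℝ} (hC0 : 0 < C)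
    (hC : ∀ x y : E N, |cutoffBump N x - cutoffBump N y| ≤ C * ‖x - y‖) {R : ℝ} (hR : 0 < R)
    {t : ℝ} (ht : t ∈ Icc (1 / 2 : ℝ) 2) (x : E N) :
    |cutoff R (t⁻¹ • x) - cutoff R x|
      ≤ 8 * C * |t - 1| * {x : E N | R / 2 < ‖x‖}.indicator 1 x := by
  have ht0 : 0 < t := by linarith [ht.1]
  have hti : t⁻¹ ≤ 2 := by
    rw [inv_le_comm₀ ht0 (by norm_num)]
    linarith [ht.1]
  have hti' : 1 / 2 ≤ t⁻¹ := by
    rw [le_inv_comm₀ (by norm_num) ht0]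
    linarith [ht.2]
  have hn : ‖t⁻¹ • x‖ = t⁻¹ * ‖x‖ := by
    rw [norm_smul, norm_inv, Real.norm_of_nonneg ht0.le]
  have hx0 := norm_nonneg x
  by_cases hx : R / 2 < ‖x‖
  · rw [indicator_of_mem (show x ∈ {x : E N | R / 2 < ‖x‖} from hx), Pi.one_apply, mul_one]
    -- For |x| ≥ 4R both cutoffs vanish, as 1/t ≥ 1/2; otherwise |x|/R < 4 and the Lipschitz bound
    -- is uniform in R.
    rcases le_or_gt (4 * R) ‖x‖ with h4 | h4
    · rw [cutoff_eq_zero hR (by rw [hn]; nlinarith), cutoff_eq_zero hR (by linarith)]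
      simp only [sub_self, abs_zero]
      positivity
    · have h1 := hC (R⁻¹ • t⁻¹ • x) (R⁻¹ • x)
      refine h1.trans ?_
      have e : R⁻¹ • t⁻¹ • x - R⁻¹ • x = (R⁻¹ * (t⁻¹ * (1 - t))) • x := by
        rw [smul_smul, ← sub_smul]
        congr 1
        field_simp
      rw [e, norm_smul, norm_mul, norm_mul, norm_inv, norm_inv, Real.norm_of_nonneg ht0.le,
        Real.norm_of_nonneg hR.le, Real.norm_eq_abs, abs_sub_comm]
      calc C * (R⁻¹ * (t⁻¹ * |t - 1|) * ‖x‖) ≤ C * (R⁻¹ * (2 * |t - 1|) * (4 * R)) := by gcongr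
        _ = 8 * C * |t - 1| := by
            field_simp
            ring
  · rw [not_lt] at hx
    rw [cutoff_eq_one hR (by rw [hn]; nlinarith), cutoff_eq_one hR (by linarith),
      indicator_of_notMem (by simpa using hx)]
    simp

theorem gradient_cutoff_eq_zero_of_lt {N : ℕ} {R : ℝ} (hR : 0 < R) {x : E N} (hx : 2 * R < ‖x‖) :
    gradient (cutoff R) x = 0 := by
  have h : (cutoff R : E N → ℝ) =ᶠ[𝓝 x] fun _ => 0 := by
    filter_upwards [(isOpen_lt continuous_const continuous_norm).mem_nhds hx] with z hz
    exact cutoff_eq_zero hR (le_of_lt hz)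
  rw [gradient, h.fderiv_eq]
  simp

/-- Dilating the argument of an integrable function under a cutoff. -/
theorem abs_integral_cutoff_dilate_le {N : ℕ} {C : ℝ} (hC0 : 0 < C)
    (hC : ∀ x y : E N, |cutoffBump N x - cutoffBump N y| ≤ C * ‖x - y‖) {R : ℝ} (hR : 0 < R)
    {t : ℝ} (ht : t ∈ Icc (1 / 2 : ℝ) 2) {a : E N → ℝ} (ha : Integrable a volume) :
    |(∫ x, cutoff R x * a (t • x)) - (t ^ N)⁻¹ * ∫ x, cutoff R x * a x|
      ≤ 2 ^ N * (8 * C * |t - 1| * ∫ x in {x : E N | R / 2 < ‖x‖}, |a x|) := by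
  have ht0 : 0 < t := by linarith [ht.1]
  have hms : MeasurableSet {x : E N | R / 2 < ‖x‖} :=
    measurableSet_lt measurable_const measurable_norm
  have hcut : ∀ s : ℝ, Integrable (fun x => cutoff R (s • x) * a x) volume := fun s =>
    ha.bdd_mul (c := 1)
      ((isTest_cutoff hR).1.continuous.comp (continuous_const_smul s)).aestronglyMeasurable
      (ae_of_all _ fun x => norm_cutoff_le_one R _)
  -- A change of variables moves the dilation from a, which has no regularity, onto the smooth
  -- cutoff.
  have h1 : ∫ x, cutoff R x * a (t • x) = (t ^ N)⁻¹ * ∫ x, cutoff R (t⁻¹ • x) * a x := by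
    rw [← integral_comp_smul_pos (fun x => cutoff R (t⁻¹ • x) * a x) ht0]
    simp only [inv_smul_smul₀ ht0.ne']
  have hcut1 := hcut 1
  simp only [one_smul] at hcut1
  rw [h1, ← mul_sub, ← integral_sub (hcut _) hcut1, abs_mul, abs_of_pos (by positivity)]
  gcongr
  · rw [← inv_pow]
    gcongr
    rw [inv_le_comm₀ ht0 (by norm_num)]
    linarith [ht.1]
  · rw [← integral_indicator hms, ← integral_const_mul]
    refine (abs_integral_le_integral_abs).trans (integral_mono_of_nonneg
      (ae_of_all _ fun x => abs_nonneg _) ((ha.abs.indicator hms).const_mul _)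
      (ae_of_all _ fun x => ?_))
    simp only
    rw [← sub_mul, abs_mul]
    refine (mul_le_mul_of_nonneg_right (abs_cutoff_dilate_sub_le hC0 hC hR ht x)
      (abs_nonneg _)).trans (le_of_eq ?_)
    by_cases hx : R / 2 < ‖x‖
    · rw [indicator_of_mem (show x ∈ {x : E N | R / 2 < ‖x‖} from hx),
        indicator_of_mem (show x ∈ {x : E N | R / 2 < ‖x‖} from hx)]
      simp
    · rw [indicator_of_notMem (show x ∉ {x : E N | R / 2 < ‖x‖} from hx),
        indicator_of_notMem (show x ∉ {x : E N | R / 2 < ‖x‖} from hx)]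
      simp

/-- Data for a bounded solution of `-Δv = h(v)` with potential `H`. -/
structure BoundedSolution {N : ℕ} (h H : ℝ → ℝ) (M L : ℝ) (v : E N → ℝ) (w : E N → E N) :
    Prop where
  sob : Sob v w
  mem : ∀ x, v x ∈ Icc 0 M
  cont : Continuous h
  contPrim : Continuous H
  nonneg : 0 ≤ L
  taylor : ∀ a ∈ Icc 0 M, ∀ b ∈ Icc 0 M, |H b - H a - h a * (b - a)| ≤ L * (b - a) ^ 2
  bound : ∀ a ∈ Icc 0 M, |h a| ≤ L * a
  boundPrim : ∀ a ∈ Icc 0 M, |H a| ≤ L * a ^ 2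
  equation : ∀ (φ : E N → ℝ) (w' : E N → E N), Sob φ w' →
    ∫ x, inner ℝ (w x) (w' x) = ∫ x, h (v x) * φ x

theorem BoundedSolution.integrable_prim {N : ℕ} {h H : ℝ → ℝ} {M L : ℝ} {v : E N → ℝ}
    {w : E N → E N} (s : BoundedSolution h H M L v w) : Integrable (fun x => H (v x)) volume :=
  (s.sob.memLp.integrable_sq.const_mul L).mono' (s.contPrim.comp_aestronglyMeasurable s.sob.memLp.1)
    (ae_of_all _ fun x => s.boundPrim _ (s.mem x))

theorem BoundedSolution.memLp_rhs {N : ℕ} {h H : ℝ → ℝ} {M L : ℝ} {v : E N → ℝ}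
    {w : E N → E N} (s : BoundedSolution h H M L v w) : MemLp (fun x => h (v x)) 2 volume :=
  MemLp.of_le_mul (c := L) s.sob.memLp (s.cont.comp_aestronglyMeasurable s.sob.memLp.1)
    (ae_of_all _ fun x => by
      rw [Real.norm_of_nonneg (s.mem x).1]
      exact s.bound _ (s.mem x))

/-- Integrability against a cutoff. -/
theorem integrable_cutoff_mul {N : ℕ} {R : ℝ} (hR : 0 < R) {a : E N → ℝ}
    (ha : Integrable a volume) : Integrable (fun x => cutoff R x * a x) volume :=
  ha.bdd_mul (c := 1) (isTest_cutoff hR).1.continuous.aestronglyMeasurable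
    (ae_of_all _ fun _ => norm_cutoff_le_one R _)

/-- The Young inequality bounding the terms in which the cutoff is differentiated. -/
theorem cutoff_cross_term_le {C R ε τ d b y : ℝ} (hR : 0 < R) (hε : 0 < ε)
    (hτ : 0 < τ) (hy : y ≤ C / R) :
    |d| * |b| * y ≤ ε / (R ^ 2 * τ) * d ^ 2 + C ^ 2 * τ / ε * b ^ 2 := by
  have h1 : |d| * |b| * y ≤ |d| * |b| * (C / R) := by gcongr
  -- With X = |d|/R and Y = Cτ|b|/ε this is X² + Y² - XY = (X - Y/2)² + ¾Y², up to the factor ε/τ.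
  have h3 : (ε / (R ^ 2 * τ)) * d ^ 2 + C ^ 2 * τ / ε * b ^ 2 - |d| * |b| * (C / R)
      = (ε / τ) * ((|d| / R - C * τ / ε * |b| / 2) ^ 2 + 3 / 4 * (C * τ / ε * |b|) ^ 2) := by
    rw [← sq_abs d, ← sq_abs b]
    field_simp
    ring
  have h4 : 0 ≤ (ε / τ) * ((|d| / R - C * τ / ε * |b| / 2) ^ 2
      + 3 / 4 * (C * τ / ε * |b|) ^ 2) := by positivity
  linarith

/-- The Pohozaev balance, tested with a dilation difference and a cutoff. -/
theorem BoundedSolution.dilation_inequality {N : ℕ} {h H : ℝ → ℝ} {M L : ℝ} {v : E N → ℝ}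
    {w : E N → E N} (s : BoundedSolution h H M L v w) {C : ℝ} (hC0 : 0 < C)
    (hC : ∀ R : ℝ, 0 < R → ∀ x : E N, ‖gradient (cutoff R) x‖ ≤ C / R) {R : ℝ} (hR : 0 < R)
    {t : ℝ} (ht : t ∈ Icc (1 / 2 : ℝ) 2) (ht1 : t ≠ 1) {ε : ℝ} (hε : 0 < ε) :
    (∫ x, cutoff R x * H (v (t • x))) - (∫ x, cutoff R x * H (v x))
      ≤ 1 / 2 * (t ^ 2 * (∫ x, cutoff R x * ‖w (t • x)‖ ^ 2) - ∫ x, cutoff R x * ‖w x‖ ^ 2)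
        + (ε / (R ^ 2 * |t - 1|) + L) * ((3 * R * |t - 1| * 2 ^ N) ^ 2 * ∫ x, ‖w x‖ ^ 2)
        + C ^ 2 * |t - 1| / ε * ∫ x in {x : E N | R / 2 < ‖x‖}, ‖w x‖ ^ 2 := by
  have ht0 : 0 < t := by linarith [ht.1]
  have hτ : 0 < |t - 1| := abs_pos.2 (sub_ne_zero.2 ht1)
  have hms : MeasurableSet {x : E N | R / 2 < ‖x‖} :=
    measurableSet_lt measurable_const measurable_norm
  have hS := s.sob
  have hSt := hS.dilate ht0
  have hφ := (hSt.sub hS).mul_isTest (isTest_cutoff hR)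
  have heq := s.equation _ _ hφ
  have iw : Integrable (fun x => ‖w x‖ ^ 2) volume := hS.memLp_grad.norm.integrable_sq
  have iwt : Integrable (fun x => ‖w (t • x)‖ ^ 2) volume :=
    (memLp_comp_smul hS.memLp_grad ht0).norm.integrable_sq
  have iH := s.integrable_prim
  have iHt : Integrable (fun x => H (v (t • x))) volume := iH.comp_smul ht0.ne'
  have id : Integrable (fun x => (v (t • x) - v x) ^ 2) volume :=
    (hSt.memLp.sub hS.memLp).integrable_sq
  have hest := hS.setIntegral_dilate_sub_sq_le ht (r := 3 * R) (by positivity)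
  -- Young weights. The local L² estimate makes ∫D of order R²|t - 1|², so c₁∫D is of order ε|t - 1|
  -- uniformly in R; c₂ is of order |t - 1|/ε but multiplies only the tail of the Dirichlet energy.
  set c₁ := ε / (R ^ 2 * |t - 1|) with hc₁
  have hc₁0 : 0 < c₁ := by positivity
  set c₂ := C ^ 2 * |t - 1| / ε with hc₂
  have hc₂0 : 0 < c₂ := by positivity
  set D : E N → ℝ := (Metric.ball 0 (3 * R)).indicator fun x => (v (t • x) - v x) ^ 2 with hD
  set T : E N → ℝ := {x : E N | R / 2 < ‖x‖}.indicator fun x => ‖w x‖ ^ 2 with hT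
  have iD : Integrable D volume := id.indicator Metric.isOpen_ball.measurableSet
  have iT : Integrable T volume := iw.indicator hms
  have hD0 : ∀ x, 0 ≤ D x := fun x => indicator_nonneg (fun _ _ => sq_nonneg _) x
  have hT0 : ∀ x, 0 ≤ T x := fun x => indicator_nonneg (fun _ _ => sq_nonneg _) x
  have hDin : ∀ x : E N, ‖x‖ < 3 * R → D x = (v (t • x) - v x) ^ 2 := fun x hx =>
    indicator_of_mem (by simpa using hx) _
  have hcutD : ∀ x, cutoff R x * (v (t • x) - v x) ^ 2 ≤ D x := by
    intro x
    rcases lt_or_ge ‖x‖ (3 * R) with hx | hx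
    · rw [hDin x hx]
      exact mul_le_of_le_one_left (sq_nonneg _) (cutoff_le_one R x)
    · rw [cutoff_eq_zero hR (by linarith), zero_mul]
      exact hD0 x
  have hcross : ∀ x, |v (t • x) - v x| * ‖w x‖ * ‖gradient (cutoff R) x‖ ≤ c₁ * D x + c₂ * T x := by
    intro x
    have hnn : 0 ≤ c₁ * D x + c₂ * T x := by
      have := hD0 x
      have := hT0 x
      positivity
    rcases lt_or_ge ‖x‖ R with h1 | h1
    · rw [gradient_cutoff_eq_zero hR h1, norm_zero, mul_zero]
      exact hnn
    rcases lt_or_ge (2 * R) ‖x‖ with h2 | h2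
    · rw [gradient_cutoff_eq_zero_of_lt hR h2, norm_zero, mul_zero]
      exact hnn
    · rw [hDin x (by linarith), hT, indicator_of_mem (show x ∈ {x : E N | R / 2 < ‖x‖} from (by linarith : R / 2 < ‖x‖))]
      have := cutoff_cross_term_le (d := v (t • x) - v x) (b := ‖w x‖) hR hε hτ (hC R hR x)
      rwa [abs_of_nonneg (norm_nonneg (w x))] at this
  -- Taylor's formula at v(x). No convexity of H is needed, because the quadratic remainder
  -- integrates to order |t - 1|².
  have hlower : ∀ x, cutoff R x * H (v (t • x)) - cutoff R x * H (v x) - L * D x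
      ≤ h (v x) * (cutoff R x * (v (t • x) - v x)) := by
    intro x
    have h1 := (abs_le.1 (s.taylor _ (s.mem x) _ (s.mem (t • x)))).2
    have h2 := mul_le_mul_of_nonneg_left h1 (cutoff_nonneg R x)
    have h3 := mul_le_mul_of_nonneg_left (hcutD x) s.nonneg
    nlinarith
  have hupper : ∀ x, inner ℝ (w x) (cutoff R x • (t • w (t • x) - w x)
        + (v (t • x) - v x) • gradient (cutoff R) x)
      ≤ 1 / 2 * (t ^ 2 * (cutoff R x * ‖w (t • x)‖ ^ 2) - cutoff R x * ‖w x‖ ^ 2)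
        + (c₁ * D x + c₂ * T x) := by
    intro x
    rw [inner_add_right, real_inner_smul_right, real_inner_smul_right, inner_sub_right,
      real_inner_self_eq_norm_sq]
    -- Convexity of the squared norm: only an inequality is available, but it will be used for t on
    -- both sides of 1.
    have h1 : inner ℝ (w x) (t • w (t • x)) ≤ 1 / 2 * ‖w x‖ ^ 2 + 1 / 2 * (t ^ 2 * ‖w (t • x)‖ ^ 2) := by
      have h2 := real_inner_le_norm (w x) (t • w (t • x))
      rw [norm_smul, Real.norm_of_nonneg ht0.le] at h2
      nlinarith [sq_nonneg (‖w x‖ - t * ‖w (t • x)‖)]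
    have h3 := mul_le_mul_of_nonneg_left h1 (cutoff_nonneg R x)
    have h4 : (v (t • x) - v x) * inner ℝ (w x) (gradient (cutoff R) x)
        ≤ |v (t • x) - v x| * ‖w x‖ * ‖gradient (cutoff R) x‖ := by
      refine (le_abs_self _).trans ?_
      rw [abs_mul, mul_assoc]
      gcongr
      exact abs_real_inner_le_norm _ _
    have h5 := hcross x
    nlinarith
  have iR : Integrable (fun x => h (v x) * (cutoff R x * (v (t • x) - v x))) volume :=
    s.memLp_rhs.integrable_mul hφ.memLp
  have iI : Integrable (fun x => inner ℝ (w x) (cutoff R x • (t • w (t • x) - w x)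
        + (v (t • x) - v x) • gradient (cutoff R) x)) volume :=
    (hS.memLp_grad.norm.integrable_mul hφ.memLp_grad.norm).mono'
      (hS.memLp_grad.1.inner hφ.memLp_grad.1) (ae_of_all _ fun x => norm_inner_le_norm _ _)
  have cH := integrable_cutoff_mul hR iH
  have cHt := integrable_cutoff_mul hR iHt
  have cw := integrable_cutoff_mul hR iw
  have cwt := integrable_cutoff_mul hR iwt
  have I1 := integral_mono ((cHt.sub cH).sub (iD.const_mul L)) iR hlower
  have I2 := integral_mono iI ((((cwt.const_mul (t ^ 2)).sub cw).const_mul (1 / 2)).add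
    ((iD.const_mul c₁).add (iT.const_mul c₂))) hupper
  simp only [Pi.sub_apply, Pi.add_apply] at I1 I2
  rw [integral_sub (by exact cHt.sub cH) (iD.const_mul L), integral_sub cHt cH,
    integral_const_mul] at I1
  rw [integral_add (by exact ((cwt.const_mul (t ^ 2)).sub cw).const_mul (1 / 2))
      (by exact (iD.const_mul c₁).add (iT.const_mul c₂)),
    integral_const_mul, integral_sub (cwt.const_mul (t ^ 2)) cw, integral_const_mul,
    integral_add (iD.const_mul c₁) (iT.const_mul c₂), integral_const_mul,
    integral_const_mul] at I2
  have eD : ∫ x, D x = ∫ x in Metric.ball 0 (3 * R), (v (t • x) - v x) ^ 2 :=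
    integral_indicator Metric.isOpen_ball.measurableSet
  have eT : ∫ x, T x = ∫ x in {x : E N | R / 2 < ‖x‖}, ‖w x‖ ^ 2 := integral_indicator hms
  rw [eT] at I2
  rw [← eD] at hest
  have h6 := mul_le_mul_of_nonneg_left hest (add_nonneg hc₁0.le s.nonneg)
  linarith

/-- The localized Pohozaev identity, with an error controlled by the tails. -/
theorem BoundedSolution.abs_pohozaev_cutoff_le {N : ℕ} {h H : ℝ → ℝ} {M L : ℝ} {v : E N → ℝ}
    {w : E N → E N} (s : BoundedSolution h H M L v w) {C : ℝ} (hC0 : 0 < C)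
    (hC : ∀ R : ℝ, 0 < R → ∀ x : E N, ‖gradient (cutoff R) x‖ ≤ C / R)
    (hC' : ∀ x y : E N, |cutoffBump N x - cutoffBump N y| ≤ C * ‖x - y‖)
    {R : ℝ} (hR : 0 < R) {ε : ℝ} (hε : 0 < ε) :
    |-(N : ℝ) * (∫ x, cutoff R x * H (v x)) - 1 / 2 * ((2 - N) * ∫ x, cutoff R x * ‖w x‖ ^ 2)|
      ≤ ε * ((3 * 2 ^ N) ^ 2 * ∫ x, ‖w x‖ ^ 2)
        + C ^ 2 / ε * (∫ x in {x : E N | R / 2 < ‖x‖}, ‖w x‖ ^ 2)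
        + 2 ^ N * (8 * C) * (∫ x in {x : E N | R / 2 < ‖x‖}, |H (v x)|)
        + 2 * (2 ^ N * (8 * C) * ∫ x in {x : E N | R / 2 < ‖x‖}, ‖w x‖ ^ 2) := by
  set B := ∫ x, cutoff R x * H (v x)
  set A := ∫ x, cutoff R x * ‖w x‖ ^ 2
  set A₀ := ∫ x, ‖w x‖ ^ 2
  set TA := ∫ x in {x : E N | R / 2 < ‖x‖}, ‖w x‖ ^ 2 with hTA
  set TB := ∫ x in {x : E N | R / 2 < ‖x‖}, |H (v x)|
  have hTA0 : 0 ≤ TA := integral_nonneg fun x => sq_nonneg _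
  -- These are the powers of t that the dilated integrals would carry if the cutoff were unaffected;
  -- the discrepancy is a tail term of order |t - 1|.
  have hQ : HasDerivAt (fun t : ℝ => (t ^ N)⁻¹ * B - 1 / 2 * (t ^ 2 * (t ^ N)⁻¹ * A))
      (-(N : ℝ) * B - 1 / 2 * ((2 - N) * A)) 1 := by
    have h1 : HasDerivAt (fun t : ℝ => (t ^ N)⁻¹) (-(N : ℝ)) 1 := by
      exact ((hasDerivAt_pow N (1 : ℝ)).inv (by simp)).congr_deriv (by simp)
    have h2 : HasDerivAt (fun t : ℝ => t ^ 2 * (t ^ N)⁻¹) (2 - (N : ℝ)) 1 := by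
      refine ((hasDerivAt_pow 2 (1 : ℝ)).mul h1).congr_deriv ?_
      simp
      ring
    exact (h1.mul_const B).sub ((h2.mul_const A).const_mul (1 / 2))
  refine abs_deriv_le_of_one_sided (D := L * ((3 * R * 2 ^ N) ^ 2 * A₀)) hQ fun t ht => ?_
  rcases eq_or_ne t 1 with rfl | ht1
  · simp
  have hτ : 0 < |t - 1| := abs_pos.2 (sub_ne_zero.2 ht1)
  have hd := s.dilation_inequality hC0 hC hR ht ht1 hε
  have e1 := (abs_le.1 (abs_integral_cutoff_dilate_le hC0 hC' hR ht s.integrable_prim)).1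
  have e2 := (abs_le.1 (abs_integral_cutoff_dilate_le hC0 hC' hR ht
    s.sob.memLp_grad.norm.integrable_sq)).2
  have habs : ∫ x in {x : E N | R / 2 < ‖x‖}, |‖w x‖ ^ 2| = TA := by
    simp only [abs_pow, abs_norm, hTA]
  rw [habs] at e2
  -- Together with the ½ in front of the Dirichlet term this produces the 2 in the last error.
  have ht4 : t ^ 2 ≤ 4 := by nlinarith [ht.1, ht.2]
  have e3 := mul_le_mul_of_nonneg_left e2 (sq_nonneg t)
  have e4 : t ^ 2 * (2 ^ N * (8 * C * |t - 1| * TA)) ≤ 4 * (2 ^ N * (8 * C * |t - 1| * TA)) := by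
    gcongr
  have e5 : (ε / (R ^ 2 * |t - 1|) + L) * ((3 * R * |t - 1| * 2 ^ N) ^ 2 * A₀)
      = ε * ((3 * 2 ^ N) ^ 2 * A₀) * |t - 1| + L * ((3 * R * 2 ^ N) ^ 2 * A₀) * |t - 1| ^ 2 := by
    field_simp
  have e6 : C ^ 2 * |t - 1| / ε * TA = C ^ 2 / ε * TA * |t - 1| := by ring
  rw [e5, e6] at hd
  simp only [one_pow, inv_one, one_mul]
  linarith

theorem tendsto_integral_cutoff {N : ℕ} {a : E N → ℝ} (ha : Integrable a volume) :
    Tendsto (fun n : ℕ => ∫ x, cutoff ((n : ℝ) + 1) x * a x) atTop (𝓝 (∫ x, a x)) := by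
  refine tendsto_integral_of_dominated_convergence (fun x => ‖a x‖)
    (fun n => (integrable_cutoff_mul (by positivity) ha).1) ha.norm
    (fun n => ae_of_all _ fun x => ?_) (ae_of_all _ fun x => ?_)
  · rw [norm_mul]
    exact mul_le_of_le_one_left (norm_nonneg _) (norm_cutoff_le_one _ _)
  · simpa using (tendsto_cutoff x).mul_const (a x)

theorem tendsto_setIntegral_tail {N : ℕ} {a : E N → ℝ} (ha : Integrable a volume) :
    Tendsto (fun n : ℕ => ∫ x in {x : E N | ((n : ℝ) + 1) / 2 < ‖x‖}, a x) atTop (𝓝 0) := by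
  have hms : ∀ r : ℝ, MeasurableSet {x : E N | r < ‖x‖} := fun r =>
    measurableSet_lt measurable_const measurable_norm
  have h : Tendsto (fun n : ℕ => ∫ x, {x : E N | ((n : ℝ) + 1) / 2 < ‖x‖}.indicator a x) atTop
      (𝓝 (∫ _ : E N, (0 : ℝ))) := by
    refine tendsto_integral_of_dominated_convergence (fun x => ‖a x‖)
      (fun n => (ha.indicator (hms _)).1) ha.norm
      (fun n => ae_of_all _ fun x => norm_indicator_le_norm_self _ _)
      (ae_of_all _ fun x => ?_)
    refine tendsto_const_nhds.congr' ?_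
    filter_upwards [eventually_ge_atTop ⌈2 * ‖x‖⌉₊] with n hn
    have h1 := Nat.le_ceil (2 * ‖x‖)
    have h2 : ((⌈2 * ‖x‖⌉₊ : ℕ) : ℝ) ≤ n := by exact_mod_cast hn
    have h3 : x ∉ {x : E N | ((n : ℝ) + 1) / 2 < ‖x‖} := fun hx => by
      have hx' : ((n : ℝ) + 1) / 2 < ‖x‖ := hx
      linarith
    exact (indicator_of_notMem h3 a).symm
  simp only [integral_zero] at h
  exact h.congr fun n => integral_indicator (hms _)

/-- The Pohozaev identity for bounded solutions in `H¹`. -/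
theorem BoundedSolution.pohozaev {N : ℕ} {h H : ℝ → ℝ} {M L : ℝ} {v : E N → ℝ}
    {w : E N → E N} (s : BoundedSolution h H M L v w) :
    (N : ℝ) * ∫ x, H (v x) = (N - 2) / 2 * ∫ x, ‖w x‖ ^ 2 := by
  obtain ⟨C, hC0, hC, hC'⟩ := exists_cutoff_bound N
  have iw : Integrable (fun x => ‖w x‖ ^ 2) volume := s.sob.memLp_grad.norm.integrable_sq
  have iH := s.integrable_prim
  have t1 := tendsto_integral_cutoff iH
  have t2 := tendsto_integral_cutoff iw
  have t3 := tendsto_setIntegral_tail iw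
  have t4 := tendsto_setIntegral_tail iH.abs
  -- The limits are ordered: with ε fixed, R → ∞ kills every tail, including the one weighted by
  -- C²/ε; only then ε → 0.
  have key : ∀ ε : ℝ, 0 < ε →
      |-(N : ℝ) * (∫ x, H (v x)) - 1 / 2 * ((2 - N) * ∫ x, ‖w x‖ ^ 2)|
        ≤ ε * ((3 * 2 ^ N) ^ 2 * ∫ x, ‖w x‖ ^ 2) := by
    intro ε hε
    have l1 := ((t1.const_mul (-(N : ℝ))).sub
      ((t2.const_mul (2 - (N : ℝ))).const_mul (1 / 2))).abs
    have l2 := (((t3.const_mul (C ^ 2 / ε)).const_add (ε * ((3 * 2 ^ N) ^ 2 * ∫ x, ‖w x‖ ^ 2))).add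
      (t4.const_mul (2 ^ N * (8 * C)))).add ((t3.const_mul (2 ^ N * (8 * C))).const_mul 2)
    simp only [mul_zero, add_zero] at l2
    exact le_of_tendsto_of_tendsto' l1 l2 fun n =>
      s.abs_pohozaev_cutoff_le hC0 hC hC' (by positivity) hε
  have hzero : |-(N : ℝ) * (∫ x, H (v x)) - 1 / 2 * ((2 - N) * ∫ x, ‖w x‖ ^ 2)| ≤ 0 := by
    have hlim : Tendsto (fun ε : ℝ => ε * ((3 * 2 ^ N) ^ 2 * ∫ x, ‖w x‖ ^ 2)) (𝓝[>] 0) (𝓝 0) := by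
      have : Continuous fun ε : ℝ => ε * ((3 * 2 ^ N) ^ 2 * ∫ x, ‖w x‖ ^ 2) := by fun_prop
      simpa using (this.tendsto 0).mono_left nhdsWithin_le_nhds
    refine ge_of_tendsto hlim ?_
    filter_upwards [self_mem_nhdsWithin] with ε hε
    exact key ε hε
  have := abs_eq_zero.1 (le_antisymm hzero (abs_nonneg _))
  linarith

/-! ### The mountain pass level -/

theorem sob_of_H1 {N : ℕ} (v : H1 N) : Sob (fn v) (grad v) :=
  ⟨Lp.memLp _, Lp.memLp _, v.2⟩

theorem measurable_fn {N : ℕ} (v : H1 N) : Measurable (fn v) :=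
  (Lp.stronglyMeasurable v.1.1).measurable

/-- The element of `H¹` given by a Sobolev function. -/
def Sob.toH1 {N : ℕ} {v : E N → ℝ} {w : E N → E N} (h : Sob v w) : H1 N :=
  ⟨(h.memLp.toLp v, h.memLp_grad.toLp w),
    (h.congr h.memLp.coeFn_toLp.symm h.memLp_grad.coeFn_toLp.symm).weak⟩

theorem fn_smul_toH1 {N : ℕ} {v : E N → ℝ} {w : E N → E N} (h : Sob v w) (c : ℝ) :
    fn (c • h.toH1) =ᵐ[volume] fun x => c * v x := by
  filter_upwards [Lp.coeFn_smul c (h.memLp.toLp v), h.memLp.coeFn_toLp] with x h1 h2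
  change (c • h.memLp.toLp v : Lp ℝ 2 (volume : Measure (E N))) x = c * v x
  rw [h1, Pi.smul_apply, h2, smul_eq_mul]

theorem grad_smul_toH1 {N : ℕ} {v : E N → ℝ} {w : E N → E N} (h : Sob v w) (c : ℝ) :
    grad (c • h.toH1) =ᵐ[volume] fun x => c • w x := by
  filter_upwards [Lp.coeFn_smul c (h.memLp_grad.toLp w), h.memLp_grad.coeFn_toLp] with x h1 h2
  change (c • h.memLp_grad.toLp w : Lp (E N) 2 (volume : Measure (E N))) x = c • w x
  rw [h1, Pi.smul_apply, h2]

theorem energy_smul_toH1 {N : ℕ} {v : E N → ℝ} {w : E N → E N} (h : Sob v w) (f : ℝ → ℝ)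
    (lam k c : ℝ) : energy f lam k (c • h.toH1) = 1 / 2 * (c ^ 2 * ∫ x, ‖w x‖ ^ 2)
      + lam / 2 * (∫ x, Ginv k (c * v x) ^ 2) - ∫ x, F f (Ginv k (c * v x)) := by
  have h1 := fn_smul_toH1 h c
  have h2 := grad_smul_toH1 h c
  have e1 : ∫ x, ‖grad (c • h.toH1) x‖ ^ 2 = c ^ 2 * ∫ x, ‖w x‖ ^ 2 := by
    rw [← integral_const_mul]
    refine integral_congr_ae ?_
    filter_upwards [h2] with x hx
    rw [hx, norm_smul, mul_pow, Real.norm_eq_abs, sq_abs]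
  have e2 : ∫ x, Ginv k (fn (c • h.toH1) x) ^ 2 = ∫ x, Ginv k (c * v x) ^ 2 :=
    integral_congr_ae (by filter_upwards [h1] with x hx; rw [hx])
  have e3 : ∫ x, F f (Ginv k (fn (c • h.toH1) x)) = ∫ x, F f (Ginv k (c * v x)) :=
    integral_congr_ae (by filter_upwards [h1] with x hx; rw [hx])
  rw [energy, e1, e2, e3]

theorem integral_Ginv_sq_le {N : ℕ} {v : E N → ℝ} (hv : MemLp v 2 volume) {k : ℝ} (hk : 0 < k)
    (c : ℝ) : ∫ x, Ginv k (c * v x) ^ 2 ≤ 9 * c ^ 2 * ∫ x, v x ^ 2 := by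
  rw [← integral_const_mul]
  refine integral_mono_of_nonneg (ae_of_all _ fun x => sq_nonneg _)
    (hv.integrable_sq.const_mul _) (ae_of_all _ fun x => ?_)
  have := abs_Ginv_le hk (c * v x)
  simp only
  rw [← sq_abs]
  calc |Ginv k (c * v x)| ^ 2 ≤ (3 * |c * v x|) ^ 2 := by gcongr
    _ = 9 * c ^ 2 * v x ^ 2 := by
        rw [mul_pow, sq_abs]
        ring

/-- The mountain pass level is bounded independently of `k`. -/
theorem exists_mpLevel_bound {N : ℕ} {f : ℝ → ℝ} (h1 : CondF1 f) (h2 : CondF2 N f) {lam : ℝ}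
    (hlam : 0 < lam) : ∃ C : ℝ, 0 ≤ C ∧ ∀ k : ℝ, 0 < k → mpLevel N f lam k ≤ C := by
  set φ : E N → ℝ := fun x => cutoffBump N x with hφdef
  have hφ : IsTest φ := isTest_cutoffBump N
  have hS := hφ.sob
  have hφ0 : ∀ x, 0 ≤ φ x := fun x => (cutoffBump N).nonneg
  set A := ∫ x, ‖gradient φ x‖ ^ 2 with hA
  set B := ∫ x, φ x ^ 2 with hB
  have hA0 : 0 ≤ A := integral_nonneg fun x => sq_nonneg _
  have hB0 : 0 ≤ B := integral_nonneg fun x => sq_nonneg _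
  set V := (volume : Measure (E N)).real (Metric.ball 0 1) with hV
  have hV0 : 0 < V := ENNReal.toReal_pos (Metric.measure_ball_pos _ _ one_pos).ne'
    measure_ball_lt_top.ne
  -- Chosen so that at the endpoint S = 2T, where s - T = T, the lower bound T²(2A + 18λB + 1) for
  -- ∫F exceeds the quadratic part T²(2A + 18λB). Neither L nor T involves `k`.
  set L := 2 * (2 * A + 18 * lam * B + 1) / V with hL
  obtain ⟨T, hT0, hT⟩ := exists_quadratic_lower_bound h1 h2 L
  set S := 2 * T with hSdef
  refine ⟨S ^ 2 * (1 / 2 * A + 9 / 2 * lam * B), by positivity, fun k hk => ?_⟩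
  have hquad : ∀ c : ℝ, 1 / 2 * (c ^ 2 * A) + lam / 2 * (∫ x, Ginv k (c * φ x) ^ 2)
      ≤ c ^ 2 * (1 / 2 * A + 9 / 2 * lam * B) := by
    intro c
    have := mul_le_mul_of_nonneg_left (integral_Ginv_sq_le hS.memLp hk c)
      (show 0 ≤ lam / 2 by positivity)
    rw [← hB] at this
    linarith
  have hFnn : ∀ c : ℝ, 0 ≤ c → 0 ≤ ∫ x, F f (Ginv k (c * φ x)) := fun c hc =>
    integral_nonneg fun x => h1.F_nonneg (Ginv_nonneg hk (mul_nonneg hc (hφ0 x)))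
  have hFT : L / 2 * T ^ 2 * V ≤ ∫ x, F f (Ginv k (S * φ x)) := by
    have hFc : Continuous (F f) :=
      continuous_iff_continuousAt.2 fun s => (h1.hasDerivAt_F s).continuousAt
    have hi : Integrable (fun x => F f (Ginv k (S * φ x))) volume := by
      refine (hFc.comp ((continuous_Ginv hk).comp
        (hφ.1.continuous.const_mul S))).integrable_of_hasCompactSupport ?_
      exact hφ.2.comp_left (g := fun s => F f (Ginv k (S * s)))
        (by simp [Ginv_zero hk, F_zero])
    calc L / 2 * T ^ 2 * V = ∫ x in Metric.ball (0 : E N) 1, L / 2 * T ^ 2 := by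
          rw [setIntegral_const, smul_eq_mul, mul_comm]
      _ ≤ ∫ x in Metric.ball (0 : E N) 1, F f (Ginv k (S * φ x)) := by
          refine setIntegral_mono_on (integrableOn_const measure_ball_lt_top.ne) hi.integrableOn
            Metric.isOpen_ball.measurableSet fun x hx => ?_
          have hx1 : φ x = 1 := (cutoffBump N).one_of_mem_closedBall
            (Metric.ball_subset_closedBall hx)
          rw [hx1, mul_one]
          have h3 := hT S (by linarith)
          have h4 := h1.monotone_F (le_Ginv hk (show 0 ≤ S by linarith))
          have e : S - T = T := by rw [hSdef]; ring
          rw [e] at h3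
          exact h3.trans h4
      _ ≤ ∫ x, F f (Ginv k (S * φ x)) := by
          refine setIntegral_le_integral hi (ae_of_all _ fun x => ?_)
          exact h1.F_nonneg (Ginv_nonneg hk (mul_nonneg (by linarith) (hφ0 x)))
  let γ : C(unitInterval, H1 N) := ⟨fun s => ((s : ℝ) * S) • hS.toH1, by fun_prop⟩
  have hγ : γ ∈ paths N f lam k := by
    refine ⟨by simp [γ], ?_⟩
    have e : γ 1 = S • hS.toH1 := by simp [γ]
    rw [e, energy_smul_toH1]
    have h3 := hquad S
    have h4 : L / 2 * T ^ 2 * V = T ^ 2 * (2 * A + 18 * lam * B + 1) := by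
      rw [hL]
      field_simp
    rw [h4] at hFT
    have h5 : S ^ 2 * (1 / 2 * A + 9 / 2 * lam * B) = T ^ 2 * (2 * A + 18 * lam * B) := by
      rw [hSdef]
      ring
    have h6 : 0 < T ^ 2 := by positivity
    rw [h5] at h3
    nlinarith
  have hsup : ⨆ t : unitInterval, energy f lam k (γ t)
      ≤ S ^ 2 * (1 / 2 * A + 9 / 2 * lam * B) := by
    refine Real.iSup_le (fun t => ?_) (by positivity)
    have hc0 : 0 ≤ (t : ℝ) * S := mul_nonneg t.2.1 (by linarith)
    have hcS : (t : ℝ) * S ≤ S := mul_le_of_le_one_left (by linarith) t.2.2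
    change energy f lam k (((t : ℝ) * S) • hS.toH1) ≤ _
    rw [energy_smul_toH1]
    have h3 := hquad ((t : ℝ) * S)
    have h4 := hFnn _ hc0
    have h5 : ((t : ℝ) * S) ^ 2 * (1 / 2 * A + 9 / 2 * lam * B)
        ≤ S ^ 2 * (1 / 2 * A + 9 / 2 * lam * B) := by gcongr
    linarith
  rw [mpLevel]
  -- If the set of path maxima were unbounded below, the real infimum would be 0 by convention,
  -- which also satisfies the bound.
  by_cases hbdd : BddBelow (range fun γ : paths N f lam k =>
      ⨆ t : unitInterval, energy f lam k (γ.1 t))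
  · exact (ciInf_le hbdd ⟨γ, hγ⟩).trans hsup
  · rw [Real.iInf_of_not_bddBelow hbdd]
    positivity

/-! ### Positive solutions as subsolutions -/

/-- A superposition with subcritical growth splits into a square-integrable part and a part in the
dual of the critical Lebesgue space. -/
theorem exists_memLp_add_memLp {N : ℕ} (hN : 3 ≤ N) {v : E N → ℝ} (hvm : Measurable v)
    (hv2 : MemLp v 2 volume)
    (hvp : MemLp v (ENNReal.ofReal (crit N)) volume) {b : ℝ → ℝ} (hb : Continuous b) {C : ℝ}
    (hC : 0 ≤ C) (hbC : ∀ s, |b s| ≤ C * (|s| + |s| ^ (crit N - 1))) :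
    ∃ h₁ h₂ : E N → ℝ, MemLp h₁ 2 volume ∧
      MemLp h₂ (ENNReal.ofReal (crit N / (crit N - 1))) volume ∧ ∀ x, h₁ x + h₂ x = b (v x) := by
  have hp := two_lt_crit hN
  set p := crit N with hpdef
  -- Where |v| ≤ 1 the linear term dominates, since p - 1 ≥ 1, and v ∈ L². Where |v| > 1 the power
  -- dominates, and |v|^(p-1) lies in L^(p/(p-1)).
  have hms : MeasurableSet {x | |v x| ≤ 1} := measurableSet_le hvm.abs measurable_const
  have hbv : Measurable fun x => b (v x) := hb.measurable.comp hvm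
  refine ⟨{x | |v x| ≤ 1}.indicator fun x => b (v x), {x | |v x| ≤ 1}ᶜ.indicator fun x => b (v x),
    ?_, ?_, fun x => congrFun (indicator_self_add_compl {x | |v x| ≤ 1} fun x => b (v x)) x⟩
  · refine MemLp.of_le_mul (c := 2 * C) hv2 (hbv.indicator hms).aestronglyMeasurable
      (ae_of_all _ fun x => ?_)
    by_cases hx : |v x| ≤ 1
    · rw [indicator_of_mem (show x ∈ {x | |v x| ≤ 1} from hx), Real.norm_eq_abs, Real.norm_eq_abs]
      have h1 : |v x| ^ (p - 1) ≤ |v x| := by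
        simpa using Real.rpow_le_rpow_of_exponent_ge_of_imp (abs_nonneg (v x)) hx
          (show (1 : ℝ) ≤ p - 1 by linarith) (fun _ h => by linarith)
      calc |b (v x)| ≤ C * (|v x| + |v x| ^ (p - 1)) := hbC _
        _ ≤ C * (|v x| + |v x|) := by gcongr
        _ = 2 * C * |v x| := by ring
    · rw [indicator_of_notMem (show x ∉ {x | |v x| ≤ 1} from hx), norm_zero]
      positivity
  · have h1 := hvp.norm_rpow_div (ENNReal.ofReal (p - 1))
    rw [← ENNReal.ofReal_div_of_pos (by linarith), ENNReal.toReal_ofReal (by linarith)] at h1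
    refine MemLp.of_le_mul (c := 2 * C) h1 (hbv.indicator hms.compl).aestronglyMeasurable
      (ae_of_all _ fun x => ?_)
    have hnn : 0 ≤ |v x| ^ (p - 1) := by positivity
    by_cases hx : |v x| ≤ 1
    · rw [indicator_of_notMem (show x ∉ {x | |v x| ≤ 1}ᶜ from fun h => h hx), norm_zero]
      positivity
    · rw [indicator_of_mem (show x ∈ {x | |v x| ≤ 1}ᶜ from hx), Real.norm_eq_abs,
        Real.norm_of_nonneg (by positivity), Real.norm_eq_abs]
      have h2 : |v x| ≤ |v x| ^ (p - 1) :=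
        Real.self_le_rpow_of_one_le (le_of_not_ge hx) (by linarith)
      calc |b (v x)| ≤ C * (|v x| + |v x| ^ (p - 1)) := hbC _
        _ ≤ C * (|v x| ^ (p - 1) + |v x| ^ (p - 1)) := by gcongr
        _ = 2 * C * |v x| ^ (p - 1) := by ring

theorem holderConjugate_crit {N : ℕ} (hN : 3 ≤ N) :
    ENNReal.HolderConjugate (ENNReal.ofReal (crit N / (crit N - 1)))
      (ENNReal.ofReal (crit N)) := by
  have hp := two_lt_crit hN
  exact (Real.HolderConjugate.conjExponent (show 1 < crit N by linarith)).symm.ennrealOfReal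

/-- Growth of the transformed nonlinearity. -/
theorem exists_rhs_growth {f : ℝ → ℝ} (hf : CondF1 f) {lam k q p : ℝ} (hlam : 0 < lam)
    (hk : 0 < k) (hq : 2 < q) (hqp : q ≤ p) {K : ℝ} (hK : 0 < K)
    (hfK : ∀ u : ℝ, 0 ≤ u → f u ≤ lam * u + K * u ^ (q - 1)) :
    ∃ C : ℝ, 0 ≤ C ∧ ∀ s, |rhs f lam k s| ≤ C * (|s| + |s| ^ (p - 1)) := by
  refine ⟨18 * lam + 3 * K * 3 ^ (q - 1), by positivity, fun s => ?_⟩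
  set u := Ginv k s with hu
  have hus : |u| ≤ 3 * |s| := abs_Ginv_le hk s
  have hs0 := abs_nonneg s
  have h1 : ext f u ≤ lam * |u| + K * |u| ^ (q - 1) := by
    rw [ext]
    refine (hfK _ (le_max_right _ _)).trans ?_
    have : max u 0 ≤ |u| := max_le (le_abs_self u) (abs_nonneg u)
    have h0 : 0 ≤ max u 0 := le_max_right _ _
    gcongr
    linarith
  have h2 : |u| ^ (q - 1) ≤ 3 ^ (q - 1) * |s| ^ (q - 1) := by
    rw [← Real.mul_rpow (by norm_num) hs0]
    gcongr
    linarith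
  have h3 : |s| ^ (q - 1) ≤ |s| + |s| ^ (p - 1) := by
    rcases le_total |s| 1 with h | h
    · have : |s| ^ (q - 1) ≤ |s| := by
        simpa using Real.rpow_le_rpow_of_exponent_ge_of_imp hs0 h
          (show (1 : ℝ) ≤ q - 1 by linarith) (fun _ h => by linarith)
      have : 0 ≤ |s| ^ (p - 1) := by positivity
      linarith
    · have : |s| ^ (q - 1) ≤ |s| ^ (p - 1) :=
        Real.rpow_le_rpow_of_exponent_le h (by linarith)
      linarith
  have hp0 : 0 ≤ |s| ^ (p - 1) := by positivity
  rw [rhs, div_eq_mul_inv, abs_mul, abs_of_pos (inv_pos.2 (g_pos hk _))]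
  calc |ext f u - lam * u| * (g k u)⁻¹ ≤ (ext f u + lam * |u|) * 3 := by
        refine mul_le_mul ?_ (inv_g_le_three hk u) (inv_g_nonneg hk u) ?_
        · refine (abs_sub _ _).trans ?_
          rw [abs_of_nonneg (hf.ext_nonneg u), abs_mul, abs_of_pos hlam]
        · have := hf.ext_nonneg u
          positivity
    _ ≤ ((lam * |u| + K * |u| ^ (q - 1)) + lam * |u|) * 3 := by gcongr
    _ ≤ ((lam * (3 * |s|) + K * (3 ^ (q - 1) * (|s| + |s| ^ (p - 1)))) + lam * (3 * |s|)) * 3 := by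
        gcongr
        exact h2.trans (by gcongr)
    _ ≤ _ := by nlinarith

/-- The weak equation tested against Sobolev functions. -/
theorem IsWeakSolution.sobolev {N : ℕ} (hN : 3 ≤ N) {f : ℝ → ℝ} (hf : CondF1 f)
    {lam k q : ℝ} (hlam : 0 < lam) (hk : 0 < k) (hq : 2 < q) (hqp : q < crit N) {K : ℝ}
    (hK : 0 < K) (hfK : ∀ u : ℝ, 0 ≤ u → f u ≤ lam * u + K * u ^ (q - 1)) {v : H1 N}
    (hv : IsWeakSolution f lam k v) {φ : E N → ℝ} {w' : E N → E N} (hφ : Sob φ w') :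
    Integrable (fun x => rhs f lam k (fn v x) * φ x) volume ∧
      ∫ x, inner ℝ (grad v x) (w' x) = ∫ x, rhs f lam k (fn v x) * φ x := by
  obtain ⟨C, hC, hgrow⟩ := exists_rhs_growth hf hlam hk hq hqp.le hK hfK
  obtain ⟨S, hS0, hS⟩ := exists_sobolev_const hN
  have hSv := sob_of_H1 v
  have hcrit : ∀ {u : E N → ℝ} {u' : E N → E N}, Sob u u' →
      MemLp u (ENNReal.ofReal (crit N)) volume := fun {u u'} hu =>
    ⟨hu.memLp.1, (hS u u' hu).trans_lt (ENNReal.mul_lt_top ENNReal.ofReal_lt_top hu.memLp_grad.2)⟩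
  obtain ⟨h₁, h₂, hh₁, hh₂, hsum⟩ := exists_memLp_add_memLp hN (measurable_fn v) hSv.memLp
    (hcrit hSv) (continuous_rhs hf lam hk) hC hgrow
  have := holderConjugate_crit hN
  -- The linear term is square integrable by itself, so it can be split off both sides of the weak
  -- equation and moved into h.
  have hlin : MemLp (fun x => lam * (Ginv k (fn v x) / g k (Ginv k (fn v x)))) 2 volume := by
    have hc : Continuous fun s => lam * (Ginv k s / g k (Ginv k s)) :=
      ((continuous_Ginv hk).div ((continuous_g hk).comp (continuous_Ginv hk))
        fun s => (g_pos hk _).ne').const_mul lam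
    refine MemLp.of_le_mul (c := lam * 9) hSv.memLp (hc.comp_aestronglyMeasurable hSv.memLp.1)
      (ae_of_all _ fun x => ?_)
    rw [norm_mul, Real.norm_of_nonneg hlam.le, norm_div, Real.norm_eq_abs, Real.norm_eq_abs,
      Real.norm_eq_abs, abs_of_pos (g_pos hk _), div_eq_mul_inv, mul_assoc]
    refine mul_le_mul_of_nonneg_left ?_ hlam.le
    calc |Ginv k (fn v x)| * (g k (Ginv k (fn v x)))⁻¹ ≤ (3 * |fn v x|) * 3 :=
          mul_le_mul (abs_Ginv_le hk _) (inv_g_le_three hk _) (inv_g_nonneg hk _) (by positivity)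
      _ = 9 * |fn v x| := by ring
  have htest : ∀ φ : E N → ℝ, IsTest φ →
      ∫ x, inner ℝ (grad v x) (gradient φ x) = ∫ x, (h₁ x + h₂ x) * φ x := by
    intro φ hφ
    have hm := hφ.sob
    have i1 : Integrable (fun x => h₁ x * φ x + h₂ x * φ x) volume :=
      (hh₁.integrable_mul hm.memLp).add (hh₂.integrable_mul (hcrit hm))
    have i2 : Integrable (fun x => lam * (Ginv k (fn v x) / g k (Ginv k (fn v x))) * φ x) volume :=
      hlin.integrable_mul hm.memLp
    have i3 : Integrable (fun x => inner ℝ (grad v x) (gradient φ x)) volume :=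
      (hSv.memLp_grad.norm.integrable_mul hm.memLp_grad.norm).mono'
        (hSv.memLp_grad.1.inner hm.memLp_grad.1) (ae_of_all _ fun x => norm_inner_le_norm _ _)
    have h3 := hv φ hφ
    have e1 : ∫ x, (fderiv ℝ φ x (grad v x)
        + lam * (Ginv k (fn v x) / g k (Ginv k (fn v x))) * φ x)
        = (∫ x, inner ℝ (grad v x) (gradient φ x))
          + ∫ x, lam * (Ginv k (fn v x) / g k (Ginv k (fn v x))) * φ x := by
      rw [← integral_add i3 i2]
      refine integral_congr_ae (ae_of_all _ fun x => ?_)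
      simp only
      rw [real_inner_comm, inner_gradient]
    have e2 : ∫ x, ext f (Ginv k (fn v x)) / g k (Ginv k (fn v x)) * φ x
        = (∫ x, (h₁ x + h₂ x) * φ x)
          + ∫ x, lam * (Ginv k (fn v x) / g k (Ginv k (fn v x))) * φ x := by
      rw [← integral_add (by simpa only [add_mul] using i1) i2]
      refine integral_congr_ae (ae_of_all _ fun x => ?_)
      simp only [hsum, rhs]
      ring
    rw [e1, e2] at h3
    linarith
  have := Sob.weak_equation hN hSv.memLp_grad hh₁ hh₂ htest hφ
  simpa only [hsum] using this

theorem ofReal_integral_le_lintegral {α : Type*} [MeasurableSpace α] {μ : Measure α} {a : α → ℝ}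
    (ha : Integrable a μ) : ENNReal.ofReal (∫ x, a x ∂μ) ≤ ∫⁻ x, ENNReal.ofReal (a x) ∂μ := by
  have h1 : ∫ x, a x ∂μ ≤ ∫ x, max (a x) 0 ∂μ :=
    integral_mono ha ha.pos_part fun x => le_max_left _ _
  refine (ENNReal.ofReal_le_ofReal h1).trans ?_
  rw [ofReal_integral_eq_lintegral_ofReal ha.pos_part (ae_of_all _ fun x => le_max_right _ _)]
  refine lintegral_mono fun x => ?_
  simp [ENNReal.ofReal_max]

/-- Positive solutions are subsolutions of a subcritical power equation, uniformly in `k`. -/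
theorem IsMPSolution.isPowerSubsolution {N : ℕ} (hN : 3 ≤ N) {f : ℝ → ℝ} (hf : CondF1 f)
    {lam k q : ℝ} (hlam : 0 < lam) (hk : 0 < k) (hq : 2 < q) (hqp : q < crit N) {K : ℝ}
    (hK : 0 < K) (hfK : ∀ u : ℝ, 0 ≤ u → f u ≤ lam * u + K * u ^ (q - 1)) {v : H1 N}
    (hv : IsMPSolution f lam k v) :
    IsPowerSubsolution (3 * K * 3 ^ (q - 1)) q (fn v) (grad v) := by
  intro ψ θ hψ hθ hθ0 hθ1 hψ0
  have hSv := sob_of_H1 v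
  have hψS := hSv.comp hψ hθ (fun s => by rw [abs_of_nonneg (hθ0 s)]; exact hθ1 s) hψ0
  obtain ⟨hint, heq⟩ := hv.sol.sobolev hN hf hlam hk hq hqp hK hfK hψS
  have hψnn : ∀ s, 0 ≤ s → 0 ≤ ψ s := fun s hs => by
    have := monotone_of_hasDerivAt_nonneg hψ hθ0 hs
    rwa [hψ0] at this
  have i1 : Integrable (fun x => θ (fn v x) * ‖grad v x‖ ^ 2) volume :=
    hSv.memLp_grad.norm.integrable_sq.bdd_mul (c := 1)
      (hθ.comp_aestronglyMeasurable hSv.memLp.1) (ae_of_all _ fun x => by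
        rw [Real.norm_of_nonneg (hθ0 _)]
        exact hθ1 _)
  have e1 : ∫ x, inner ℝ (grad v x) (θ (fn v x) • grad v x)
      = ∫ x, θ (fn v x) * ‖grad v x‖ ^ 2 := by
    refine integral_congr_ae (ae_of_all _ fun x => ?_)
    simp only
    rw [real_inner_smul_right, real_inner_self_eq_norm_sq]
  rw [e1] at heq
  calc ∫⁻ x, ENNReal.ofReal (θ (fn v x)) * ‖grad v x‖ₑ ^ 2
      = ENNReal.ofReal (∫ x, θ (fn v x) * ‖grad v x‖ ^ 2) := by
        rw [ofReal_integral_eq_lintegral_ofReal i1 (ae_of_all _ fun x =>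
          mul_nonneg (hθ0 _) (sq_nonneg _))]
        refine lintegral_congr fun x => ?_
        rw [ENNReal.ofReal_mul (hθ0 _), ENNReal.ofReal_pow (norm_nonneg _), ofReal_norm]
    _ ≤ ∫⁻ x, ENNReal.ofReal (rhs f lam k (fn v x) * ψ (fn v x)) := by
        rw [heq]
        exact ofReal_integral_le_lintegral hint
    _ ≤ ∫⁻ x, ENNReal.ofReal (3 * K * 3 ^ (q - 1))
          * ENNReal.ofReal (fn v x ^ (q - 1) * ψ (fn v x)) := by
        refine lintegral_mono_ae ?_
        filter_upwards [hv.pos] with x hx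
        rw [← ENNReal.ofReal_mul (by positivity)]
        refine ENNReal.ofReal_le_ofReal ?_
        rw [← mul_assoc]
        refine mul_le_mul_of_nonneg_right ?_ (hψnn _ hx.le)
        have hu0 := Ginv_nonneg hk hx.le
        rw [rhs, ext_of_nonneg f hu0, div_eq_mul_inv]
        -- The linear coefficient of the growth bound is exactly λ, so the zero-order term of the
        -- equation cancels it and a pure power remains.
        have h1 := hfK _ hu0
        calc (f (Ginv k (fn v x)) - lam * Ginv k (fn v x)) * (g k (Ginv k (fn v x)))⁻¹
            ≤ (K * Ginv k (fn v x) ^ (q - 1)) * (g k (Ginv k (fn v x)))⁻¹ := by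
              refine mul_le_mul_of_nonneg_right ?_ (inv_g_nonneg hk _)
              linarith
          _ ≤ (K * (3 * fn v x) ^ (q - 1)) * 3 := by
              refine mul_le_mul ?_ (inv_g_le_three hk _) (inv_g_nonneg hk _) (by positivity)
              refine mul_le_mul_of_nonneg_left ?_ hK.le
              exact Real.rpow_le_rpow hu0 (Ginv_le hk hx.le) (by linarith)
          _ = 3 * K * 3 ^ (q - 1) * fn v x ^ (q - 1) := by
              rw [Real.mul_rpow (by norm_num) hx.le]
              ring
    _ = _ := lintegral_const_mul' _ _ ENNReal.ofReal_ne_top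

/-! ### Dirichlet energy at the mountain pass level and conclusion -/

/-- For a solution at the mountain pass level the Dirichlet energy is `N` times the level. -/
theorem IsMPSolution.integral_grad_sq {N : ℕ} (hN : 3 ≤ N) {f : ℝ → ℝ} (hf : CondF1 f)
    (hf2 : CondF2 N f) {lam k : ℝ} (hlam : 0 < lam) (hk : 0 < k) {v : H1 N}
    (hv : IsMPSolution f lam k v) : ∫ x, ‖grad v x‖ ^ 2 = N * mpLevel N f lam k := by
  obtain ⟨q, hq, hqp, hgr⟩ := exists_growth_bound hf hf2
  obtain ⟨K, hK, hfK⟩ := hgr lam hlam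
  have hSv := sob_of_H1 v
  obtain ⟨M, hM, hbd⟩ := exists_bound_of_isPowerSubsolution hN
    (show 0 < 3 * K * 3 ^ (q - 1) by positivity) hq hqp (eLpNorm (grad v) 2 volume).toReal
  have hle := hbd _ _ hSv (measurable_fn v) (hv.pos.mono fun x hx => hx.le)
    (ENNReal.ofReal_toReal hSv.memLp_grad.2.ne).ge
    (hv.isPowerSubsolution hN hf hlam hk hq hqp hK hfK)
  -- A representative with values in [0, M] at every point, so that the Taylor estimates apply at x
  -- and at tx alike.
  set v' : E N → ℝ := fun x => max 0 (min M (fn v x)) with hv'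
  have hae : fn v =ᵐ[volume] v' := by
    filter_upwards [hle, hv.pos] with x h1 h2
    rw [hv']
    simp only
    rw [min_eq_right h1, max_eq_right h2.le]
  obtain ⟨L, hL, hT, hb1, hb2⟩ := exists_rhsPrim_taylor hf lam hk hM.le
  have hprim : Continuous (rhsPrim f lam k) :=
    continuous_iff_continuousAt.2 fun s => (hasDerivAt_rhsPrim hf lam hk s).continuousAt
  have hsol : BoundedSolution (rhs f lam k) (rhsPrim f lam k) M L v' (grad v) :=
    { sob := hSv.congr hae (ae_eq_refl _)
      mem := fun x => ⟨le_max_left _ _, max_le hM.le (min_le_left _ _)⟩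
      cont := continuous_rhs hf lam hk
      contPrim := hprim
      nonneg := hL
      taylor := hT
      bound := hb1
      boundPrim := hb2
      equation := fun φ w' hφ => by
        rw [(hv.sol.sobolev hN hf hlam hk hq hqp hK hfK hφ).2]
        refine integral_congr_ae ?_
        filter_upwards [hae] with x hx
        rw [hx] }
  have hpoh := hsol.pohozaev
  have eP : ∫ x, rhsPrim f lam k (v' x) = ∫ x, rhsPrim f lam k (fn v x) :=
    integral_congr_ae (by filter_upwards [hae] with x hx; rw [hx])
  have iP : Integrable (fun x => rhsPrim f lam k (fn v x)) volume :=
    hsol.integrable_prim.congr (by filter_upwards [hae] with x hx; rw [hx])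
  have iG : Integrable (fun x => Ginv k (fn v x) ^ 2) volume := by
    have : MemLp (fun x => Ginv k (fn v x)) 2 volume :=
      MemLp.of_le_mul (c := 3) hSv.memLp
        ((continuous_Ginv hk).comp_aestronglyMeasurable hSv.memLp.1)
        (ae_of_all _ fun x => abs_Ginv_le hk _)
    exact this.integrable_sq
  have eF : ∫ x, F f (Ginv k (fn v x))
      = (∫ x, rhsPrim f lam k (fn v x)) + lam / 2 * ∫ x, Ginv k (fn v x) ^ 2 := by
    rw [← integral_const_mul, ← integral_add iP (iG.const_mul _)]
    refine integral_congr_ae (ae_of_all _ fun x => ?_)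
    simp [rhsPrim]
  rw [eP] at hpoh
  have hN' : (0 : ℝ) < N := by
    have : 0 < N := by omega
    exact_mod_cast this
  -- The level is ½∫|∇v|² - ∫H(v), and Pohozaev makes this (½ - (N-2)/(2N))∫|∇v|² = (1/N)∫|∇v|².
  have hlev := hv.level
  rw [energy, eF] at hlev
  rw [← hlev]
  linarith

end QLS

end

theorem proposition6p1 (N : ℕ) (hN : 3 ≤ N) (f : ℝ → ℝ) (hF1 : QLS.CondF1 f)
    (hF2 : QLS.CondF2 N f) (lam : ℝ) (hlam : 0 < lam) :
    ∃ C₁ : ℝ, 0 < C₁ ∧ ∀ k : ℝ, 0 < k → ∀ v : QLS.H1 N, QLS.IsMPSolution f lam k v →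
      MeasureTheory.eLpNorm (QLS.fn v) ⊤ MeasureTheory.volume ≤ ENNReal.ofReal C₁ := by
  obtain ⟨q, hq, hqp, hgr⟩ := QLS.exists_growth_bound hF1 hF2
  obtain ⟨K, hK, hfK⟩ := hgr lam hlam
  obtain ⟨C, hC, hlev⟩ := QLS.exists_mpLevel_bound hF1 hF2 hlam
  -- The bound is fixed before `k`: the gradient norm squared is N m_λ ≤ NC, and K, q, C depend only
  -- on N, f and λ.
  obtain ⟨M, hM, hbd⟩ := QLS.exists_bound_of_isPowerSubsolution hN
    (show 0 < 3 * K * 3 ^ (q - 1) by positivity) hq hqp √(N * C)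
  refine ⟨M, hM, fun k hk v hv => ?_⟩
  have hSv := QLS.sob_of_H1 v
  have hgrad : eLpNorm (QLS.grad v) 2 volume ≤ ENNReal.ofReal √(N * C) := by
    refine (ENNReal.pow_le_pow_left_iff two_ne_zero).1 ?_
    rw [← QLS.ofReal_integral_norm_sq hSv.memLp_grad, ← ENNReal.ofReal_pow (Real.sqrt_nonneg _),
      Real.sq_sqrt (by positivity), hv.integral_grad_sq hN hF1 hF2 hlam hk]
    refine ENNReal.ofReal_le_ofReal ?_
    gcongr
    exact hlev k hk
  have hle := hbd _ _ hSv (QLS.measurable_fn v) (hv.pos.mono fun x hx => hx.le) hgrad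
    (hv.isPowerSubsolution hN hF1 hlam hk hq hqp hK hfK)
  rw [eLpNorm_exponent_top]
  refine eLpNormEssSup_le_of_ae_bound ?_
  filter_upwards [hle, hv.pos] with x h1 h2
  rwa [Real.norm_of_nonneg h2.le]
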